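/- **Setting.** All families are indexed by a security parameter $\kappa$. "Efficient" means: computed by (randomized) Boolean circuits of size polynomial in $\kappa$; $\approx_c$ means that every family of polynomial-size circuits has negligible distinguishing advantage, uniformly over all inputs. Parties are semi-honest, and a party's view consists of its input, its random coins and the messages it receives. A model owner (MO) holds the weights $M$ of a feed-forward network with public architecture over $\mathbb{Z}_t$, $t=2^{\ell}$; a data owner (DO) holds training data $D$, given as the batches $(X^{(\tau)},t^{(\tau)})$ that it uses in the $T$ training iterations, together with the (arbitrary, possibly zero) perturbations $e^{(\tau)}$ that it adds to the gradients. The bit length $\ell$, the size of the network and $T$ are polynomial in $\kappa$, and the non-linear functions, the gradient of the loss and MO's update rule are efficiently computable. Linear layers are $Y=W\circ X+b$ with $\circ$ bilinear; non-linear layers are arbitrary, with a forward map and a backward map. **Pencil (without preprocessing).** DO generates keys of a homomorphic encryption scheme and sends the public key. All intermediate tensors and gradients are additively shared; in each iteration the initial shares of the batch are $0$ (MO) and $X^{(\tau)}$ (DO). - *Linear forward*: DO sends $[\![X_1]\!]$; MO returns $[\![W\circ(X_0+X_1)-s]\!]$ for a uniformly random $s$ and keeps $s+b$; DO keeps the decryption.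 The gradient $\nabla_X$ is computed likewise, with the transposed operator and without bias, and is then truncated by a secure two-party protocol. - *Bias gradient*: DO sends its share of $\nabla_b$ plus its perturbation. - *Weight gradient*: write $\nabla_Y\odot X$ for the gradient of the weights. DO sends $[\![X_1]\!],[\![(\nabla_Y)_1]\!]$; MO returns $[\![(\nabla_Y)_0\odot X_1+(\nabla_Y)_1\odot X_0-s]\!]$; DO decrypts, adds $(\nabla_Y)_1\odot X_1$ and its perturbation and sends the result; MO adds $s+(\nabla_Y)_0\odot X_0$. - *Non-linear layers* are evaluated, forward and backward, by two-party protocols on shares. - *Output*: MO reveals its share of the output to DO, which obtains the prediction and the gradient of the loss. MO updates the model with the perturbed gradients. **Theorem.** Assume that 1. the homomorphic encryption scheme is efficient, supports affine evaluation of one or two ciphertexts with perfect correctness, has indistinguishable encryptions, and is function private: even for the owner of the secret key and of the input ciphertexts, an evaluated ciphertext can be efficiently simulated from the keys, the input ciphertexts and the plaintext of the result; 2. the two-party protocols for the non-linear parts (which are typically built from oblivious transfer) correctly and, against semi-honest parties, securely evaluate the functionality that maps shares of $x$ to uniformly random shares of $\varphi(x)$, where $\varphi$ is the respective function. Then Pencil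 is a cryptographic training protocol: - *Correctness.* For all $M$ and $D$, with probability one MO outputs exactly the series of (perturbed) gradients and the final model of plaintext training over $\mathbb{Z}_t$, and DO outputs the model's predictions on its batches. - *Data privacy.* There is an efficient simulator with $\mathsf{View}_{MO}\approx_c\mathsf{Sim}_{MO}(M,\mathsf{out})$, where $\mathsf{out}$ is MO's output (the weight updates and the final model). - *Model privacy.* There is an efficient simulator with $\mathsf{View}_{DO}\approx_c\mathsf{Sim}_{DO}(D,\mathsf{pred})$, where $\mathsf{pred}$ is the series of the model's predictions on DO's batches. -/

import Mathlib

noncomputable section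

namespace Pencil

/-! # Finite data and Boolean circuits -/

abbrev Bits (n : ℕ) : Type := Fin n → Bool

/-- A type of data together with an injective encoding into bit strings; the positions of the
bit string are indexed by the finite type `Wire`. -/
class BitData (α : Type) : Type 1 where
  Wire : Type
  [fintypeWire : Fintype Wire]
  encode : α → Wire → Bool
  encode_injective : Function.Injective encode

attribute [instance] BitData.fintypeWire

/-- The number of bits of an encoded element of `α`. -/
def bitLength (α : Type) [BitData α] : ℕ := Fintype.card (BitData.Wire α)

instance bitDataUnit : BitData Unit where
  Wire := Empty
  encode _ w := w.elim
  encode_injective _ _ _ := rfl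

instance : BitData Bool where
  Wire := Unit
  encode b _ := b
  encode_injective _ _ h := congrFun h ()

instance bitDataProd {α β : Type} [BitData α] [BitData β] : BitData (α × β) where
  Wire := BitData.Wire α ⊕ BitData.Wire β
  encode a := Sum.elim (BitData.encode a.1) (BitData.encode a.2)
  encode_injective := by
    intro a b h
    refine Prod.ext (BitData.encode_injective ?_) (BitData.encode_injective ?_)
    · funext w
      exact congrFun h (Sum.inl w)
    · funext w
      exact congrFun h (Sum.inr w)

instance {n : ℕ} {α : Type} [BitData α] : BitData (Fin n → α) where
  Wire := Fin n × BitData.Wire α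
  encode f w := BitData.encode (f w.1) w.2
  encode_injective := by
    intro f g h
    funext i
    refine BitData.encode_injective ?_
    funext w
    exact congrFun h (i, w)

instance {m n : ℕ} {α : Type} [BitData α] : BitData (Matrix (Fin m) (Fin n) α) :=
  inferInstanceAs (BitData (Fin m → Fin n → α))

/-- Elements of `ℤ / 2 ^ l` are encoded by the `l` binary digits of the representative in
`[0, 2 ^ l)`. -/
instance (l : ℕ) : BitData (ZMod (2 ^ l)) where
  Wire := Fin l
  encode x i := x.val.testBit i
  encode_injective := by
    intro x y h
    refine ZMod.val_injective _ (Nat.eq_of_testBit_eq fun i => ?_)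
    by_cases hi : i < l
    · exact congrFun h ⟨i, hi⟩
    · have hle : 2 ^ l ≤ 2 ^ i := Nat.pow_le_pow_right (by norm_num) (not_lt.mp hi)
      rw [Nat.testBit_lt_two_pow ((ZMod.val_lt x).trans_le hle),
        Nat.testBit_lt_two_pow ((ZMod.val_lt y).trans_le hle)]

/-- Boolean circuits with input wires `I` and output wires `O`, over the gates NAND and the two
constants, with arbitrary fan-out. -/
inductive Circuit : Type → Type → Type 1
  | wire {I O : Type} [Fintype O] (f : O → I) : Circuit I O
  | const {I : Type} (b : Bool) : Circuit I Unit
  | nand {I : Type} (i j : I) : Circuit I Unit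
  | comp {I J K : Type} (C : Circuit I J) (D : Circuit J K) : Circuit I K
  | pair {I J K : Type} (C : Circuit I J) (D : Circuit I K) : Circuit I (J ⊕ K)

/-- The size of a circuit: the number of its gates and of the wires that it copies. -/
def Circuit.size {I O : Type} : Circuit I O → ℕ
  | @Circuit.wire _ O _ _ => Fintype.card O
  | .const _ => 1
  | .nand _ _ => 1
  | .comp C D => C.size + D.size
  | .pair C D => C.size + D.size

def Circuit.eval {I O : Type} : Circuit I O → (I → Bool) → O → Bool
  | @Circuit.wire _ _ _ f, x => fun o => x (f o)
  | .const b, _ => fun _ => b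
  | .nand i j, x => fun _ => !(x i && x j)
  | .comp C D, x => D.eval (C.eval x)
  | .pair C D, x => Sum.elim (C.eval x) (D.eval x)

/-! # Efficiency and computational indistinguishability

The security parameter is `κ`. Families are indexed by `κ` and, for every `κ`, by a further index
`i : ι κ`; all bounds are uniform in `i`. -/

/-- A family of functions is computed by circuits of size polynomial in `κ` (the length of the
input is polynomial, too). -/
def PolySize {ι : ℕ → Type} {α β : ∀ κ, ι κ → Type} [∀ κ i, BitData (α κ i)]
    [∀ κ i, BitData (β κ i)] (f : ∀ κ i, α κ i → β κ i) : Prop :=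
  ∃ p : Polynomial ℕ, ∀ κ i,
    ∃ C : Circuit (BitData.Wire (α κ i)) (BitData.Wire (β κ i)),
      bitLength (α κ i) + C.size ≤ p.eval κ ∧
      ∀ a, C.eval (BitData.encode a) = BitData.encode (f κ i a)

/-- A family of randomized functions is sampled by circuits of size polynomial in `κ` from
uniformly random bits: these are the efficient algorithms. -/
def PolySampler {ι : ℕ → Type} {α β : ∀ κ, ι κ → Type} [∀ κ i, BitData (α κ i)]
    [∀ κ i, BitData (β κ i)] (F : ∀ κ i, α κ i → PMF (β κ i)) : Prop :=
  ∃ p : Polynomial ℕ, ∀ κ i, ∃ (r : ℕ)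
    (C : Circuit (BitData.Wire (α κ i) ⊕ Fin r) (BitData.Wire (β κ i))),
      bitLength (α κ i) + r + C.size ≤ p.eval κ ∧
      ∀ a, (PMF.uniformOfFintype (Bits r)).map (fun ρ => C.eval (Sum.elim (BitData.encode a) ρ)) =
        (F κ i a).map BitData.encode

/-- The probability that the circuit `D` accepts a sample of `X`. -/
def acceptProb {α : Type} [BitData α] (X : PMF α) (D : Circuit (BitData.Wire α) Unit) : ℝ :=
  ((X.map fun a => D.eval (BitData.encode a) ()) true).toReal

/-- Computational indistinguishability of two families of distributions: every
polynomial-size distinguisher has negligible advantage. -/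
def Indist {ι : ℕ → Type} {α : ∀ κ, ι κ → Type} [∀ κ i, BitData (α κ i)]
    (X Y : ∀ κ i, PMF (α κ i)) : Prop :=
  ∀ p : Polynomial ℕ, ∃ μ : ℕ → ℝ,
    Asymptotics.SuperpolynomialDecay Filter.atTop (fun κ : ℕ => (κ : ℝ)) μ ∧
    ∀ κ i (D : Circuit (BitData.Wire (α κ i)) Unit), D.size ≤ p.eval κ →
      |acceptProb (X κ i) D - acceptProb (Y κ i) D| ≤ μ κ

/-! # Two-party protocols

A protocol in `Proto A B A' B'` is run by party 0, whose local state is of type `A` before and `A'`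
after the run, and party 1, whose local state is of type `B` before and `B'` after the run. -/

inductive Proto : Type → Type → Type → Type → Type 1
  /-- deterministic local computation of both parties -/
  | loc {A B A' B' : Type} (f : A → A') (g : B → B') : Proto A B A' B'
  /-- party 0 tosses coins, uniform over `C` -/
  | coin₀ {A B : Type} (C : Type) [BitData C] [Fintype C] [Nonempty C] : Proto A B (A × C) B
  /-- party 1 tosses coins, uniform over `C` -/
  | coin₁ {A B : Type} (C : Type) [BitData C] [Fintype C] [Nonempty C] : Proto A B A (B × C)
  /-- party 0 sends a message to party 1 -/
  | send₀ {A B M : Type} [BitData M] (f : A → M) : Proto A B A (B × M)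
  /-- party 1 sends a message to party 0 -/
  | send₁ {A B M : Type} [BitData M] (f : B → M) : Proto A B (A × M) B
  /-- sequential composition -/
  | seq {A B A' B' A'' B'' : Type} (p : Proto A B A' B') (q : Proto A' B' A'' B'') :
      Proto A B A'' B''
  /-- a run of `p` during which the parties keep further local data -/
  | frame {S R A B A' B' : Type} (p : Proto A B A' B') : Proto (S × A) (R × B) (S × A') (R × B')

infixl:65 " ⨟ " => Proto.seq

/-- Run `p` on inputs computed locally from the states, and append the outputs to the states. -/
def Proto.call {S R A B A' B' : Type} (p : Proto A B A' B') (f : S → A) (g : R → B) :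
    Proto S R (S × A') (R × B') :=
  Proto.loc (fun s => (s, f s)) (fun r => (r, g r)) ⨟ Proto.frame p

/-- What party 0 sees in a run besides its input: its coins and the messages that it receives. -/
def Proto.Seen₀ {A B A' B' : Type} : Proto A B A' B' → Type
  | .loc _ _ => Unit
  | @Proto.coin₀ _ _ C _ _ _ => C
  | @Proto.coin₁ _ _ _ _ _ _ => Unit
  | @Proto.send₀ _ _ _ _ _ => Unit
  | @Proto.send₁ _ _ M _ _ => M
  | .seq p q => p.Seen₀ × q.Seen₀
  | .frame p => p.Seen₀

/-- What party 1 sees in a run besides its input. -/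
def Proto.Seen₁ {A B A' B' : Type} : Proto A B A' B' → Type
  | .loc _ _ => Unit
  | @Proto.coin₀ _ _ _ _ _ _ => Unit
  | @Proto.coin₁ _ _ C _ _ _ => C
  | @Proto.send₀ _ _ M _ _ => M
  | @Proto.send₁ _ _ _ _ _ => Unit
  | .seq p q => p.Seen₁ × q.Seen₁
  | .frame p => p.Seen₁

@[reducible]
def Proto.bitDataSeen₀ {A B A' B' : Type} : (p : Proto A B A' B') → BitData p.Seen₀
  | .loc _ _ => bitDataUnit
  | @Proto.coin₀ _ _ _ h _ _ => h
  | @Proto.coin₁ _ _ _ _ _ _ => bitDataUnit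
  | @Proto.send₀ _ _ _ _ _ => bitDataUnit
  | @Proto.send₁ _ _ _ h _ => h
  | .seq p q => @bitDataProd _ _ p.bitDataSeen₀ q.bitDataSeen₀
  | .frame p => p.bitDataSeen₀

@[reducible]
def Proto.bitDataSeen₁ {A B A' B' : Type} : (p : Proto A B A' B') → BitData p.Seen₁
  | .loc _ _ => bitDataUnit
  | @Proto.coin₀ _ _ _ _ _ _ => bitDataUnit
  | @Proto.coin₁ _ _ _ h _ _ => h
  | @Proto.send₀ _ _ _ h _ => h
  | @Proto.send₁ _ _ _ _ _ => bitDataUnit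
  | .seq p q => @bitDataProd _ _ p.bitDataSeen₁ q.bitDataSeen₁
  | .frame p => p.bitDataSeen₁

instance {A B A' B' : Type} (p : Proto A B A' B') : BitData p.Seen₀ := p.bitDataSeen₀

instance {A B A' B' : Type} (p : Proto A B A' B') : BitData p.Seen₁ := p.bitDataSeen₁

/-- The joint distribution of what the two parties see and of their outputs (final states). -/
def Proto.exec {A B A' B' : Type} :
    (p : Proto A B A' B') → A → B → PMF ((p.Seen₀ × p.Seen₁) × (A' × B'))
  | .loc f g, a, b => PMF.pure (((), ()), (f a, g b))
  | @Proto.coin₀ _ _ C _ _ _, a, b => (PMF.uniformOfFintype C).map fun c => ((c, ()), ((a, c), b))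
  | @Proto.coin₁ _ _ C _ _ _, a, b => (PMF.uniformOfFintype C).map fun c => (((), c), (a, (b, c)))
  | @Proto.send₀ _ _ _ _ f, a, b => PMF.pure (((), f a), (a, (b, f a)))
  | @Proto.send₁ _ _ _ _ f, a, b => PMF.pure ((f b, ()), ((a, f b), b))
  | .seq p q, a, b =>
    (p.exec a b).bind fun u =>
      (q.exec u.2.1 u.2.2).map fun v => (((u.1.1, v.1.1), (u.1.2, v.1.2)), v.2)
  | .frame p, a, b =>
    (p.exec a.2 b.2).map fun u => (u.1, ((a.1, u.2.1), (b.1, u.2.2)))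

/-- The view of party 0: its input, its coins and the messages that it receives. -/
abbrev Proto.View₀ {A B A' B' : Type} (p : Proto A B A' B') : Type := A × p.Seen₀

/-- The view of party 1: its input, its coins and the messages that it receives. -/
abbrev Proto.View₁ {A B A' B' : Type} (p : Proto A B A' B') : Type := B × p.Seen₁

def Proto.viewLaw₀ {A B A' B' : Type} (p : Proto A B A' B') (a : A) (b : B) : PMF p.View₀ :=
  (p.exec a b).map fun u => (a, u.1.1)

def Proto.viewLaw₁ {A B A' B' : Type} (p : Proto A B A' B') (a : A) (b : B) : PMF p.View₁ :=
  (p.exec a b).map fun u => (b, u.1.2)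

/-- The joint distribution of the outputs of the two parties. -/
def Proto.outLaw {A B A' B' : Type} (p : Proto A B A' B') (a : A) (b : B) : PMF (A' × B') :=
  (p.exec a b).map fun u => u.2

/-! # Cryptographic training protocols

Party 0 is the model owner and party 1 is the data owner. `A` is the type of model weights, `B` of
training data, `A'` of the output of the model owner (the weight updates and the trained model) and
`B'` of the output of the data owner (the predictions of the model on its data). -/

/-- `train` is the training that is to be computed. -/
structure IsCryptographicTrainingProtocol {A B A' B' : ℕ → Type} [∀ κ, BitData (A κ)]
    [∀ κ, BitData (B κ)] [∀ κ, BitData (A' κ)] [∀ κ, BitData (B' κ)]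
    (P : ∀ κ, Proto (A κ) (B κ) (A' κ) (B' κ)) (train : ∀ κ, A κ → B κ → A' κ × B' κ) :
    Prop where
  correct : ∀ κ M D, (P κ).outLaw M D = PMF.pure (train κ M D)
  data_privacy :
    ∃ sim : ∀ κ (_ : Unit), A κ × A' κ → PMF (P κ).View₀, PolySampler sim ∧
      Indist (ι := fun κ => A κ × B κ) (fun κ i => (P κ).viewLaw₀ i.1 i.2)
        (fun κ i => ((P κ).outLaw i.1 i.2).bind fun out => sim κ () (i.1, out.1))
  model_privacy :
    ∃ sim : ∀ κ (_ : Unit), B κ × B' κ → PMF (P κ).View₁, PolySampler sim ∧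
      Indist (ι := fun κ => A κ × B κ) (fun κ i => (P κ).viewLaw₁ i.1 i.2)
        (fun κ i => ((P κ).outLaw i.1 i.2).bind fun out => sim κ () (i.2, out.2))

/-! # Secure evaluation of functions on additive shares -/

/-- A function between finite abelian groups and a two-party protocol for evaluating it on additive
shares. -/
structure Gadget where
  G : Type
  H : Type
  [groupG : AddCommGroup G]
  [groupH : AddCommGroup H]
  [fintypeH : Fintype H]
  [dataG : BitData G]
  [dataH : BitData H]
  φ : G → H
  prot : Proto G G H H

attribute [instance] Gadget.groupG Gadget.groupH Gadget.fintypeH Gadget.dataG Gadget.dataH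

/-- The protocols of the family securely evaluate the functionality that takes shares `x₀`, `x₁`
and returns a uniformly random pair of shares of `φ (x₀ + x₁)`, against semi-honest parties. -/
structure SecureOnShares {ι : ℕ → Type} (g : ∀ κ, ι κ → Gadget) : Prop where
  correct : ∀ κ i x₀ x₁, ∀ o ∈ ((g κ i).prot.outLaw x₀ x₁).support,
    o.1 + o.2 = (g κ i).φ (x₀ + x₁)
  secure₀ :
    ∃ sim : ∀ κ i, (g κ i).G × (g κ i).H → PMF (g κ i).prot.View₀, PolySampler sim ∧
      Indist (ι := fun κ => Σ i : ι κ, (g κ i).G × (g κ i).G)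
        (fun κ s => ((g κ s.1).prot.exec s.2.1 s.2.2).map fun u => ((s.2.1, u.1.1), u.2))
        (fun κ s => (PMF.uniformOfFintype (g κ s.1).H).bind fun o =>
          (sim κ s.1 (s.2.1, o)).map fun v => (v, (o, (g κ s.1).φ (s.2.1 + s.2.2) - o)))
  secure₁ :
    ∃ sim : ∀ κ i, (g κ i).G × (g κ i).H → PMF (g κ i).prot.View₁, PolySampler sim ∧
      Indist (ι := fun κ => Σ i : ι κ, (g κ i).G × (g κ i).G)
        (fun κ s => ((g κ s.1).prot.exec s.2.1 s.2.2).map fun u => ((s.2.2, u.1.2), u.2))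
        (fun κ s => (PMF.uniformOfFintype (g κ s.1).H).bind fun o =>
          (sim κ s.1 (s.2.2, o)).map fun v => (v, ((g κ s.1).φ (s.2.1 + s.2.2) - o, o)))

/-! # Homomorphic encryption of tensors over `ℤ / 2 ^ l` -/

/-- Tensors with `n` entries, flattened. -/
abbrev Vec (l n : ℕ) : Type := Fin n → ZMod (2 ^ l)

abbrev Mat (l m n : ℕ) : Type := Matrix (Fin m) (Fin n) (ZMod (2 ^ l))

/-- The algorithms of a public-key encryption scheme for tensors over `ℤ / 2 ^ l` with homomorphic
evaluation of affine maps of one ciphertext, `x ↦ A x + c`, and of two ciphertexts,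
`(x, y) ↦ A x + A' y + c`, where `A`, `A'`, `c` are plaintexts. The last argument of `enc`, `eval`,
`eval₂` is the random coins. -/
structure HEScheme (l : ℕ) where
  pkLen : ℕ
  skLen : ℕ
  ctLen : ℕ → ℕ
  genCoins : ℕ
  encCoins : ℕ → ℕ
  evalCoins : ℕ → ℕ → ℕ
  eval₂Coins : ℕ → ℕ → ℕ → ℕ
  gen : Bits genCoins → Bits pkLen × Bits skLen
  enc : ∀ n, Bits pkLen → Vec l n → Bits (encCoins n) → Bits (ctLen n)
  dec : ∀ n, Bits skLen → Bits (ctLen n) → Vec l n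
  eval : ∀ n m, Bits pkLen → Mat l m n → Vec l m → Bits (ctLen n) → Bits (evalCoins n m) →
    Bits (ctLen m)
  eval₂ : ∀ n n' m, Bits pkLen → Mat l m n → Mat l m n' → Vec l m → Bits (ctLen n) →
    Bits (ctLen n') → Bits (eval₂Coins n n' m) → Bits (ctLen m)

abbrev HEScheme.PK {l : ℕ} (E : HEScheme l) : Type := Bits E.pkLen

abbrev HEScheme.SK {l : ℕ} (E : HEScheme l) : Type := Bits E.skLen

abbrev HEScheme.Ct {l : ℕ} (E : HEScheme l) (n : ℕ) : Type := Bits (E.ctLen n)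

/-- A secure homomorphic encryption scheme with function privacy. In all clauses, the shapes of the
tensors are bounded by an arbitrary polynomial `b` in the security parameter. -/
structure SecureHE {l : ℕ → ℕ} (E : ∀ κ, HEScheme (l κ)) : Prop where
  gen_eff : PolySize (ι := fun _ => Unit) (fun κ _ => (E κ).gen)
  enc_eff : ∀ b : Polynomial ℕ, PolySize (ι := fun κ => {n : ℕ // n ≤ b.eval κ})
    (fun κ n (a : (E κ).PK × Vec (l κ) n × Bits ((E κ).encCoins n)) =>
      (E κ).enc n a.1 a.2.1 a.2.2)
  dec_eff : ∀ b : Polynomial ℕ, PolySize (ι := fun κ => {n : ℕ // n ≤ b.eval κ})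
    (fun κ n (a : (E κ).SK × (E κ).Ct n) => (E κ).dec n a.1 a.2)
  eval_eff : ∀ b : Polynomial ℕ,
    PolySize (ι := fun κ => {n : ℕ × ℕ // n.1 ≤ b.eval κ ∧ n.2 ≤ b.eval κ})
      (fun κ n (a : (E κ).PK × Mat (l κ) n.1.2 n.1.1 × Vec (l κ) n.1.2 × (E κ).Ct n.1.1 ×
          Bits ((E κ).evalCoins n.1.1 n.1.2)) =>
        (E κ).eval n.1.1 n.1.2 a.1 a.2.1 a.2.2.1 a.2.2.2.1 a.2.2.2.2)
  eval₂_eff : ∀ b : Polynomial ℕ,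
    PolySize
      (ι := fun κ => {n : ℕ × ℕ × ℕ // n.1 ≤ b.eval κ ∧ n.2.1 ≤ b.eval κ ∧ n.2.2 ≤ b.eval κ})
      (fun κ n (a : (E κ).PK × Mat (l κ) n.1.2.2 n.1.1 × Mat (l κ) n.1.2.2 n.1.2.1 ×
          Vec (l κ) n.1.2.2 × (E κ).Ct n.1.1 × (E κ).Ct n.1.2.1 ×
          Bits ((E κ).eval₂Coins n.1.1 n.1.2.1 n.1.2.2)) =>
        (E κ).eval₂ n.1.1 n.1.2.1 n.1.2.2 a.1 a.2.1 a.2.2.1 a.2.2.2.1 a.2.2.2.2.1 a.2.2.2.2.2.1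
          a.2.2.2.2.2.2)
  dec_enc : ∀ κ n g x r, (E κ).dec n ((E κ).gen g).2 ((E κ).enc n ((E κ).gen g).1 x r) = x
  dec_eval : ∀ κ n m g x r A c s,
    (E κ).dec m ((E κ).gen g).2
      ((E κ).eval n m ((E κ).gen g).1 A c ((E κ).enc n ((E κ).gen g).1 x r) s) =
      A.mulVec x + c
  dec_eval₂ : ∀ κ n n' m g x y r r' A A' c s,
    (E κ).dec m ((E κ).gen g).2
      ((E κ).eval₂ n n' m ((E κ).gen g).1 A A' c ((E κ).enc n ((E κ).gen g).1 x r)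
        ((E κ).enc n' ((E κ).gen g).1 y r') s) =
      A.mulVec x + A'.mulVec y + c
  /-- Encryptions of any two tensors of the same shape are indistinguishable, given the public
  key. -/
  indist : ∀ b : Polynomial ℕ,
    Indist (ι := fun κ => Σ n : {n : ℕ // n ≤ b.eval κ}, Vec (l κ) n × Vec (l κ) n)
      (fun κ i => (PMF.uniformOfFintype (Bits (E κ).genCoins × Bits ((E κ).encCoins i.1))).map
        fun ω => (((E κ).gen ω.1).1, (E κ).enc i.1 ((E κ).gen ω.1).1 i.2.1 ω.2))
      (fun κ i => (PMF.uniformOfFintype (Bits (E κ).genCoins × Bits ((E κ).encCoins i.1))).map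
        fun ω => (((E κ).gen ω.1).1, (E κ).enc i.1 ((E κ).gen ω.1).1 i.2.2 ω.2))
  /-- To the owner of the keys and of the input ciphertext, an evaluated ciphertext reveals no more
  than its plaintext: it can be simulated from the keys, the input ciphertext and the plaintext of
  the result. -/
  eval_private :
    ∃ sim : ∀ κ n m, (E κ).PK × (E κ).SK × (E κ).Ct n × Vec (l κ) m → PMF ((E κ).Ct m),
      (∀ b : Polynomial ℕ,
        PolySampler (ι := fun κ => {n : ℕ × ℕ // n.1 ≤ b.eval κ ∧ n.2 ≤ b.eval κ})
          (fun κ n => sim κ n.1.1 n.1.2)) ∧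
      ∀ b : Polynomial ℕ,
        Indist (ι := fun κ => Σ n : {n : ℕ × ℕ // n.1 ≤ b.eval κ ∧ n.2 ≤ b.eval κ},
            Vec (l κ) n.1.1 × Mat (l κ) n.1.2 n.1.1 × Vec (l κ) n.1.2)
          (fun κ i =>
            (PMF.uniformOfFintype (Bits (E κ).genCoins × Bits ((E κ).encCoins i.1.1.1) ×
              Bits ((E κ).evalCoins i.1.1.1 i.1.1.2))).map fun ω =>
                (ω.1, ω.2.1, (E κ).eval i.1.1.1 i.1.1.2 ((E κ).gen ω.1).1 i.2.2.1 i.2.2.2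
                  ((E κ).enc i.1.1.1 ((E κ).gen ω.1).1 i.2.1 ω.2.1) ω.2.2))
          (fun κ i =>
            (PMF.uniformOfFintype (Bits (E κ).genCoins × Bits ((E κ).encCoins i.1.1.1))).bind
              fun ω => (sim κ i.1.1.1 i.1.1.2 (((E κ).gen ω.1).1, ((E κ).gen ω.1).2,
                (E κ).enc i.1.1.1 ((E κ).gen ω.1).1 i.2.1 ω.2,
                i.2.2.1.mulVec i.2.1 + i.2.2.2)).map fun ct => (ω.1, ω.2, ct))
  eval₂_private :
    ∃ sim : ∀ κ n n' m, (E κ).PK × (E κ).SK × (E κ).Ct n × (E κ).Ct n' × Vec (l κ) m →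
        PMF ((E κ).Ct m),
      (∀ b : Polynomial ℕ,
        PolySampler
          (ι := fun κ =>
            {n : ℕ × ℕ × ℕ // n.1 ≤ b.eval κ ∧ n.2.1 ≤ b.eval κ ∧ n.2.2 ≤ b.eval κ})
          (fun κ n => sim κ n.1.1 n.1.2.1 n.1.2.2)) ∧
      ∀ b : Polynomial ℕ,
        Indist
          (ι := fun κ =>
            Σ n : {n : ℕ × ℕ × ℕ // n.1 ≤ b.eval κ ∧ n.2.1 ≤ b.eval κ ∧ n.2.2 ≤ b.eval κ},
              Vec (l κ) n.1.1 × Vec (l κ) n.1.2.1 × Mat (l κ) n.1.2.2 n.1.1 ×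
                Mat (l κ) n.1.2.2 n.1.2.1 × Vec (l κ) n.1.2.2)
          (fun κ i =>
            (PMF.uniformOfFintype (Bits (E κ).genCoins × Bits ((E κ).encCoins i.1.1.1) ×
              Bits ((E κ).encCoins i.1.1.2.1) ×
              Bits ((E κ).eval₂Coins i.1.1.1 i.1.1.2.1 i.1.1.2.2))).map fun ω =>
                (ω.1, ω.2.1, ω.2.2.1,
                  (E κ).eval₂ i.1.1.1 i.1.1.2.1 i.1.1.2.2 ((E κ).gen ω.1).1 i.2.2.2.1 i.2.2.2.2.1
                    i.2.2.2.2.2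
                    ((E κ).enc i.1.1.1 ((E κ).gen ω.1).1 i.2.1 ω.2.1)
                    ((E κ).enc i.1.1.2.1 ((E κ).gen ω.1).1 i.2.2.1 ω.2.2.1) ω.2.2.2))
          (fun κ i =>
            (PMF.uniformOfFintype (Bits (E κ).genCoins × Bits ((E κ).encCoins i.1.1.1) ×
              Bits ((E κ).encCoins i.1.1.2.1))).bind
              fun ω => (sim κ i.1.1.1 i.1.1.2.1 i.1.1.2.2 (((E κ).gen ω.1).1, ((E κ).gen ω.1).2,
                (E κ).enc i.1.1.1 ((E κ).gen ω.1).1 i.2.1 ω.2.1,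
                (E κ).enc i.1.1.2.1 ((E κ).gen ω.1).1 i.2.2.1 ω.2.2,
                i.2.2.2.1.mulVec i.2.1 + i.2.2.2.2.1.mulVec i.2.2.1 + i.2.2.2.2.2)).map
                  fun ct => (ω.1, ω.2.1, ω.2.2, ct))

/-! # Neural networks -/

/-- The linear operator `W ∘ X` (on a whole batch) of a linear layer `Y = W ∘ X + b`, as a bilinear
map `(W ∘ X) i = ∑ j k, coef i j k * W j * X k`, and the matrix that broadcasts the bias `b` to the
shape of `Y`. The tensors `W`, `b`, `X`, `Y` have `w`, `k`, `n`, `m` entries. -/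
structure LinearOp (l n m w k : ℕ) where
  coef : Fin m → Fin w → Fin n → ZMod (2 ^ l)
  bias : Mat l m k

namespace LinearOp

variable {l n m w k : ℕ} (o : LinearOp l n m w k)

/-- The matrix of `X ↦ W ∘ X`. Its transpose is the matrix of `∇Y ↦ W ⊙ₓ ∇Y = ∇X`. -/
def weightMat (W : Vec l w) : Mat l m n := Matrix.of fun i q => ∑ j, o.coef i j q * W j

/-- The gradient `∇Y ⊙ X` of the weights: the transpose of `W ↦ W ∘ X`, applied to `∇Y`. -/
def gradW (dY : Vec l m) (X : Vec l n) : Vec l w :=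
  fun j => ∑ i, ∑ q, o.coef i j q * dY i * X q

/-- The matrix of `X ↦ ∇Y ⊙ X`. -/
def gradMatX (dY : Vec l m) : Mat l w n := Matrix.of fun j q => ∑ i, o.coef i j q * dY i

/-- The matrix of `∇Y ↦ ∇Y ⊙ X`. -/
def gradMatY (X : Vec l n) : Mat l w m := Matrix.of fun j i => ∑ q, o.coef i j q * X q

end LinearOp

/-- A layer from tensors with `n` entries to tensors with `m` entries (over the whole batch),
with the two-party protocols for its non-linear parts.

A linear layer is followed, in the backward direction, by the truncation `trunc` of the gradient of
its input.

A non-linear layer consists of the forward map `fwd`, which returns the output and auxiliary data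
that is kept for the backward pass (such as the Boolean value of the derivative of ReLU;
in shares over `ℤ / 2 ^ auxBits`, which is XOR sharing for `auxBits = 1`), and the backward map `bwd`
from the auxiliary data and the gradient of the output to the gradient of the input. -/
inductive Layer (l n m : ℕ) : Type 1
  | linear (w k : ℕ) (o : LinearOp l n m w k) (trunc : Vec l n → Vec l n)
      (truncProt : Proto (Vec l n) (Vec l n) (Vec l n) (Vec l n)) : Layer l n m
  | nonlinear (auxBits auxLen : ℕ)
      (fwd : Vec l n → Vec l m × Vec auxBits auxLen)
      (bwd : Vec auxBits auxLen × Vec l m → Vec l n)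
      (fwdProt : Proto (Vec l n) (Vec l n) (Vec l m × Vec auxBits auxLen)
        (Vec l m × Vec auxBits auxLen))
      (bwdProt : Proto (Vec auxBits auxLen × Vec l m) (Vec auxBits auxLen × Vec l m)
        (Vec l n) (Vec l n)) : Layer l n m

namespace Layer

variable {l n m : ℕ}

/-- The number of weights; non-linear layers have no trainable parameters. -/
@[reducible] def wDim : Layer l n m → ℕ
  | linear w _ _ _ _ => w
  | nonlinear _ _ _ _ _ _ => 0

/-- The number of bias entries. -/
@[reducible] def bDim : Layer l n m → ℕ
  | linear _ k _ _ _ => k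
  | nonlinear _ _ _ _ _ _ => 0

/-- The trainable parameters (weights and bias) of a layer; also the type of their gradients. -/
abbrev Param (a : Layer l n m) : Type := Vec l a.wDim × Vec l a.bDim

@[reducible] def cacheBits : Layer l n m → ℕ
  | linear _ _ _ _ _ => l
  | nonlinear s _ _ _ _ _ => s

@[reducible] def cacheLen : Layer l n m → ℕ
  | linear _ _ _ _ _ => n
  | nonlinear _ c _ _ _ _ => c

/-- What is kept from the forward pass for the backward pass: the input of a linear layer, the
auxiliary data of a non-linear layer. -/
abbrev Cache (a : Layer l n m) : Type := Vec a.cacheBits a.cacheLen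

/-- Forward propagation in plaintext. -/
def forward : (a : Layer l n m) → a.Param → Vec l n → Vec l m × a.Cache
  | linear _ _ o _ _, W, X => ((o.weightMat W.1).mulVec X + o.bias.mulVec W.2, X)
  | nonlinear _ _ fwd _ _ _, _, X => fwd X

/-- Backpropagation in plaintext: the gradients of the input and of the parameters. -/
def backward : (a : Layer l n m) → a.Param → a.Cache → Vec l m → Vec l n × a.Param
  | linear _ _ o trunc _, W, X, dY =>
    (trunc ((o.weightMat W.1).transpose.mulVec dY), (o.gradW dY X, o.bias.transpose.mulVec dY))
  | nonlinear _ _ _ bwd _ _, _, c, dY => (bwd (c, dY), 0)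

/-- The calls of secure non-linear protocols in a layer: the truncation for a linear layer; the
forward (`false`) and the backward (`true`) evaluation for a non-linear layer. -/
def Site : Layer l n m → Type
  | linear _ _ _ _ _ => Unit
  | nonlinear _ _ _ _ _ _ => Bool

def gadget : (a : Layer l n m) → a.Site → Gadget
  | linear _ _ _ trunc truncProt, _ => { G := Vec l n, H := Vec l n, φ := trunc, prot := truncProt }
  | nonlinear s c fwd _ fwdProt _, false =>
    { G := Vec l n, H := Vec l m × Vec s c, φ := fwd, prot := fwdProt }
  | nonlinear s c _ bwd _ bwdProt, true =>
    { G := Vec s c × Vec l m, H := Vec l n, φ := bwd, prot := bwdProt }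

end Layer

/-- The parameters of the last `j` layers of a network. -/
def ParamsOf {l : ℕ} {dim : ℕ → ℕ} (layer : ∀ j, Layer l (dim (j + 1)) (dim j)) : ℕ → Type
  | 0 => Unit
  | j + 1 => ParamsOf layer j × (layer j).Param

@[reducible]
def bitDataParamsOf {l : ℕ} {dim : ℕ → ℕ} (layer : ∀ j, Layer l (dim (j + 1)) (dim j)) :
    (j : ℕ) → BitData (ParamsOf layer j)
  | 0 => bitDataUnit
  | j + 1 => @bitDataProd _ _ (bitDataParamsOf layer j) inferInstance

instance {l : ℕ} {dim : ℕ → ℕ} (layer : ∀ j, Layer l (dim (j + 1)) (dim j)) (j : ℕ) :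
    BitData (ParamsOf layer j) := bitDataParamsOf layer j

/-- A feed-forward network with its (public) training algorithm, over `ℤ / 2 ^ l`. Layers are
numbered from the output: `layer j` is followed by `j` further layers, and maps tensors with
`dim (j + 1)` entries to tensors with `dim j` entries. The network consists of the layers
`layer (L - 1), …, layer 0`, in this order. -/
structure Network where
  l : ℕ
  /-- the number of layers -/
  L : ℕ
  /-- the number of training iterations -/
  T : ℕ
  dim : ℕ → ℕ
  layer : ∀ j, Layer l (dim (j + 1)) (dim j)
  /-- the number of entries of the labels of a batch -/
  labelDim : ℕ
  /-- the gradient of the loss, as a function of the output and the labels of a batch -/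
  lossGrad : Vec l (dim 0) → Vec l labelDim → Vec l (dim 0)
  /-- the new parameters after iteration `τ`, from the old ones and their gradients -/
  update : ℕ → ParamsOf layer L → ParamsOf layer L → ParamsOf layer L

namespace Network

variable (N : Network)

/-- The parameters of the last `j` layers. -/
abbrev Params (j : ℕ) : Type := ParamsOf N.layer j

/-- The model weights. -/
abbrev Model : Type := N.Params N.L

/-- The predictions on a batch. -/
abbrev Prediction : Type := Vec N.l (N.dim 0)

/-- What the data owner contributes to an iteration: a batch of inputs, its labels, and the
perturbation that it adds to the gradients of the parameters. -/
abbrev Round : Type := Vec N.l (N.dim N.L) × Vec N.l N.labelDim × N.Model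

/-- The input of the data owner: its training data, in the batches that it uses in the iterations,
and the perturbations. -/
abbrev TrainData : Type := Fin N.T → N.Round

/-- The output of the model owner: the weight updates (perturbed gradients) of all iterations and
the trained model. -/
abbrev TrainOutput : Type := (Fin N.T → N.Model) × N.Model

/-- Propagation of `X` through the last `j` layers, and backpropagation, in plaintext: the final
output, the perturbed gradients of the parameters, and the gradient of `X`. -/
def propagate (t : Vec N.l N.labelDim) :
    (j : ℕ) → N.Params j → N.Params j → Vec N.l (N.dim j) →
      N.Prediction × N.Params j × Vec N.l (N.dim j)
  | 0, _, _, X => (X, (), N.lossGrad X t)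
  | j + 1, W, e, X =>
    let f := (N.layer j).forward W.2 X
    let u := propagate t j W.1 e.1 f.1
    let d := (N.layer j).backward W.2 f.2 u.2.2
    (u.1, (u.2.1, d.2 + e.2), d.1)

/-- `k` iterations of training in plaintext: the weight updates, the resulting model, and the
predictions. -/
def trainIter (M : N.Model) :
    (k : ℕ) → (Fin k → N.Round) → ((Fin k → N.Model) × N.Model) × (Fin k → N.Prediction)
  | 0, _ => ((Fin.elim0, M), Fin.elim0)
  | k + 1, D =>
    let s := trainIter M k (fun i => D i.castSucc)
    let r := D (Fin.last k)
    let u := N.propagate r.2.1 N.L s.1.2 r.2.2 r.1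
    ((Fin.snoc (α := fun _ => N.Model) s.1.1 u.2.1, N.update k s.1.2 u.2.1),
      Fin.snoc (α := fun _ => N.Prediction) s.2 u.1)

/-- Training in plaintext: the output for the model owner and the predictions. -/
def train (M : N.Model) (D : N.TrainData) : N.TrainOutput × (Fin N.T → N.Prediction) :=
  N.trainIter M N.T D

/-- All calls of secure non-linear protocols in the network. -/
def Site : Type := Σ j : Fin N.L, (N.layer j).Site

def gadget (s : N.Site) : Gadget := (N.layer s.1).gadget s.2

end Network

/-- The size of the network, the number of iterations and the bit length of numbers are polynomial
in the security parameter, and so is the cost of the non-linear functions, of the gradient of the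
loss function and of the update rule. -/
structure EfficientTraining (N : ℕ → Network) : Prop where
  bound : ∃ q : Polynomial ℕ, ∀ κ,
    (N κ).l ≤ q.eval κ ∧ (N κ).L ≤ q.eval κ ∧ (N κ).T ≤ q.eval κ ∧ (N κ).labelDim ≤ q.eval κ ∧
    (∀ j ≤ (N κ).L, (N κ).dim j ≤ q.eval κ) ∧
    ∀ j < (N κ).L, ((N κ).layer j).wDim ≤ q.eval κ ∧ ((N κ).layer j).bDim ≤ q.eval κ
  nonlinear_eff : PolySize (fun κ (s : (N κ).Site) => ((N κ).gadget s).φ)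
  loss_eff : PolySize (ι := fun _ => Unit)
    (fun κ _ (a : (N κ).Prediction × Vec (N κ).l (N κ).labelDim) => (N κ).lossGrad a.1 a.2)
  update_eff : PolySize (ι := fun κ => Fin (N κ).T)
    (fun κ τ (a : (N κ).Model × (N κ).Model) => (N κ).update τ a.1 a.2)

/-! # The training protocol

Party 0 is the model owner; it knows the public key. Party 1 is the data owner; it knows both keys.
Subscripts 0 and 1 denote the shares of the two parties. -/

section Protocol

variable {l : ℕ} (E : HEScheme l)

/-- Evaluation of `A X + b` on shares of `X`, where the model owner holds `A` and `b`: the data owner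
sends the encryption of its share `X₁`, and receives the encryption of `A (X₁ + X₀) - s` for a random
mask `s`. -/
def affineProt (n m : ℕ) :
    Proto (E.PK × Mat l m n × Vec l m × Vec l n) ((E.PK × E.SK) × Vec l n) (Vec l m) (Vec l m) :=
  .coin₁ (Bits (E.encCoins n)) ⨟
  .send₁ (fun ((k, X₁), r) => E.enc n k.1 X₁ r) ⨟
  .coin₀ (Vec l m) ⨟
  .coin₀ (Bits (E.evalCoins n m)) ⨟
  .send₀ (fun ((((pk, A, _, X₀), ct), s), r) => E.eval n m pk A (A.mulVec X₀ - s) ct r) ⨟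
  .loc (fun ((((_, _, b, _), _), s), _) => s + b) (fun (((k, _), _), ct) => E.dec m k.2 ct)

/-- Evaluation of the perturbed gradient `∇Y ⊙ X + e` of the weights, revealed to the model owner, on
shares of `X` and `∇Y`, where the data owner holds the perturbation `e`. -/
def gradWProt {n m w k : ℕ} (o : LinearOp l n m w k) :
    Proto (E.PK × Vec l n × Vec l m) ((E.PK × E.SK) × Vec l w × Vec l n × Vec l m)
      (Vec l w) Unit :=
  .coin₁ (Bits (E.encCoins n)) ⨟
  .coin₁ (Bits (E.encCoins m)) ⨟
  .send₁ (fun (((k, _, X₁, _), r), _) => E.enc n k.1 X₁ r) ⨟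
  .send₁ (fun (((k, _, _, dY₁), _), r') => E.enc m k.1 dY₁ r') ⨟
  .coin₀ (Vec l w) ⨟
  .coin₀ (Bits (E.eval₂Coins n m w)) ⨟
  .send₀ (fun (((((pk, X₀, dY₀), ctX), ctY), s), r) =>
    E.eval₂ n m w pk (o.gradMatX dY₀) (o.gradMatY X₀) (-s) ctX ctY r) ⨟
  .send₁ (fun ((((k, e, X₁, dY₁), _), _), ct) => E.dec w k.2 ct + o.gradW dY₁ X₁ + e) ⨟
  .loc (fun ((((((_, X₀, dY₀), _), _), s), _), g) => g + s + o.gradW dY₀ X₀) (fun _ => ())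

/-- Forward propagation of a layer on shares; both parties keep their shares of the cache. -/
def forwardProt {n m : ℕ} : (a : Layer l n m) →
    Proto (E.PK × a.Param × Vec l n) ((E.PK × E.SK) × Vec l n)
      (Vec l m × a.Cache) (Vec l m × a.Cache)
  | .linear _ _ o _ _ =>
    (affineProt E n m).call
      (fun (pk, W, X₀) => (pk, o.weightMat W.1, o.bias.mulVec W.2, X₀)) (fun s => s) ⨟
    .loc (fun ((_, _, X₀), Y₀) => (Y₀, X₀)) (fun ((_, X₁), Y₁) => (Y₁, X₁))
  | .nonlinear _ _ _ _ fwdProt _ =>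
    fwdProt.call (fun (_, _, X₀) => X₀) (fun (_, X₁) => X₁) ⨟
    .loc (fun (_, c) => c) (fun (_, c) => c)

/-- Backpropagation of a layer: shares of the gradient of the input, and for the model owner the
perturbed gradients of the parameters. The data owner also inputs the perturbations. -/
def backwardProt {n m : ℕ} : (a : Layer l n m) →
    Proto (E.PK × a.Param × a.Cache × Vec l m)
      ((E.PK × E.SK) × a.Param × a.Cache × Vec l m) (Vec l n × a.Param) (Vec l n)
  | .linear _ _ o _ truncProt =>
    (affineProt E m n).call
      (fun (pk, W, _, dY₀) => (pk, (o.weightMat W.1).transpose, 0, dY₀))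
      (fun (k, _, _, dY₁) => (k, dY₁)) ⨟
    truncProt.call (fun (_, z₀) => z₀) (fun (_, z₁) => z₁) ⨟
    .send₁ (fun (((_, e, _, dY₁), _), _) => o.bias.transpose.mulVec dY₁ + e.2) ⨟
    (gradWProt E o).call
      (fun ((((pk, _, X₀, dY₀), _), _), _) => (pk, X₀, dY₀))
      (fun (((k, e, X₁, dY₁), _), _) => (k, e.1, X₁, dY₁)) ⨟
    .loc
      (fun (((((_, _, _, dY₀), _), dX₀), g), dW) => (dX₀, (dW, o.bias.transpose.mulVec dY₀ + g)))
      (fun ((_, dX₁), _) => dX₁)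
  | .nonlinear _ _ _ _ _ bwdProt =>
    bwdProt.call (fun (_, _, c₀, dY₀) => (c₀, dY₀)) (fun (_, _, c₁, dY₁) => (c₁, dY₁)) ⨟
    .loc (fun (_, dX₀) => (dX₀, 0)) (fun (_, dX₁) => dX₁)

end Protocol

section Training

variable (N : Network) (E : HEScheme N.l)

/-- Forward and backward propagation through the last `j` layers on shares of `X`. At the output, the
model owner reveals its share, and the data owner computes the prediction and the gradient of the
loss. -/
def propagateProt : (j : ℕ) →
    Proto (E.PK × N.Params j × Vec N.l (N.dim j))
      ((E.PK × E.SK) × Vec N.l N.labelDim × N.Params j × Vec N.l (N.dim j))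
      (N.Params j × Vec N.l (N.dim j)) (N.Prediction × Vec N.l (N.dim j))
  | 0 =>
    .send₀ (fun (_, _, Y₀) => Y₀) ⨟
    .loc (fun _ => ((), 0))
      (fun ((_, t, _, Y₁), Y₀) => (Y₀ + Y₁, N.lossGrad (Y₀ + Y₁) t))
  | j + 1 =>
    (forwardProt E (N.layer j)).call (fun (pk, W, X₀) => (pk, W.2, X₀))
      (fun (k, _, _, X₁) => (k, X₁)) ⨟
    (propagateProt j).call (fun ((pk, W, _), (Y₀, _)) => (pk, W.1, Y₀))
      (fun ((k, t, e, _), (Y₁, _)) => (k, t, e.1, Y₁)) ⨟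
    (backwardProt E (N.layer j)).call
      (fun (((pk, W, _), (_, c₀)), (_, dY₀)) => (pk, W.2, c₀, dY₀))
      (fun (((k, _, e, _), (_, c₁)), (_, dY₁)) => (k, e.2, c₁, dY₁)) ⨟
    .loc (fun ((_, (g, _)), (dX₀, g')) => ((g, g'), dX₀))
      (fun ((_, (Y, _)), dX₁) => (Y, dX₁))

/-- `k` iterations of training. In each, the shares of the input batch `X` are `0` and `X`. -/
def trainIterProt : (k : ℕ) →
    Proto (E.PK × N.Model) ((E.PK × E.SK) × (Fin k → N.Round))
      ((Fin k → N.Model) × N.Model) (Fin k → N.Prediction)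
  | 0 => .loc (fun (_, M) => (Fin.elim0, M)) (fun _ => Fin.elim0)
  | k + 1 =>
    (trainIterProt k).call (fun s => s) (fun (key, D) => (key, fun i => D i.castSucc)) ⨟
    (propagateProt N E N.L).call (fun ((pk, _), (_, M)) => (pk, M, 0))
      (fun ((key, D), _) =>
        (key, (D (Fin.last k)).2.1, (D (Fin.last k)).2.2, (D (Fin.last k)).1)) ⨟
    .loc
      (fun ((_, (gs, M)), (g, _)) => (Fin.snoc (α := fun _ => N.Model) gs g, N.update k M g))
      (fun ((_, Ys), (Y, _)) => Fin.snoc (α := fun _ => N.Prediction) Ys Y)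

/-- The training protocol: the data owner generates keys and sends the public key, then the parties
perform all iterations. -/
def pencil : Proto N.Model N.TrainData N.TrainOutput (Fin N.T → N.Prediction) :=
  .coin₁ (Bits E.genCoins) ⨟
  .send₁ (fun (_, g) => (E.gen g).1) ⨟
  (trainIterProt N E N.T).call (fun (M, pk) => (pk, M)) (fun (D, g) => (E.gen g, D)) ⨟
  .loc (fun (_, out) => out) (fun (_, Ys) => Ys)

end Training

end Pencil

end

/-! Each message falls into one of three classes. The model owner receives encryptions under a key
it cannot open; they may be replaced by encryptions of `0`. The data owner holds the secret key, but
function privacy reduces an evaluated ciphertext to its plaintext, and the model owner's fresh mask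
makes that plaintext uniform. The remaining messages are functions of what their receiver may know:
the unmasking message for a weight gradient is determined by the revealed perturbed gradient and the
model owner's mask and shares, and the output share sent to the data owner is the prediction minus
its own share. The non-linear protocols are simulatable by assumption.

The difficulty is composition, because one key pair serves all steps, which are therefore not
independent. `Secure` is the invariant that survives composition. Its clause `sim` compares the view
and the output of the observer jointly with its key, for each fixed input of the parties. Its clause
`mix` says that the run on a fixed input is a mixture over a variable independent of the keys (a
mask, or the complete run of a non-linear protocol), that this variable determines all outputs, and
that given it the view can be sampled by a small circuit from the observer's key alone. Decryption
without errors is what keeps outputs independent of keys.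

`Secure.seq` is then a two-step hybrid argument. Conditionally on the mixing variable of the first
protocol, the second runs on a fixed input and can be exchanged for its simulator, while the
reduction resamples the first view from the key. Afterwards the first protocol is exchanged, the
simulator of the second being efficient post-processing. The relation `Post` between inputs and
outputs, carried along by `mix`, identifies sums of shares with the plaintext values; for the whole
training it is correctness with probability one (`outLaw_pencil`).

The blocks are `secure₀_affine`, `secure₁_affine`, `secure₀_gradW`, `secure₁_gradW`,
`secure₀_gadget` and `secure₁_gadget`. They are composed over layers (`secure₀_propagate`,
`secure₁_propagate`) and iterations (`secure₀_trainIter`, `secure₁_trainIter`). All this happens at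
one security parameter, with explicit circuit sizes. A layer costs at most five exchanges per
iteration, so the total loss is `5 * L * T` times the advantage against a primitive, and
`Indist.of_close` passes to the asymptotic statement. Reductions are non-uniform: inputs, masks and
coins are hard-wired. -/

noncomputable section

namespace Pencil

open BitData

/-! # Circuits -/

namespace Circuit

/-- Renaming the input wires of a circuit. -/
def reindex {I O : Type} : Circuit I O → {J : Type} → (I → J) → Circuit J O
  | @Circuit.wire _ _ _ f, _, φ => .wire (φ ∘ f)
  | .const b, _, _ => .const b
  | .nand i j, _, φ => .nand (φ i) (φ j)
  | .comp C D, _, φ => .comp (C.reindex φ) D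
  | .pair C D, _, φ => .pair (C.reindex φ) (D.reindex φ)

@[simp]
theorem size_reindex {I O J : Type} (C : Circuit I O) (φ : I → J) :
    (C.reindex φ).size = C.size := by
  induction C generalizing J <;> simp_all [reindex, size]

@[simp]
theorem eval_reindex {I O J : Type} (C : Circuit I O) (φ : I → J) (x : J → Bool) :
    (C.reindex φ).eval x = C.eval (x ∘ φ) := by
  induction C generalizing J <;> simp_all [reindex, eval, Function.comp_def]

/-- Copied wires count towards the size, so a circuit cannot have more outputs than its size.
Finiteness is part of the induction because intermediate wire types carry no `Fintype` instance. -/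
theorem finite_and_card_le {I O : Type} (C : Circuit I O) : Finite O ∧ Nat.card O ≤ C.size := by
  induction C with
  | @wire I O _ f => exact ⟨inferInstance, by simp [size]⟩
  | const b => exact ⟨inferInstance, by simp [size]⟩
  | nand i j => exact ⟨inferInstance, by simp [size]⟩
  | comp C D hC hD => exact ⟨hD.1, hD.2.trans (by simp [size])⟩
  | pair C D hC hD =>
    obtain ⟨_, hC⟩ := hC
    obtain ⟨_, hD⟩ := hD
    exact ⟨inferInstance, by rw [Nat.card_sum, size]; omega⟩

theorem card_le_size {I O : Type} [Fintype O] (C : Circuit I O) : Fintype.card O ≤ C.size := by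
  simpa using C.finite_and_card_le.2

/-- The circuit with output `f`. -/
def constant {O : Type} [Fintype O] (I : Type) (f : O → Bool) : Circuit I O :=
  .comp (.pair (.const true) (.const false))
    (.wire fun o => if f o then Sum.inl () else Sum.inr ())

@[simp]
theorem size_constant {O : Type} [Fintype O] (I : Type) (f : O → Bool) :
    (constant I f).size = 2 + Fintype.card O := rfl

@[simp]
theorem eval_constant {O : Type} [Fintype O] (I : Type) (f : O → Bool) (x : I → Bool) :
    (constant I f).eval x = f := by
  funext o
  by_cases h : f o <;> simp [constant, eval, h]

end Circuit

/-! # Bit lengths -/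

@[simp]
theorem bitLength_unit : bitLength Unit = 0 := rfl

@[simp]
theorem bitLength_bool : bitLength Bool = 1 := rfl

@[simp]
theorem bitLength_prod (α β : Type) [BitData α] [BitData β] :
    bitLength (α × β) = bitLength α + bitLength β :=
  Fintype.card_sum

@[simp]
theorem bitLength_fin (n : ℕ) (α : Type) [BitData α] :
    bitLength (Fin n → α) = n * bitLength α := by
  simp [bitLength, BitData.Wire]

@[simp]
theorem bitLength_zmod (l : ℕ) : bitLength (ZMod (2 ^ l)) = l := by
  simp [bitLength, BitData.Wire]

@[simp]
theorem bitLength_matrix (m n : ℕ) (α : Type) [BitData α] :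
    bitLength (Matrix (Fin m) (Fin n) α) = m * (n * bitLength α) := by
  simp [bitLength, BitData.Wire]

/-- All bit strings of the right length are encodings. -/
def EncodeSurjective (α : Type) [BitData α] : Prop :=
  Function.Surjective (encode : α → Wire α → Bool)

theorem encodeSurjective_bool : EncodeSurjective Bool := fun f => ⟨f (), rfl⟩

theorem EncodeSurjective.prod {α β : Type} [BitData α] [BitData β] (hα : EncodeSurjective α)
    (hβ : EncodeSurjective β) : EncodeSurjective (α × β) := by
  intro f
  obtain ⟨a, ha⟩ := hα (f ∘ Sum.inl)
  obtain ⟨b, hb⟩ := hβ (f ∘ Sum.inr)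
  refine ⟨(a, b), funext fun w => ?_⟩
  rcases w with w | w
  · exact congrFun ha w
  · exact congrFun hb w

theorem EncodeSurjective.fin {n : ℕ} {α : Type} [BitData α] (hα : EncodeSurjective α) :
    EncodeSurjective (Fin n → α) := by
  intro f
  choose a ha using fun i => hα fun w => f (i, w)
  exact ⟨a, funext fun w => congrFun (ha w.1) w.2⟩

/-- An injection of `2 ^ l` residues into the `2 ^ l` strings of `l` bits is onto. -/
theorem encodeSurjective_zmod (l : ℕ) : EncodeSurjective (ZMod (2 ^ l)) := by
  classical
  have h := (Fintype.bijective_iff_injective_and_card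
    (encode : ZMod (2 ^ l) → Wire (ZMod (2 ^ l)) → Bool)).2 ⟨encode_injective, by
      rw [ZMod.card]
      simp [BitData.Wire]⟩
  exact h.2

theorem encodeSurjective_vec (l n : ℕ) : EncodeSurjective (Vec l n) :=
  (encodeSurjective_zmod l).fin

theorem encodeSurjective_bits (n : ℕ) : EncodeSurjective (Bits n) :=
  encodeSurjective_bool.fin

/-! # Uniform distributions -/

theorem map_uniform_equiv {α β : Type} [Fintype α] [Nonempty α] [Fintype β] [Nonempty β]
    (e : α ≃ β) : (PMF.uniformOfFintype α).map e = PMF.uniformOfFintype β := by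
  ext b
  rw [PMF.map_apply, tsum_eq_single (e.symm b)]
  · simp [Fintype.card_congr e]
  · intro a ha
    rw [if_neg]
    rintro rfl
    simp at ha

theorem uniform_prod {α β : Type} [Fintype α] [Nonempty α] [Fintype β] [Nonempty β] :
    PMF.uniformOfFintype (α × β) =
      (PMF.uniformOfFintype α).bind fun a => (PMF.uniformOfFintype β).map (Prod.mk a) := by
  ext ⟨a, b⟩
  rw [PMF.bind_apply, tsum_eq_single a, PMF.map_apply, tsum_eq_single b]
  · simp only [PMF.uniformOfFintype_apply, Fintype.card_prod, Nat.cast_mul, if_true]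
    rw [ENNReal.mul_inv] <;> simp
  · intro b' hb'
    simp [Ne.symm hb']
  · intro a' ha'
    simp [PMF.map_apply, Ne.symm ha']

theorem bind_uniform_equiv {α β γ : Type} [Fintype α] [Nonempty α] [Fintype β] [Nonempty β]
    (e : α ≃ β) (f : β → PMF γ) :
    (PMF.uniformOfFintype α).bind (fun a => f (e a)) = (PMF.uniformOfFintype β).bind f := by
  rw [← map_uniform_equiv e, PMF.bind_map]
  rfl

/-- Splits one random tape into two independent ones, as needed for composing samplers. -/
theorem uniform_bits_add (m n : ℕ) :
    (PMF.uniformOfFintype (Bits m)).bind (fun ρ => (PMF.uniformOfFintype (Bits n)).map fun ρ' =>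
      (Sum.elim ρ ρ' : Fin m ⊕ Fin n → Bool) ∘ finSumFinEquiv.symm) =
        PMF.uniformOfFintype (Bits (m + n)) := by
  have h := map_uniform_equiv
    (((Equiv.sumArrowEquivProdArrow (Fin m) (Fin n) Bool).symm).trans
      (finSumFinEquiv.arrowCongr (Equiv.refl Bool)))
  rw [← h, uniform_prod, PMF.map_bind]
  simp only [PMF.map_comp]
  rfl

/-! # Maps that only copy bits -/

/-- Every bit of `f a` is a bit of `a`, at a position that does not depend on `a`. -/
@[fun_prop]
def IsWiring {α β : Type} [BitData α] [BitData β] (f : α → β) : Prop :=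
  ∃ φ : Wire β → Wire α, ∀ a, encode (f a) = encode a ∘ φ

instance : IsEmpty (Wire Unit) := inferInstanceAs (IsEmpty Empty)

namespace IsWiring

variable {α β γ : Type} [BitData α] [BitData β] [BitData γ]

@[fun_prop]
theorem id : IsWiring fun a : α => a := ⟨fun w => w, fun _ => rfl⟩

@[fun_prop]
theorem comp {g : β → γ} {f : α → β} (hg : IsWiring g) (hf : IsWiring f) :
    IsWiring fun a => g (f a) := by
  obtain ⟨φ, hφ⟩ := hg
  obtain ⟨ψ, hψ⟩ := hf
  exact ⟨ψ ∘ φ, fun a => by rw [hφ, hψ]; rfl⟩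

@[fun_prop]
theorem fst {f : α → β × γ} (hf : IsWiring f) : IsWiring fun a => (f a).1 :=
  comp (g := Prod.fst) ⟨Sum.inl, fun _ => rfl⟩ hf

@[fun_prop]
theorem snd {f : α → β × γ} (hf : IsWiring f) : IsWiring fun a => (f a).2 :=
  comp (g := Prod.snd) ⟨Sum.inr, fun _ => rfl⟩ hf

@[fun_prop]
theorem prodMk {f : α → β} {g : α → γ} (hf : IsWiring f) (hg : IsWiring g) :
    IsWiring fun a => (f a, g a) := by
  obtain ⟨φ, hφ⟩ := hf
  obtain ⟨ψ, hψ⟩ := hg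
  refine ⟨Sum.elim φ ψ, fun a => ?_⟩
  change Sum.elim (encode (f a)) (encode (g a)) = _
  rw [hφ, hψ]
  funext w
  rcases w with w | w <;> rfl

-- A wiring cannot create a bit, so only constants without bits qualify, notably `()`. Other
-- constants cost gates, as in `Comp.const`.
@[fun_prop]
theorem const [IsEmpty (Wire β)] (b : β) : IsWiring fun _ : α => b :=
  ⟨fun w => isEmptyElim w, fun _ => funext fun w => isEmptyElim w⟩

@[fun_prop]
theorem apply {n : ℕ} (i : Fin n) : IsWiring fun f : Fin n → β => f i :=
  ⟨fun w => (i, w), fun _ => rfl⟩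

@[fun_prop]
theorem pi {n : ℕ} {f : α → Fin n → β} (hf : ∀ i, IsWiring fun a => f a i) : IsWiring f := by
  choose φ hφ using hf
  exact ⟨fun w => φ w.1 w.2, fun a => funext fun w => congrFun (hφ w.1 a) w.2⟩

end IsWiring

/-! # Computable maps -/

/-- `f` is computed by a circuit of size at most `c`. -/
def Comp {α β : Type} [BitData α] [BitData β] (c : ℕ) (f : α → β) : Prop :=
  ∃ C : Circuit (Wire α) (Wire β), C.size ≤ c ∧ ∀ a, C.eval (encode a) = encode (f a)

/-- `F` is sampled by a circuit of size at most `c` from at most `r` random bits. -/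
def Samp {α β : Type} [BitData α] [BitData β] (r c : ℕ) (F : α → PMF β) : Prop :=
  ∃ (r' : ℕ) (C : Circuit (Wire α ⊕ Fin r') (Wire β)), r' ≤ r ∧ C.size ≤ c ∧
    ∀ a, (PMF.uniformOfFintype (Bits r')).map (fun ρ => C.eval (Sum.elim (encode a) ρ)) =
      (F a).map encode

section Samplers

variable {α β γ δ : Type} [BitData α] [BitData β] [BitData γ] [BitData δ]

theorem IsWiring.computable {f : α → β} (hf : IsWiring f) : Comp (bitLength β) f := by
  obtain ⟨φ, hφ⟩ := hf
  exact ⟨.wire φ, le_rfl, fun a => (hφ a).symm⟩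

theorem Comp.bitLength_le {f : α → β} {c : ℕ} (hf : Comp c f) : bitLength β ≤ c := by
  obtain ⟨C, hC, -⟩ := hf
  exact C.card_le_size.trans hC

theorem Comp.mono {f : α → β} {c c' : ℕ} (hf : Comp c f) (h : c ≤ c') : Comp c' f := by
  obtain ⟨C, hC, hf⟩ := hf
  exact ⟨C, hC.trans h, hf⟩

theorem Comp.comp {g : β → γ} {f : α → β} {c c' : ℕ} (hg : Comp c g) (hf : Comp c' f) :
    Comp (c + c') fun a => g (f a) := by
  obtain ⟨C, hC, hg⟩ := hg
  obtain ⟨D, hD, hf⟩ := hf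
  exact ⟨.comp D C, by simp only [Circuit.size]; omega, fun a => by simp [Circuit.eval, hf, hg]⟩

/-- Input wires are merely renamed, so precomposition with a wiring is free, in contrast to
`Comp.comp`. The plumbing between steps is kept in this form wherever possible. -/
theorem Comp.comap {g : β → γ} {f : α → β} {c : ℕ} (hg : Comp c g) (hf : IsWiring f) :
    Comp c fun a => g (f a) := by
  obtain ⟨C, hC, hg⟩ := hg
  obtain ⟨φ, hφ⟩ := hf
  exact ⟨C.reindex φ, by simpa using hC, fun a => by simp [← hφ, hg]⟩

theorem Comp.prodMk {f : α → β} {g : α → γ} {c c' : ℕ} (hf : Comp c f) (hg : Comp c' g) :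
    Comp (c + c') fun a => (f a, g a) := by
  obtain ⟨C, hC, hf⟩ := hf
  obtain ⟨D, hD, hg⟩ := hg
  refine ⟨.pair C D, by simp only [Circuit.size]; omega, fun a => ?_⟩
  change Sum.elim (C.eval _) (D.eval _) = Sum.elim _ _
  rw [hf, hg]

theorem Comp.const (b : β) : Comp (2 + bitLength β) fun _ : α => b :=
  ⟨Circuit.constant _ (encode b), le_rfl, fun a => by simp⟩

theorem Samp.mono {F : α → PMF β} {r c r' c' : ℕ} (hF : Samp r c F) (hr : r ≤ r') (hc : c ≤ c') :
    Samp r' c' F := by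
  obtain ⟨s, C, hs, hC, hF⟩ := hF
  exact ⟨s, C, hs.trans hr, hC.trans hc, hF⟩

theorem Samp.congr {F F' : α → PMF β} {r c : ℕ} (hF : Samp r c F) (h : ∀ a, F a = F' a) :
    Samp r c F' := by
  rwa [← funext h]

theorem Samp.bitLength_le {F : α → PMF β} {r c : ℕ} (hF : Samp r c F) : bitLength β ≤ c := by
  obtain ⟨s, C, hs, hC, hF⟩ := hF
  exact C.card_le_size.trans hC

theorem Comp.samp {f : α → β} {c : ℕ} (hf : Comp c f) : Samp 0 c fun a => PMF.pure (f a) := by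
  obtain ⟨C, hC, hf⟩ := hf
  refine ⟨0, C.reindex Sum.inl, le_rfl, by simpa using hC, fun a => ?_⟩
  simp only [Circuit.eval_reindex, Sum.elim_comp_inl, hf, PMF.pure_map]
  exact PMF.map_const _ _

theorem IsWiring.samp {f : α → β} (hf : IsWiring f) :
    Samp 0 (bitLength β) fun a => PMF.pure (f a) :=
  hf.computable.samp

theorem Samp.comap {F : β → PMF γ} {f : α → β} {r c : ℕ} (hF : Samp r c F) (hf : IsWiring f) :
    Samp r c fun a => F (f a) := by
  obtain ⟨s, C, hs, hC, hF⟩ := hF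
  obtain ⟨φ, hφ⟩ := hf
  refine ⟨s, C.reindex (Sum.map φ fun i => i), hs, by simpa using hC, fun a => ?_⟩
  rw [← hF, hφ]
  congr 1
  funext ρ
  rw [Circuit.eval_reindex]
  congr 1
  funext w
  rcases w with w | w <;> rfl

/-- When every bit string is an encoding, a uniform element is encoded by uniform bits, and the
circuit only copies its tape. -/
theorem samp_uniform [Fintype β] [Nonempty β] (hβ : EncodeSurjective β) :
    Samp (bitLength β) (bitLength β) fun _ : α => PMF.uniformOfFintype β := by
  let e : Fin (bitLength β) ≃ Wire β := (Fintype.equivFin (Wire β)).symm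
  refine ⟨bitLength β, .wire fun w => Sum.inr (e.symm w), le_rfl, le_rfl, fun a => ?_⟩
  classical
  have h₁ := map_uniform_equiv (e.arrowCongr (Equiv.refl Bool))
  have h₂ := map_uniform_equiv
    (Equiv.ofBijective (encode : β → Wire β → Bool) ⟨encode_injective, hβ⟩)
  exact h₁.trans h₂.symm

/-- The second half of the tape has to bypass the first circuit on copied wires; this is the extra
`r'` in the size. -/
theorem Samp.bind {F : α → PMF β} {G : β → PMF γ} {r c r' c' : ℕ} (hF : Samp r c F)
    (hG : Samp r' c' G) : Samp (r + r') (c + c' + r') fun a => (F a).bind G := by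
  obtain ⟨s, C, hs, hC, hF⟩ := hF
  obtain ⟨s', C', hs', hC', hG⟩ := hG
  refine ⟨s + s', .comp
    (.pair (C.reindex (Sum.map (fun w => w) fun i => finSumFinEquiv (Sum.inl i)))
      (.wire fun i : Fin s' => Sum.inr (finSumFinEquiv (Sum.inr i)))) C', by omega, ?_, fun a => ?_⟩
  · simp only [Circuit.size, Circuit.size_reindex, Fintype.card_fin]
    omega
  · rw [← uniform_bits_add, PMF.map_bind, PMF.map_bind]
    have key : ∀ b, (G b).map encode = (PMF.uniformOfFintype (Bits s')).map
        fun ρ => C'.eval (Sum.elim (encode b) ρ) := fun b => (hG b).symm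
    have hF' : (F a).bind (fun b => (G b).map encode) = ((F a).map encode).bind fun x =>
        (PMF.uniformOfFintype (Bits s')).map fun ρ => C'.eval (Sum.elim x ρ) := by
      rw [PMF.bind_map]
      exact congrArg _ (funext key)
    rw [hF', ← hF, PMF.bind_map]
    congr 1
    funext ρ
    simp only [PMF.map_comp, Function.comp_def]
    congr 1
    funext ρ'
    simp only [Circuit.eval, Circuit.eval_reindex]
    congr 2
    · congr 1
      funext w
      rcases w with w | w <;> simp
    · funext i
      simp

theorem Samp.prod {F : α → PMF β} {G : α → PMF γ} {r c r' c' : ℕ} (hF : Samp r c F)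
    (hG : Samp r' c' G) :
    Samp (r + r') (c + c') fun a => (F a).bind fun b => (G a).map (Prod.mk b) := by
  obtain ⟨s, C, hs, hC, hF⟩ := hF
  obtain ⟨s', C', hs', hC', hG⟩ := hG
  refine ⟨s + s',
    .pair (C.reindex (Sum.map (fun w => w) fun i => finSumFinEquiv (Sum.inl i)))
      (C'.reindex (Sum.map (fun w => w) fun i => finSumFinEquiv (Sum.inr i))), by omega, ?_,
    fun a => ?_⟩
  · simp only [Circuit.size, Circuit.size_reindex]
    omega
  · rw [← uniform_bits_add, PMF.map_bind, PMF.map_bind]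
    have h : (F a).bind (fun b => ((G a).map (Prod.mk b)).map encode) =
        ((F a).map encode).bind fun x => ((G a).map encode).map fun y => Sum.elim x y := by
      simp only [PMF.bind_map, PMF.map_comp]
      rfl
    rw [h, ← hF, ← hG, PMF.bind_map]
    congr 1
    funext ρ
    simp only [PMF.map_comp, Function.comp_def]
    congr 1
    funext ρ'
    simp only [Circuit.eval, Circuit.eval_reindex]
    congr 2
    · funext w
      rcases w with w | w <;> simp
    · funext w
      rcases w with w | w <;> simp

/-- The input is copied alongside the first sample, at the price `bitLength α`, so that the second
sampler can use both. -/
theorem Samp.bindWith {F : α → PMF β} {G : α × β → PMF γ} {r c r' c' : ℕ} (hF : Samp r c F)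
    (hG : Samp r' c' G) :
    Samp (r + r') (bitLength α + c + c' + r') fun a => (F a).bind fun b => G (a, b) :=
  (((IsWiring.id.samp.prod hF).bind hG).congr fun a => by
    simp [PMF.bind_map, Function.comp_def]).mono (by omega) (by omega)

theorem Samp.map {F : α → PMF β} {f : β → γ} {r c c' : ℕ} (hF : Samp r c F) (hf : Comp c' f) :
    Samp r (c + c') fun a => (F a).map f :=
  hF.bind hf.samp

end Samplers

/-! # Distributions -/

section Distributions

variable {α β γ : Type}

theorem bind_congr_support {p : PMF α} {f g : α → PMF β} (h : ∀ a ∈ p.support, f a = g a) :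
    p.bind f = p.bind g := by
  ext b
  rw [PMF.bind_apply, PMF.bind_apply]
  refine tsum_congr fun a => ?_
  by_cases ha : a ∈ p.support
  · rw [h a ha]
  · rw [PMF.mem_support_iff, not_not] at ha
    simp [ha]

theorem toReal_bind_apply (p : PMF α) (f : α → PMF β) (b : β) :
    ((p.bind f) b).toReal = ∑' a, (p a).toReal * (f a b).toReal := by
  rw [PMF.bind_apply, ENNReal.tsum_toReal_eq]
  · simp
  · exact fun a => ENNReal.mul_ne_top (p.apply_ne_top a) ((f a).apply_ne_top b)

theorem summable_toReal_mul (p : PMF α) {f : α → ℝ} {C : ℝ} (hf : ∀ a, |f a| ≤ C) :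
    Summable fun a => (p a).toReal * f a := by
  have hp : Summable fun a => (p a).toReal := ENNReal.summable_toReal p.tsum_coe_ne_top
  refine Summable.of_norm_bounded (hp.mul_right C) fun a => ?_
  rw [norm_mul, Real.norm_eq_abs, Real.norm_eq_abs, abs_of_nonneg ENNReal.toReal_nonneg]
  exact mul_le_mul_of_nonneg_left (hf a) ENNReal.toReal_nonneg

/-- The difference of the two mixtures is the `p`-average of the differences of their components. -/
theorem abs_bind_sub_bind_le {p : PMF α} {f g : α → PMF β} {b : β} {ε : ℝ}
    (h : ∀ a ∈ p.support, |(f a b).toReal - (g a b).toReal| ≤ ε) :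
    |((p.bind f) b).toReal - ((p.bind g) b).toReal| ≤ ε := by
  have hle : ∀ (q : PMF β), |(q b).toReal| ≤ 1 := fun q => by
    rw [abs_of_nonneg ENNReal.toReal_nonneg]
    exact ENNReal.toReal_le_of_le_ofReal zero_le_one (by simpa using q.coe_le_one b)
  have hp : Summable fun a => (p a).toReal := ENNReal.summable_toReal p.tsum_coe_ne_top
  have hsum : ∑' a, (p a).toReal = 1 := by
    rw [← ENNReal.tsum_toReal_eq fun a => p.apply_ne_top a, p.tsum_coe, ENNReal.toReal_one]
  have hf := summable_toReal_mul p fun a => hle (f a)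
  have hg := summable_toReal_mul p fun a => hle (g a)
  rw [toReal_bind_apply, toReal_bind_apply, ← hf.tsum_sub hg, ← Real.norm_eq_abs]
  have hε : HasSum (fun a => (p a).toReal * ε) ε := by
    simpa [hsum] using hp.hasSum.mul_right ε
  refine tsum_of_norm_bounded hε fun a => ?_
  rw [← mul_sub, norm_mul, Real.norm_eq_abs, Real.norm_eq_abs,
    abs_of_nonneg ENNReal.toReal_nonneg]
  by_cases ha : a ∈ p.support
  · exact mul_le_mul_of_nonneg_left (h a ha) ENNReal.toReal_nonneg
  · rw [PMF.mem_support_iff, not_not] at ha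
    simp [ha]

end Distributions

/-! # Closeness for circuits of bounded size -/

/-- No circuit of size at most `s` distinguishes `X` and `Y` with advantage more than `ε`. -/
def Close {α : Type} [BitData α] (s : ℕ) (ε : ℝ) (X Y : PMF α) : Prop :=
  ∀ D : Circuit (Wire α) Unit, D.size ≤ s → |acceptProb X D - acceptProb Y D| ≤ ε

namespace Close

variable {α β ζ : Type} [BitData α] [BitData β] {s s' r c : ℕ} {ε ε' : ℝ}

theorem mono {X Y : PMF α} (h : Close s ε X Y) (hs : s' ≤ s) (hε : ε ≤ ε') : Close s' ε' X Y :=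
  fun D hD => (h D (hD.trans hs)).trans hε

theorem refl (X : PMF α) (hε : 0 ≤ ε) : Close s ε X X := fun D _ => by simpa using hε

theorem trans {X Y Z : PMF α} (h : Close s ε X Y) (h' : Close s ε' Y Z) :
    Close s (ε + ε') X Z := fun D hD =>
  (abs_sub_le _ _ _).trans (add_le_add (h D hD) (h' D hD))

/-- A distinguisher of two mixtures with the same mixing law does at least as well on some
component. The index `z` is fixed, so neither `ζ` nor the dependence on `z` has to be computable. -/
theorem bind {Z : PMF ζ} {X Y : ζ → PMF α} (h : ∀ z ∈ Z.support, Close s ε (X z) (Y z)) :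
    Close s ε (Z.bind X) (Z.bind Y) := by
  intro D hD
  unfold acceptProb
  rw [PMF.map_bind, PMF.map_bind]
  exact abs_bind_sub_bind_le fun z hz => h z hz D hD

/-- The reduction runs `F` and then `D`. The coins of `F` are averaged over outside and hard-wired;
the copied sample, the two constant gates, the coins and the circuit of `F` make up the loss in
size. -/
theorem bind_samp {X Y : PMF α} {F : α → PMF β}
    (h : Close (s + c + bitLength α + r + 2) ε X Y) (hF : Samp r c F) :
    Close s ε (X.bind F) (Y.bind F) := by
  obtain ⟨r', C, hr, hC, hF⟩ := hF
  intro D hD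
  have key : ∀ Z : PMF α, (Z.bind F).map (fun b => D.eval (encode b) ()) =
      (PMF.uniformOfFintype (Bits r')).bind fun ρ => Z.map fun a =>
        (Circuit.comp (.pair (.wire fun w => w) (Circuit.constant _ ρ)) (.comp C D)).eval
          (encode a) () := by
    intro Z
    have h₁ : (Z.bind F).map (fun b => D.eval (encode b) ()) =
        Z.bind fun a => ((F a).map encode).map fun x => D.eval x () := by
      simp only [PMF.map_bind, PMF.map_comp]
      rfl
    rw [h₁]
    simp_rw [← hF]
    simp only [PMF.map, PMF.bind_bind, PMF.pure_bind, Function.comp_def]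
    rw [PMF.bind_comm]
    simp [Circuit.eval]
  unfold acceptProb
  rw [key, key]
  refine abs_bind_sub_bind_le fun ρ _ => h _ ?_
  simp only [Circuit.size, Circuit.size_constant, Fintype.card_fin]
  change bitLength α + (2 + r') + (C.size + D.size) ≤ _
  omega

end Close

/-! # Secure evaluation in the presence of keys -/

/-- A source of keys; `key` is the part of the keys that is known to an observer. -/
structure Source where
  G : Type
  Key : Type
  [dataKey : BitData Key]
  law : PMF G
  key : G → Key

attribute [instance] Source.dataKey

/-- The joint law of the observer's keys and of `F`. -/
def Source.joint (σ : Source) {A : Type} (F : σ.G → PMF A) : PMF (σ.Key × A) :=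
  σ.law.bind fun g => (F g).map (Prod.mk (σ.key g))

/-- Let `F x g` be the law of what an observer sees, of type `V`, and of the outputs, of type `O`,
of a computation on the input `x` and the keys `g`. Suppose that no circuit of size at most `S` has
an advantage of more than `ε` against the primitives (`Base S ε`). Then the observer's view and
output `obs` are `n * ε`-close to a simulation from its keys and its input `inp x`. Moreover, the
outputs are independent of the keys, satisfy `Post`, and given the outputs the view can be sampled
from the keys. -/
structure Secure (σ : Source) (Base : ℕ → ℝ → Prop) (b c n : ℕ) {X V O I P : Type} [BitData V]
    [BitData I] [BitData P] (F : X → σ.G → PMF (V × O)) (inp : X → I) (obs : O → P)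
    (Post : X → O → Prop) : Prop where
  bits : bitLength σ.Key + bitLength V + bitLength I + bitLength P ≤ b
  sim : ∃ Sim : σ.Key × I → PMF (V × P), Samp b c Sim ∧
    ∀ S ε, 0 ≤ ε → Base S ε → ∀ x s, s + c ≤ S →
      Close s (n * ε) (σ.joint fun g => (F x g).map fun u => (u.1, obs u.2))
        (σ.joint fun g => Sim (σ.key g, inp x))
  mix : ∀ x, ∃ (Ω : Type) (W : PMF Ω) (T : Ω → σ.Key → PMF V) (out : Ω → O),
    (∀ g, F x g = W.bind fun w => (T w (σ.key g)).map fun v => (v, out w)) ∧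
    (∀ w, Samp b c (T w)) ∧ ∀ w ∈ W.support, Post x (out w)

/-- The second argument becomes non-uniform advice, built into the circuit by two constant gates and
copies. -/
theorem Comp.withConst {α β γ : Type} [BitData α] [BitData β] [BitData γ] {f : α × β → γ} {c : ℕ}
    (hf : Comp c f) (b : β) : Comp (c + bitLength α + bitLength β + 2) fun a => f (a, b) :=
  (hf.comp (IsWiring.id.computable.prodMk (Comp.const b))).mono (by omega)

namespace Secure

variable {σ : Source} {Base : ℕ → ℝ → Prop} {b c n b' c' n' : ℕ}
  {X V O I P X' V' O' I' P' : Type} [BitData V] [BitData I] [BitData P] [BitData V'] [BitData I']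
  [BitData P'] {F : X → σ.G → PMF (V × O)} {inp : X → I} {obs : O → P} {Post : X → O → Prop}
  {F' : X' → σ.G → PMF (V' × O')} {inp' : X' → I'} {obs' : O' → P'} {Post' : X' → O' → Prop}

theorem mono (h : Secure σ Base b c n F inp obs Post) (hb : b ≤ b') (hc : c ≤ c') (hn : n ≤ n') :
    Secure σ Base b' c' n' F inp obs Post := by
  obtain ⟨h₁, ⟨Sim, h₂, h₃⟩, h₄⟩ := h
  refine ⟨h₁.trans hb, ⟨Sim, h₂.mono hb hc, fun S ε hε hB x s hs => ?_⟩, fun x => ?_⟩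
  · exact (h₃ S ε hε hB x s (by omega)).mono le_rfl (by gcongr)
  · obtain ⟨Ω, W, T, out, h₅, h₆, h₇⟩ := h₄ x
    exact ⟨Ω, W, T, out, h₅, fun w => (h₆ w).mono hb hc, h₇⟩

/-- Sequential composition. -/
theorem seq (h : Secure σ Base b c n F inp obs Post) (h' : Secure σ Base b' c' n' F' inp' obs' Post')
    (next : X → O → X') {glue : I × P → I'} (hglue : IsWiring glue)
    (hnext : ∀ x o, Post x o → inp' (next x o) = glue (inp x, obs o)) :
    Secure σ Base (b + b') (c + c' + 20 * (b + b') + 20) (n + n')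
      (fun x g => (F x g).bind fun u => (F' (next x u.2) g).map fun u' => ((u.1, u'.1), (u.2, u'.2)))
      inp (fun o => (obs o.1, obs' o.2)) (fun x o => Post x o.1 ∧ Post' (next x o.1) o.2) := by
  obtain ⟨h₁, ⟨Sim, h₂, h₃⟩, h₄⟩ := h
  obtain ⟨h₁', ⟨Sim', h₂', h₃'⟩, h₄'⟩ := h'
  have hstep : Samp b' (c' + 10 * (b + b')) fun a : (σ.Key × I) × (V × P) =>
      (Sim' (a.1.1, glue (a.1.2, a.2.2))).map fun v => ((a.2.1, v.1), (a.2.2, v.2)) := by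
    have h₅ := (h₂'.comap (f := fun a : (σ.Key × I) × (V × P) => (a.1.1, glue (a.1.2, a.2.2)))
      (by fun_prop)).bindWith (IsWiring.samp (f := fun a : ((σ.Key × I) × (V × P)) × (V' × P') =>
        ((a.1.2.1, a.2.1), (a.1.2.2, a.2.2))) (by fun_prop))
    refine (h₅.congr fun a => rfl).mono le_rfl ?_
    simp only [bitLength_prod]
    omega
  refine ⟨?_, ⟨fun k => (Sim k).bind fun v => (Sim' (k.1, glue (k.2, v.2))).map
    fun v' => ((v.1, v'.1), (v.2, v'.2)), ?_, fun S ε hε hB x s hs => ?_⟩, fun x => ?_⟩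
  · simp only [bitLength_prod]
    omega
  · refine (h₂.bindWith hstep).mono le_rfl ?_
    simp only [bitLength_prod]
    omega
  · obtain ⟨Ω, W, T, out, hW, hT, hP⟩ := h₄ x
    -- The real run with the mixing variable `w` drawn before everything else: the second protocol
    -- has the fixed input `next x (out w)`, and the first view is sampled afterwards from the key.
    have e₁ : (σ.joint fun g => ((F x g).bind fun u => (F' (next x u.2) g).map
          fun u' => ((u.1, u'.1), (u.2, u'.2))).map fun u => (u.1, (obs u.2.1, obs' u.2.2))) =
        W.bind fun w => (σ.joint fun g => (F' (next x (out w)) g).map fun u => (u.1, obs' u.2)).bind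
          fun a => (T w a.1).map fun v => (a.1, ((v, a.2.1), (obs (out w), a.2.2))) := by
      simp only [Source.joint, hW, PMF.map, PMF.bind_bind, PMF.pure_bind, Function.comp_def]
      rw [PMF.bind_comm]
      refine congrArg _ (funext fun w => congrArg _ (funext fun g => ?_))
      rw [PMF.bind_comm]
    -- The hybrid, in two forms: real first protocol, simulated second. `hnext` is available because
    -- `Post` holds on the support of `W`, and it lets the second simulator work from what the
    -- observer knows.
    have e₂ : (W.bind fun w => (σ.joint fun g => Sim' (σ.key g, inp' (next x (out w)))).bind
          fun a => (T w a.1).map fun v => (a.1, ((v, a.2.1), (obs (out w), a.2.2)))) =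
        (σ.joint fun g => (F x g).map fun u => (u.1, obs u.2)).bind fun a =>
          (Sim' (a.1, glue (inp x, a.2.2))).map fun v => (a.1, ((a.2.1, v.1), (a.2.2, v.2))) := by
      simp only [Source.joint, hW, PMF.map, PMF.bind_bind, PMF.pure_bind, Function.comp_def]
      rw [PMF.bind_comm]
      refine congrArg _ (funext fun g => bind_congr_support fun w hw => ?_)
      rw [PMF.bind_comm, hnext _ _ (hP w hw)]
    have e₃ : (σ.joint fun g => (Sim (σ.key g, inp x)).bind fun v =>
          (Sim' ((σ.key g, inp x).1, glue ((σ.key g, inp x).2, v.2))).map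
            fun v' => ((v.1, v'.1), (v.2, v'.2))) =
        (σ.joint fun g => Sim (σ.key g, inp x)).bind fun a =>
          (Sim' (a.1, glue (inp x, a.2.2))).map fun v => (a.1, ((a.2.1, v.1), (a.2.2, v.2))) := by
      simp only [Source.joint, PMF.map, PMF.bind_bind, PMF.pure_bind, Function.comp_def]
    rw [e₁, e₃]
    have hε' : ((n + n' : ℕ) : ℝ) * ε = n' * ε + n * ε := by push_cast; ring
    rw [hε']
    refine Close.trans (Y := W.bind fun w =>
      (σ.joint fun g => Sim' (σ.key g, inp' (next x (out w)))).bind fun a =>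
        (T w a.1).map fun v => (a.1, ((v, a.2.1), (obs (out w), a.2.2)))) ?_ ?_
    -- Security of the second protocol for fixed `w`. The reduction extends its challenge by a first
    -- view sampled from the key, with `obs (out w)` hard-wired.
    · refine Close.bind fun w _ => ?_
      have h₅ : Samp b (c + 10 * (b + b') + 2) fun a : σ.Key × (V' × P') =>
          (T w a.1).map fun v => (a.1, ((v, a.2.1), (obs (out w), a.2.2))) := by
        have h₆ := ((hT w).comap (f := fun a : σ.Key × (V' × P') => a.1)
          (by fun_prop)).bindWith (Comp.samp (Comp.withConst (IsWiring.computable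
            (f := fun a : ((σ.Key × (V' × P')) × V) × P =>
              (a.1.1.1, ((a.1.2, a.1.1.2.1), (a.2, a.1.1.2.2)))) (by fun_prop)) (obs (out w))))
        refine (h₆.congr fun a => rfl).mono le_rfl ?_
        simp only [bitLength_prod]
        omega
      refine Close.bind_samp ((h₃' S ε hε hB (next x (out w)) _ ?_)) h₅
      simp only [bitLength_prod]
      omega
    -- Security of the first protocol. The reduction appends the simulation of the second, with `inp
    -- x` hard-wired.
    · rw [e₂]
      have h₅ : Samp b' (c' + 10 * (b + b') + 2) fun a : σ.Key × (V × P) =>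
          (Sim' (a.1, glue (inp x, a.2.2))).map fun v => (a.1, ((a.2.1, v.1), (a.2.2, v.2))) := by
        have h₆ := (Samp.bind (Comp.samp (Comp.withConst (IsWiring.computable
            (f := fun a : (σ.Key × (V × P)) × I => a) (by fun_prop)) (inp x)))
          ((h₂'.comap (f := fun a : (σ.Key × (V × P)) × I => (a.1.1, glue (a.2, a.1.2.2)))
            (by fun_prop)).bindWith (IsWiring.samp
              (f := fun a : ((σ.Key × (V × P)) × I) × (V' × P') =>
                (a.1.1.1, ((a.1.1.2.1, a.2.1), (a.1.1.2.2, a.2.2)))) (by fun_prop))))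
        refine (h₆.congr fun a => ?_).mono ?_ ?_
        · rw [PMF.pure_bind]
          rfl
        · omega
        · simp only [bitLength_prod]
          omega
      refine Close.bind_samp (h₃ S ε hε hB x _ ?_) h₅
      simp only [bitLength_prod]
      omega
  · obtain ⟨Ω, W, T, out, hW, hT, hP⟩ := h₄ x
    choose Ω' W' T' out' hW' hT' hP' using fun w => h₄' (next x (out w))
    -- The law of the second mixing variable depends on the value of the first through the outputs,
    -- but on no key.
    refine ⟨Σ w, Ω' w, W.bind fun w => (W' w).map (Sigma.mk w),
      fun w k => (T w.1 k).bind fun v => (T' w.1 w.2 k).map fun v' => (v, v'),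
      fun w => (out w.1, out' w.1 w.2), fun g => ?_, fun w => ?_, ?_⟩
    · simp only [hW, hW', PMF.map, PMF.bind_bind, PMF.pure_bind, Function.comp_def]
      refine congrArg _ (funext fun w => ?_)
      rw [PMF.bind_comm]
    · exact ((hT w.1).prod (hT' w.1 w.2)).mono le_rfl (by omega)
    · rintro ⟨w, w'⟩ hw
      simp only [PMF.mem_support_bind_iff, PMF.mem_support_map_iff] at hw
      obtain ⟨w₀, hw₀, w₁, hw₁, h₅⟩ := hw
      cases h₅
      exact ⟨hP w hw₀, hP' w w' hw₁⟩

/-- Change of the format of inputs, views and outputs. -/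
theorem reshape (h : Secure σ Base b c n F inp obs Post) (φ : X' → X) (hO : X' → O → O')
    {hI : I' → I} {hV : V → V'} {hP : I' × P → P'} (wI : IsWiring hI) (wV : IsWiring hV)
    (wP : IsWiring hP)
    (hF : ∀ x g, F' x g = (F (φ x) g).map fun u => (hV u.1, hO x u.2))
    (hinp : ∀ x, inp (φ x) = hI (inp' x))
    (hobs : ∀ x o, Post (φ x) o → obs' (hO x o) = hP (inp' x, obs o))
    (hPost : ∀ x o, Post (φ x) o → Post' x (hO x o))
    (hb : b ≤ b') (hb' : bitLength σ.Key + bitLength V' + bitLength I' + bitLength P' ≤ b') :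
    Secure σ Base b' (c + 40 * b' + 20) n F' inp' obs' Post' := by
  obtain ⟨h₁, ⟨Sim, h₂, h₃⟩, h₄⟩ := h
  refine ⟨by omega, ⟨fun k => (Sim (k.1, hI k.2)).map fun v => (hV v.1, hP (k.2, v.2)), ?_,
    fun S ε hε hB x s hs => ?_⟩, fun x => ?_⟩
  · have h₅ := (h₂.comap (f := fun a : σ.Key × I' => (a.1, hI a.2)) (by fun_prop)).bindWith
      (IsWiring.samp (f := fun a : (σ.Key × I') × (V × P) => (hV a.2.1, hP (a.1.2, a.2.2)))
        (by fun_prop))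
    refine (h₅.congr fun a => rfl).mono (by omega) ?_
    simp only [bitLength_prod]
    omega
  · obtain ⟨Ω, W, T, out, hW, hT, hPo⟩ := h₄ (φ x)
    have e₁ : (σ.joint fun g => (F' x g).map fun u => (u.1, obs' u.2)) =
        (σ.joint fun g => (F (φ x) g).map fun u => (u.1, obs u.2)).bind fun a =>
          PMF.pure (a.1, (hV a.2.1, hP (inp' x, a.2.2))) := by
      simp only [Source.joint, hF, hW, PMF.map, PMF.bind_bind, PMF.pure_bind, Function.comp_def]
      refine congrArg _ (funext fun g => bind_congr_support fun w hw => ?_)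
      rw [hobs _ _ (hPo w hw)]
    have e₂ : (σ.joint fun g => (Sim ((σ.key g, inp' x).1, hI (σ.key g, inp' x).2)).map
          fun v => (hV v.1, hP ((σ.key g, inp' x).2, v.2))) =
        (σ.joint fun g => Sim (σ.key g, inp (φ x))).bind fun a =>
          PMF.pure (a.1, (hV a.2.1, hP (inp' x, a.2.2))) := by
      simp only [Source.joint, hinp, PMF.map, PMF.bind_bind, PMF.pure_bind, Function.comp_def]
    rw [e₁, e₂]
    have h₅ : Samp 0 (10 * b' + 2) fun a : σ.Key × (V × P) =>
        PMF.pure (a.1, (hV a.2.1, hP (inp' x, a.2.2))) := by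
      refine (Comp.samp (Comp.withConst (IsWiring.computable
        (f := fun a : (σ.Key × (V × P)) × I' => (a.1.1, (hV a.1.2.1, hP (a.2, a.1.2.2))))
          (by fun_prop)) (inp' x))).mono le_rfl ?_
      simp only [bitLength_prod]
      omega
    refine Close.bind_samp (h₃ S ε hε hB (φ x) _ ?_) h₅
    simp only [bitLength_prod]
    omega
  · obtain ⟨Ω, W, T, out, hW, hT, hPo⟩ := h₄ (φ x)
    refine ⟨Ω, W, fun w k => (T w k).map hV, fun w => hO x (out w), fun g => ?_, fun w => ?_,
      fun w hw => hPost _ _ (hPo w hw)⟩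
    · simp only [hF, hW, PMF.map, PMF.bind_bind, PMF.pure_bind, Function.comp_def]
    · exact ((hT w).map wV.computable).mono (by omega) (by omega)

/-- Change of the format of inputs. -/
theorem pull (h : Secure σ Base b c n F inp obs Post) (φ : X' → X) (inp' : X' → I') {hI : I' → I}
    (wI : IsWiring hI) (hinp : ∀ x, inp (φ x) = hI (inp' x)) (hb : bitLength I' + b ≤ b') :
    Secure σ Base b' (c + 40 * b' + 20) n (fun x => F (φ x)) inp' obs fun x => Post (φ x) := by
  have hbits := h.bits
  refine h.reshape φ (fun _ o => o) (hV := fun v => v) (hP := fun p => p.2) wI (by fun_prop)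
    (by fun_prop) (fun x g => ?_) hinp (fun _ _ _ => rfl) (fun _ _ ho => ho) (by omega) (by omega)
  exact (PMF.map_id _).symm

/-- A deterministic computation whose view and output are a function of the observer's input. -/
theorem det {f : I → V × P} {v : X → V} {o : X → O} (hf : Comp c f)
    (hF : ∀ x g, F x g = PMF.pure (v x, o x)) (hv : ∀ x, (v x, obs (o x)) = f (inp x))
    (hPost : ∀ x, Post x (o x))
    (hb : bitLength σ.Key + bitLength V + bitLength I + bitLength P ≤ b) :
    Secure σ Base b (c + b + 2) 0 F inp obs Post := by
  refine ⟨hb, ⟨fun k => PMF.pure (f k.2), ?_, fun S ε hε hB x s hs => ?_⟩, fun x => ?_⟩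
  · exact ((hf.comap (f := fun k : σ.Key × I => k.2) (by fun_prop)).samp).mono (by omega) (by omega)
  · simp only [hF, PMF.pure_map, hv]
    exact Close.refl _ (by simp)
  · refine ⟨Unit, PMF.pure (), fun _ _ => PMF.pure (v x), fun _ => o x, fun g => ?_, fun _ => ?_,
      fun _ _ => hPost x⟩
    · rw [PMF.pure_bind, PMF.pure_map, hF]
    · exact (Comp.const (v x)).samp.mono (by omega) (by omega)

end Secure

/-! # What one party sees, together with the outputs of both -/

namespace Proto

variable {A B A' B' A'' B'' S R M C : Type}

/-- The law of what party 0 sees and of the outputs. -/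
def run₀ (p : Proto A B A' B') (a : A) (b : B) : PMF (p.Seen₀ × (A' × B')) :=
  (p.exec a b).map fun u => (u.1.1, u.2)

/-- The law of what party 1 sees and of the outputs. -/
def run₁ (p : Proto A B A' B') (a : A) (b : B) : PMF (p.Seen₁ × (A' × B')) :=
  (p.exec a b).map fun u => (u.1.2, u.2)

theorem run₀_loc (f : A → A') (g : B → B') (a : A) (b : B) :
    (loc f g).run₀ a b = PMF.pure ((), (f a, g b)) := PMF.pure_map _ _

theorem run₁_loc (f : A → A') (g : B → B') (a : A) (b : B) :
    (loc f g).run₁ a b = PMF.pure ((), (f a, g b)) := PMF.pure_map _ _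

theorem run₀_coin₀ [BitData C] [Fintype C] [Nonempty C] (a : A) (b : B) :
    (coin₀ C).run₀ a b = (PMF.uniformOfFintype C).bind fun c => PMF.pure (c, ((a, c), b)) :=
  PMF.map_comp _ _ _

theorem run₁_coin₀ [BitData C] [Fintype C] [Nonempty C] (a : A) (b : B) :
    (coin₀ C).run₁ a b = (PMF.uniformOfFintype C).bind fun c => PMF.pure ((), ((a, c), b)) :=
  PMF.map_comp _ _ _

theorem run₀_coin₁ [BitData C] [Fintype C] [Nonempty C] (a : A) (b : B) :
    (coin₁ C).run₀ a b = (PMF.uniformOfFintype C).bind fun c => PMF.pure ((), (a, (b, c))) :=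
  PMF.map_comp _ _ _

theorem run₁_coin₁ [BitData C] [Fintype C] [Nonempty C] (a : A) (b : B) :
    (coin₁ C).run₁ a b = (PMF.uniformOfFintype C).bind fun c => PMF.pure (c, (a, (b, c))) :=
  PMF.map_comp _ _ _

theorem run₀_send₀ [BitData M] (f : A → M) (a : A) (b : B) :
    (send₀ f).run₀ a b = PMF.pure ((), (a, (b, f a))) := PMF.pure_map _ _

theorem run₁_send₀ [BitData M] (f : A → M) (a : A) (b : B) :
    (send₀ f).run₁ a b = PMF.pure (f a, (a, (b, f a))) := PMF.pure_map _ _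

theorem run₀_send₁ [BitData M] (f : B → M) (a : A) (b : B) :
    (send₁ f).run₀ a b = PMF.pure (f b, ((a, f b), b)) := PMF.pure_map _ _

theorem run₁_send₁ [BitData M] (f : B → M) (a : A) (b : B) :
    (send₁ f).run₁ a b = PMF.pure ((), ((a, f b), b)) := PMF.pure_map _ _

/-- The second protocol depends on the first only through the outputs of both parties, so the other
party's view can be forgotten before composing. -/
theorem run₀_seq (p : Proto A B A' B') (q : Proto A' B' A'' B'') (a : A) (b : B) :
    (p ⨟ q).run₀ a b = (p.run₀ a b).bind fun u => (q.run₀ u.2.1 u.2.2).bind fun v =>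
      PMF.pure ((u.1, v.1), v.2) := by
  simp only [run₀, exec, PMF.map, PMF.bind_bind, PMF.pure_bind, Function.comp_def]
  rfl

theorem run₁_seq (p : Proto A B A' B') (q : Proto A' B' A'' B'') (a : A) (b : B) :
    (p ⨟ q).run₁ a b = (p.run₁ a b).bind fun u => (q.run₁ u.2.1 u.2.2).bind fun v =>
      PMF.pure ((u.1, v.1), v.2) := by
  simp only [run₁, exec, PMF.map, PMF.bind_bind, PMF.pure_bind, Function.comp_def]
  rfl

theorem run₀_call (p : Proto A B A' B') (f : S → A) (g : R → B) (s : S) (r : R) :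
    (p.call f g).run₀ s r = (p.run₀ (f s) (g r)).bind fun u =>
      PMF.pure (((), u.1), ((s, u.2.1), (r, u.2.2))) := by
  simp only [run₀, call, exec, PMF.map, PMF.bind_bind, PMF.pure_bind, Function.comp_def]
  rfl

theorem run₁_call (p : Proto A B A' B') (f : S → A) (g : R → B) (s : S) (r : R) :
    (p.call f g).run₁ s r = (p.run₁ (f s) (g r)).bind fun u =>
      PMF.pure (((), u.1), ((s, u.2.1), (r, u.2.2))) := by
  simp only [run₁, call, exec, PMF.map, PMF.bind_bind, PMF.pure_bind, Function.comp_def]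
  rfl

end Proto

/-! # Bounds for a homomorphic encryption scheme, at one security parameter -/

/-- The simulators of evaluated ciphertexts. -/
structure EvalSim {l : ℕ} (E : HEScheme l) where
  sim : ∀ n m, E.PK × E.SK × E.Ct n × Vec l m → PMF (E.Ct m)
  sim₂ : ∀ n n' m, E.PK × E.SK × E.Ct n × E.Ct n' × Vec l m → PMF (E.Ct m)

/-- For tensors with at most `q` entries, the costs of the scheme `E` are at most `B`, and `E` is
correct. -/
structure HEBound {l : ℕ} (E : HEScheme l) (ev : EvalSim E) (q B : ℕ) : Prop where
  one_le : 1 ≤ B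
  genCoins_le : E.genCoins ≤ B
  pkLen_le : E.pkLen ≤ B
  skLen_le : E.skLen ≤ B
  vec_le : ∀ n ≤ q, n * l ≤ B
  mat_le : ∀ n ≤ q, ∀ m ≤ q, m * (n * l) ≤ B
  encCoins_le : ∀ n ≤ q, E.encCoins n ≤ B
  ctLen_le : ∀ n ≤ q, E.ctLen n ≤ B
  evalCoins_le : ∀ n ≤ q, ∀ m ≤ q, E.evalCoins n m ≤ B
  eval₂Coins_le : ∀ n ≤ q, ∀ n' ≤ q, ∀ m ≤ q, E.eval₂Coins n n' m ≤ B
  gen : Comp B E.gen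
  enc : ∀ n ≤ q, Comp B fun a : E.PK × Vec l n × Bits (E.encCoins n) => E.enc n a.1 a.2.1 a.2.2
  dec : ∀ n ≤ q, Comp B fun a : E.SK × E.Ct n => E.dec n a.1 a.2
  eval : ∀ n ≤ q, ∀ m ≤ q, Comp B fun a : E.PK × Mat l m n × Vec l m × E.Ct n ×
    Bits (E.evalCoins n m) => E.eval n m a.1 a.2.1 a.2.2.1 a.2.2.2.1 a.2.2.2.2
  eval₂ : ∀ n ≤ q, ∀ n' ≤ q, ∀ m ≤ q, Comp B fun a : E.PK × Mat l m n × Mat l m n' × Vec l m ×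
    E.Ct n × E.Ct n' × Bits (E.eval₂Coins n n' m) =>
      E.eval₂ n n' m a.1 a.2.1 a.2.2.1 a.2.2.2.1 a.2.2.2.2.1 a.2.2.2.2.2.1 a.2.2.2.2.2.2
  sim : ∀ n ≤ q, ∀ m ≤ q, Samp B B (ev.sim n m)
  sim₂ : ∀ n ≤ q, ∀ n' ≤ q, ∀ m ≤ q, Samp B B (ev.sim₂ n n' m)
  dec_eval : ∀ n m g x r A c s, E.dec m (E.gen g).2
    (E.eval n m (E.gen g).1 A c (E.enc n (E.gen g).1 x r) s) = A.mulVec x + c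
  dec_eval₂ : ∀ n n' m g x y r r' A A' c s, E.dec m (E.gen g).2
    (E.eval₂ n n' m (E.gen g).1 A A' c (E.enc n (E.gen g).1 x r) (E.enc n' (E.gen g).1 y r') s) =
      A.mulVec x + A'.mulVec y + c

/-- Circuits of size at most `S` have an advantage of at most `ε` against the scheme. -/
structure HEClose {l : ℕ} (E : HEScheme l) (ev : EvalSim E) (q S : ℕ) (ε : ℝ) : Prop where
  enc : ∀ n ≤ q, ∀ x y : Vec l n, Close S ε
    ((PMF.uniformOfFintype (Bits E.genCoins × Bits (E.encCoins n))).map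
      fun ω => ((E.gen ω.1).1, E.enc n (E.gen ω.1).1 x ω.2))
    ((PMF.uniformOfFintype (Bits E.genCoins × Bits (E.encCoins n))).map
      fun ω => ((E.gen ω.1).1, E.enc n (E.gen ω.1).1 y ω.2))
  eval : ∀ n ≤ q, ∀ m ≤ q, ∀ (x : Vec l n) (A : Mat l m n) (c : Vec l m), Close S ε
    ((PMF.uniformOfFintype (Bits E.genCoins × Bits (E.encCoins n) × Bits (E.evalCoins n m))).map
      fun ω => (ω.1, ω.2.1,
        E.eval n m (E.gen ω.1).1 A c (E.enc n (E.gen ω.1).1 x ω.2.1) ω.2.2))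
    ((PMF.uniformOfFintype (Bits E.genCoins × Bits (E.encCoins n))).bind
      fun ω => (ev.sim n m ((E.gen ω.1).1, (E.gen ω.1).2, E.enc n (E.gen ω.1).1 x ω.2,
        A.mulVec x + c)).map fun ct => (ω.1, ω.2, ct))
  eval₂ : ∀ n ≤ q, ∀ n' ≤ q, ∀ m ≤ q, ∀ (x : Vec l n) (y : Vec l n') (A : Mat l m n)
    (A' : Mat l m n') (c : Vec l m), Close S ε
    ((PMF.uniformOfFintype (Bits E.genCoins × Bits (E.encCoins n) × Bits (E.encCoins n') ×
        Bits (E.eval₂Coins n n' m))).map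
      fun ω => (ω.1, ω.2.1, ω.2.2.1, E.eval₂ n n' m (E.gen ω.1).1 A A' c
        (E.enc n (E.gen ω.1).1 x ω.2.1) (E.enc n' (E.gen ω.1).1 y ω.2.2.1) ω.2.2.2))
    ((PMF.uniformOfFintype (Bits E.genCoins × Bits (E.encCoins n) × Bits (E.encCoins n'))).bind
      fun ω => (ev.sim₂ n n' m ((E.gen ω.1).1, (E.gen ω.1).2, E.enc n (E.gen ω.1).1 x ω.2.1,
        E.enc n' (E.gen ω.1).1 y ω.2.2, A.mulVec x + A'.mulVec y + c)).map
          fun ct => (ω.1, ω.2.1, ω.2.2, ct))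

/-- The model owner knows the public key. -/
abbrev moSource {l : ℕ} (E : HEScheme l) : Source where
  G := Bits E.genCoins
  Key := E.PK
  law := PMF.uniformOfFintype _
  key g := (E.gen g).1

/-- The data owner knows the coins of the key generation. -/
abbrev doSource {l : ℕ} (E : HEScheme l) : Source where
  G := Bits E.genCoins
  Key := Bits E.genCoins
  law := PMF.uniformOfFintype _
  key g := g

theorem bind_congr {α β : Type} {p : PMF α} {f g : α → PMF β} (h : ∀ a, f a = g a) :
    p.bind f = p.bind g :=
  congrArg _ (funext h)

theorem Close.congr {α : Type} [BitData α] {s : ℕ} {ε : ℝ} {X Y X' Y' : PMF α}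
    (h : Close s ε X Y) (hX : X' = X) (hY : Y' = Y) : Close s ε X' Y' := by
  rwa [hX, hY]

/-! ### Affine maps on shares by homomorphic encryption. -/

section Affine

variable {l q B : ℕ} {E : HEScheme l} {ev : EvalSim E} {Base : ℕ → ℝ → Prop} {n m : ℕ}

theorem isWiring_affineSeen₁ (E : HEScheme l) (n m : ℕ) :
    IsWiring (α := Bits (E.encCoins n) × E.Ct m) (β := (affineProt E n m).Seen₁) fun v =>
      (((((v.1, ()), ()), ()), v.2), ()) := by
  -- The recursively defined type of the view is unfolded to an explicit product for `fun_prop`; the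
  -- silent steps contribute factors without bits.
  change IsWiring (α := Bits (E.encCoins n) × E.Ct m) (β := (((((Bits (E.encCoins n) × Unit) × Unit) × Unit) × E.Ct m) × Unit))
    fun v => (((((v.1, ()), ()), ()), v.2), ())
  fun_prop

theorem isWiring_affineSeen₀ (E : HEScheme l) (n m : ℕ) :
    IsWiring (α := E.Ct n × Vec l m × Bits (E.evalCoins n m)) (β := (affineProt E n m).Seen₀) fun v =>
      ((((((), v.1), v.2.1), v.2.2), ()), ()) := by
  change IsWiring (α := E.Ct n × Vec l m × Bits (E.evalCoins n m)) (β := (((((Unit × E.Ct n) × Vec l m) × Bits (E.evalCoins n m)) × Unit) × Unit))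
    fun v => ((((((), v.1), v.2.1), v.2.2), ()), ())
  fun_prop

/-- By perfect correctness the decrypted share is an expression in the inputs and the mask `s`, free
of keys and encryption coins. This is what allows `s` to be the mixing variable. -/
theorem run₁_affine (hE : HEBound E ev q B) (x : Mat l m n × Vec l m × Vec l n × Vec l n)
    (g : Bits E.genCoins) :
    (affineProt E n m).run₁ ((E.gen g).1, x.1, x.2.1, x.2.2.1) (E.gen g, x.2.2.2) =
      ((PMF.uniformOfFintype (Bits (E.encCoins n))).bind fun r =>
        (PMF.uniformOfFintype (Vec l m)).bind fun s =>
          (PMF.uniformOfFintype (Bits (E.evalCoins n m))).bind fun r' =>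
            PMF.pure ((r, E.eval n m (E.gen g).1 x.1 (x.1.mulVec x.2.2.1 - s)
              (E.enc n (E.gen g).1 x.2.2.2 r) r'),
                (s + x.2.1, x.1.mulVec x.2.2.2 + (x.1.mulVec x.2.2.1 - s)))).map
      fun u => ((((((u.1.1, ()), ()), ()), u.1.2), ()), u.2) := by
  simp only [affineProt, Proto.run₁_seq, Proto.run₁_coin₁, Proto.run₁_send₁, Proto.run₁_coin₀,
    Proto.run₁_send₀, Proto.run₁_loc]
  dsimp only [Proto.Seen₁]
  simp only [PMF.bind_bind, PMF.pure_bind, PMF.map, Function.comp_def,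
    hE.dec_eval]

theorem run₀_affine (hE : HEBound E ev q B) (x : Mat l m n × Vec l m × Vec l n × Vec l n)
    (g : Bits E.genCoins) :
    (affineProt E n m).run₀ ((E.gen g).1, x.1, x.2.1, x.2.2.1) (E.gen g, x.2.2.2) =
      ((PMF.uniformOfFintype (Bits (E.encCoins n))).bind fun r =>
        (PMF.uniformOfFintype (Vec l m)).bind fun s =>
          (PMF.uniformOfFintype (Bits (E.evalCoins n m))).bind fun r' =>
            PMF.pure ((E.enc n (E.gen g).1 x.2.2.2 r, s, r'),
                (s + x.2.1, x.1.mulVec x.2.2.2 + (x.1.mulVec x.2.2.1 - s)))).map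
      fun u => (((((((), u.1.1), u.1.2.1), u.1.2.2), ()), ()), u.2) := by
  simp only [affineProt, Proto.run₀_seq, Proto.run₀_coin₁, Proto.run₀_send₁, Proto.run₀_coin₀,
    Proto.run₀_send₀, Proto.run₀_loc]
  dsimp only [Proto.Seen₀]
  simp only [PMF.bind_bind, PMF.pure_bind, PMF.map, Function.comp_def,
    hE.dec_eval]

/-- The ciphertext received by the data owner can be simulated from its plaintext `A X₁ + A X₀ - s`.
For uniform `s` this is uniform, so the simulator draws its output share at random and feeds it to
the simulator of evaluated ciphertexts. -/
theorem secure₁_affine (hE : HEBound E ev q B) (hB : ∀ S ε, Base S ε → HEClose E ev q S ε)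
    (hn : n ≤ q) (hm : m ≤ q) :
    Secure (doSource E) Base (100 * B) (10000 * B) 1
      (fun (x : Mat l m n × Vec l m × Vec l n × Vec l n) g =>
        (affineProt E n m).run₁ ((E.gen g).1, x.1, x.2.1, x.2.2.1) (E.gen g, x.2.2.2))
      (fun x => x.2.2.2) (fun o => o.2) (fun x o => o.1 + o.2 = x.1.mulVec (x.2.2.1 + x.2.2.2) + x.2.1) := by
  have b₀ := hE.one_le
  have b₁ := hE.genCoins_le
  have b₂ := hE.pkLen_le
  have b₃ := hE.skLen_le
  have b₄ := hE.vec_le n hn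
  have b₅ := hE.vec_le m hm
  have b₆ := hE.encCoins_le n hn
  have b₇ := hE.ctLen_le n hn
  have b₈ := hE.ctLen_le m hm
  have b₉ := hE.evalCoins_le n hn m hm
  have b₁₀ := hE.mat_le n hn m hm
  have hclean : Secure (doSource E) Base (20 * B) (1000 * B) 1
      (fun (x : Mat l m n × Vec l m × Vec l n × Vec l n) g =>
        (PMF.uniformOfFintype (Bits (E.encCoins n))).bind fun r =>
          (PMF.uniformOfFintype (Vec l m)).bind fun s =>
            (PMF.uniformOfFintype (Bits (E.evalCoins n m))).bind fun r' =>
              PMF.pure ((r, E.eval n m (E.gen g).1 x.1 (x.1.mulVec x.2.2.1 - s)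
                (E.enc n (E.gen g).1 x.2.2.2 r) r'),
                  (s + x.2.1, x.1.mulVec x.2.2.2 + (x.1.mulVec x.2.2.1 - s))))
      (fun x => x.2.2.2) (fun o => o.2)
      (fun x o => o.1 + o.2 = x.1.mulVec (x.2.2.1 + x.2.2.2) + x.2.1) := by
    -- The simulator knows the coins of the key generation: it recomputes the keys, encrypts its
    -- share with fresh coins, and calls `ev.sim` on a uniform plaintext.
    have hsim := ((samp_uniform (α := Bits E.genCoins × Vec l n)
      ((encodeSurjective_bits (E.encCoins n)).prod (encodeSurjective_vec l m))).bindWith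
        ((hE.gen.samp.comap (f := fun a => a.1.1) (by fun_prop)).bindWith
          (((hE.enc n hn).samp.comap
            (f := fun a => (a.2.1, a.1.1.2, a.1.2.1)) (by fun_prop)).bindWith
              (((hE.sim n hn m hm).comap
                (f := fun a => (a.1.2.1, a.1.2.2, a.2, a.1.1.2.2)) (by fun_prop)).bindWith
                  (IsWiring.samp (f := fun a => ((a.1.1.1.2.1, a.2), a.1.1.1.2.2))
                    (by fun_prop))))))
    refine ⟨?_, ⟨_, hsim.mono ?_ ?_, fun S ε hε hS x s hs => ?_⟩, fun x => ?_⟩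
    · simp only [bitLength_prod, bitLength_fin, bitLength_bool, bitLength_zmod]
      omega
    · simp only [bitLength_prod, bitLength_fin, bitLength_bool, bitLength_zmod]
      omega
    · simp only [bitLength_prod, bitLength_fin, bitLength_bool, bitLength_zmod]
      omega
    · have hpost : ∀ y : Vec l m, Samp 0 (40 * B)
          fun a : Bits E.genCoins × Bits (E.encCoins n) × E.Ct m => PMF.pure (a.1, (a.2, y)) := by
        intro y
        refine (Comp.samp (Comp.withConst (IsWiring.computable
          (f := fun a : (Bits E.genCoins × Bits (E.encCoins n) × E.Ct m) × Vec l m =>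
            (a.1.1, (a.1.2, a.2))) (by fun_prop)) y)).mono le_rfl ?_
        simp only [bitLength_prod, bitLength_fin, bitLength_bool, bitLength_zmod]
        omega
      -- For a fixed mask the output share is a constant, so function privacy applies and the share
      -- is appended by post-processing.
      have hcl := Close.bind (Z := PMF.uniformOfFintype (Vec l m)) fun s' _ =>
        Close.bind_samp (s := s) ((hB S ε hS).eval n hn m hm x.2.2.2 x.1 (x.1.mulVec x.2.2.1 - s')
          |>.mono (by
            simp only [bitLength_prod, bitLength_fin, bitLength_bool]
            omega) le_rfl) (hpost (x.1.mulVec x.2.2.2 + (x.1.mulVec x.2.2.1 - s')))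
      refine (hcl.mono le_rfl (by simp)).congr ?_ ?_
      · simp only [Source.joint, uniform_prod, PMF.map, PMF.bind_bind, PMF.pure_bind,
          Function.comp_def]
        conv_rhs => rw [PMF.bind_comm]
        refine bind_congr fun g => ?_
        conv_rhs => rw [PMF.bind_comm]
      · simp only [Source.joint, uniform_prod, PMF.map, PMF.bind_bind, PMF.pure_bind,
          Function.comp_def]
        conv_rhs => rw [PMF.bind_comm]
        refine bind_congr fun g => ?_
        conv_rhs => rw [PMF.bind_comm]
        refine bind_congr fun r => ?_
        simp only [← add_sub_assoc]
        -- Substitution `s ↦ A (X₁ + X₀) - s`, which turns the uniform mask into the uniform output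
        -- share drawn by the simulator.
        exact (bind_uniform_equiv (Equiv.subLeft (x.1.mulVec x.2.2.2 + x.1.mulVec x.2.2.1))
          fun y => (ev.sim n m ((E.gen g).1, (E.gen g).2, E.enc n (E.gen g).1 x.2.2.2 r, y)).bind
            fun a => PMF.pure (g, (r, a), y)).symm
    -- Given the mask, the view is recomputed from the key with the inputs of both parties
    -- hard-wired.
    · have hT := fun s : Vec l m => ((samp_uniform (α := Bits E.genCoins)
        ((encodeSurjective_bits (E.encCoins n)).prod
          (encodeSurjective_bits (E.evalCoins n m)))).bindWith
        ((hE.gen.samp.comap (f := fun a => a.1) (by fun_prop)).bindWith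
          (((Comp.withConst ((hE.enc n hn).comap (f := fun a =>
              (a.1.2.1, a.2, a.1.1.2.1)) (by fun_prop)) x.2.2.2).samp).bindWith
            ((Comp.withConst ((hE.eval n hn m hm).comap (f := fun a =>
              (a.1.1.2.1, a.2.1, a.2.2, a.1.2, a.1.1.1.2.2)) (by fun_prop))
                (x.1, x.1.mulVec x.2.2.1 - s)).samp.bindWith
                  (IsWiring.samp (f := fun a => (a.1.1.1.2.1, a.2)) (by fun_prop))))))
      refine ⟨Vec l m, PMF.uniformOfFintype _, _, fun s =>
        (s + x.2.1, x.1.mulVec x.2.2.2 + (x.1.mulVec x.2.2.1 - s)), fun g => ?_,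
        fun s => (hT s).mono ?_ ?_, fun s _ => ?_⟩
      · simp only [uniform_prod, PMF.map, PMF.bind_bind, PMF.pure_bind, Function.comp_def]
        rw [PMF.bind_comm]
      · simp only [bitLength_prod, bitLength_fin, bitLength_bool]
        omega
      · simp only [bitLength_prod, bitLength_fin, bitLength_bool, bitLength_zmod,
          bitLength_matrix]
        omega
      · simp only [Matrix.mulVec_add]
        abel
  have hbits : bitLength (affineProt E n m).Seen₁ ≤ 2 * B := by
    change bitLength (((((Bits (E.encCoins n) × Unit) × Unit) × Unit) × E.Ct m) × Unit) ≤ _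
    simp only [bitLength_prod, bitLength_fin, bitLength_bool, bitLength_unit]
    omega
  refine (hclean.reshape (b' := 40 * B) (fun x => x) (fun x o => o) (hI := fun i => i)
    (hP := fun i => i.2) (by fun_prop) (isWiring_affineSeen₁ E n m) (by fun_prop)
    (fun x g => run₁_affine hE x g)
    (fun x => rfl) (fun x o _ => rfl) (fun x o h => h) ?_ ?_).mono ?_ ?_ le_rfl
  · omega
  · simp only [bitLength_fin, bitLength_bool, bitLength_zmod]
    omega
  · omega
  · omega

/-- The only message to the model owner is an encryption of `X₁`, exchanged for one of `0`. The rest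
of its view is its own coins, and its output is `s + b`; hence the bias is the only input that the
simulator needs. -/
theorem secure₀_affine (hE : HEBound E ev q B) (hB : ∀ S ε, Base S ε → HEClose E ev q S ε)
    (hn : n ≤ q) (hm : m ≤ q) (hadd : Comp (30 * B) fun a : Vec l m × Vec l m => a.1 + a.2) :
    Secure (moSource E) Base (100 * B) (10000 * B) 1
      (fun (x : Mat l m n × Vec l m × Vec l n × Vec l n) g =>
        (affineProt E n m).run₀ ((E.gen g).1, x.1, x.2.1, x.2.2.1) (E.gen g, x.2.2.2))
      (fun x => x.2.1) (fun o => o.1)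
      (fun x o => o.1 + o.2 = x.1.mulVec (x.2.2.1 + x.2.2.2) + x.2.1) := by
  have b₀ := hE.one_le
  have b₁ := hE.genCoins_le
  have b₂ := hE.pkLen_le
  have b₃ := hE.skLen_le
  have b₄ := hE.vec_le n hn
  have b₅ := hE.vec_le m hm
  have b₆ := hE.encCoins_le n hn
  have b₇ := hE.ctLen_le n hn
  have b₈ := hE.ctLen_le m hm
  have b₉ := hE.evalCoins_le n hn m hm
  have b₁₀ := hE.mat_le n hn m hm
  have hclean : Secure (moSource E) Base (20 * B) (1000 * B) 1
      (fun (x : Mat l m n × Vec l m × Vec l n × Vec l n) g =>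
        (PMF.uniformOfFintype (Bits (E.encCoins n))).bind fun r =>
          (PMF.uniformOfFintype (Vec l m)).bind fun s =>
            (PMF.uniformOfFintype (Bits (E.evalCoins n m))).bind fun r' =>
              PMF.pure ((E.enc n (E.gen g).1 x.2.2.2 r, s, r'),
                (s + x.2.1, x.1.mulVec x.2.2.2 + (x.1.mulVec x.2.2.1 - s))))
      (fun x => x.2.1) (fun o => o.1)
      (fun x o => o.1 + o.2 = x.1.mulVec (x.2.2.1 + x.2.2.2) + x.2.1) := by
    have hsim := ((samp_uniform (α := E.PK × Vec l m)
      ((encodeSurjective_bits (E.encCoins n)).prod ((encodeSurjective_vec l m).prod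
        (encodeSurjective_bits (E.evalCoins n m))))).bindWith
        ((Comp.withConst ((hE.enc n hn).comap
            (f := fun a => (a.1.1.1, a.2, a.1.2.1)) (by fun_prop)) 0).samp.bindWith
          ((hadd.samp.comap (f := fun a => (a.1.2.2.1, a.1.1.2)) (by fun_prop)).bindWith
            (IsWiring.samp (f := fun a => ((a.1.2, a.1.1.2.2.1, a.1.1.2.2.2), a.2))
                    (by fun_prop)))))
    refine ⟨?_, ⟨_, hsim.mono ?_ ?_, fun S ε hε hS x s hs => ?_⟩, fun x => ?_⟩
    · simp only [bitLength_prod, bitLength_fin, bitLength_bool, bitLength_zmod]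
      omega
    · simp only [bitLength_prod, bitLength_fin, bitLength_bool, bitLength_zmod]
      omega
    · simp only [bitLength_prod, bitLength_fin, bitLength_bool, bitLength_zmod]
      omega
    · have hpost : ∀ s : Vec l m, Samp B (40 * B)
          fun a : E.PK × E.Ct n => (PMF.uniformOfFintype (Bits (E.evalCoins n m))).bind
            fun r' => PMF.pure (a.1, ((a.2, s, r'), s + x.2.1)) := by
        intro s
        have h := (samp_uniform (α := E.PK × E.Ct n)
          (encodeSurjective_bits (E.evalCoins n m))).bindWith
            (Comp.withConst (IsWiring.computable
              (f := fun a : ((E.PK × E.Ct n) × Bits (E.evalCoins n m)) × Vec l m × Vec l m =>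
                (a.1.1.1, ((a.1.1.2, a.2.1, a.1.2), a.2.2))) (by fun_prop)) (s, s + x.2.1)).samp
        refine (h.congr fun a => rfl).mono ?_ ?_
        · simp only [bitLength_fin, bitLength_bool]
          omega
        · simp only [bitLength_prod, bitLength_fin, bitLength_bool, bitLength_zmod]
          omega
      -- The observer's key is the public key only, which is exactly what accompanies the challenge
      -- ciphertext in the indistinguishability game.
      have hcl := Close.bind (Z := PMF.uniformOfFintype (Vec l m)) fun s' _ =>
        Close.bind_samp (s := s) ((hB S ε hS).enc n hn x.2.2.2 0
          |>.mono (by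
            simp only [bitLength_prod, bitLength_fin, bitLength_bool]
            omega) le_rfl) (hpost s')
      refine (hcl.mono le_rfl (by simp)).congr ?_ ?_
      · simp only [Source.joint, uniform_prod, PMF.map, PMF.bind_bind, PMF.pure_bind,
          Function.comp_def]
        conv_rhs => rw [PMF.bind_comm]
        refine bind_congr fun g => ?_
        conv_rhs => rw [PMF.bind_comm]
      · simp only [Source.joint, uniform_prod, PMF.map, PMF.bind_bind, PMF.pure_bind,
          Function.comp_def]
        conv_rhs => rw [PMF.bind_comm]
        refine bind_congr fun g => ?_
        conv_rhs => rw [PMF.bind_comm]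
    · have hT := fun s : Vec l m => ((samp_uniform (α := E.PK)
        ((encodeSurjective_bits (E.encCoins n)).prod
          (encodeSurjective_bits (E.evalCoins n m)))).bindWith
          ((Comp.withConst ((hE.enc n hn).comap (f := fun a =>
              (a.1.1, a.2, a.1.2.1)) (by fun_prop)) x.2.2.2).samp.bindWith
                  (Comp.withConst (IsWiring.computable (f := fun a => (a.1.2, a.2, a.1.1.2.2))
                    (by fun_prop)) s).samp))
      refine ⟨Vec l m, PMF.uniformOfFintype _, _, fun s =>
        (s + x.2.1, x.1.mulVec x.2.2.2 + (x.1.mulVec x.2.2.1 - s)), fun g => ?_,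
        fun s => (hT s).mono ?_ ?_, fun s _ => ?_⟩
      · simp only [uniform_prod, PMF.map, PMF.bind_bind, PMF.pure_bind, Function.comp_def]
        rw [PMF.bind_comm]
      · simp only [bitLength_prod, bitLength_fin, bitLength_bool]
        omega
      · simp only [bitLength_prod, bitLength_fin, bitLength_bool, bitLength_zmod]
        omega
      · simp only [Matrix.mulVec_add]
        abel
  have hbits : bitLength (affineProt E n m).Seen₀ ≤ 3 * B := by
    change bitLength (((((Unit × E.Ct n) × Vec l m) × Bits (E.evalCoins n m)) × Unit) × Unit) ≤ _
    simp only [bitLength_prod, bitLength_fin, bitLength_bool, bitLength_unit, bitLength_zmod]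
    omega
  refine (hclean.reshape (b' := 40 * B) (fun x => x) (fun x o => o) (hI := fun i => i)
    (hP := fun i => i.2) (by fun_prop) (isWiring_affineSeen₀ E n m) (by fun_prop)
    (fun x g => run₀_affine hE x g)
    (fun x => rfl) (fun x o _ => rfl) (fun x o h => h) ?_ ?_).mono ?_ ?_ le_rfl
  · omega
  · simp only [bitLength_fin, bitLength_bool, bitLength_zmod]
    omega
  · omega
  · omega

end Affine

/-! # Arithmetic -/

namespace LinearOp

variable {l n m w k : ℕ} (o : LinearOp l n m w k)

theorem gradMatX_mulVec (dY : Vec l m) (X : Vec l n) : (o.gradMatX dY).mulVec X = o.gradW dY X := by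
  funext j
  simp only [Matrix.mulVec, dotProduct, gradMatX, gradW, Matrix.of_apply, Finset.sum_mul]
  exact Finset.sum_comm

theorem gradMatY_mulVec (dY : Vec l m) (X : Vec l n) : (o.gradMatY X).mulVec dY = o.gradW dY X := by
  funext j
  simp only [Matrix.mulVec, dotProduct, gradMatY, gradW, Matrix.of_apply, Finset.sum_mul]
  exact Finset.sum_congr rfl fun i _ => Finset.sum_congr rfl fun q _ => by ring

/-- `gradW` is bilinear, being given by a matrix in either argument. The four terms of its expansion
on shares are those which the two parties assemble. -/
theorem gradW_add_left (dY dY' : Vec l m) (X : Vec l n) :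
    o.gradW (dY + dY') X = o.gradW dY X + o.gradW dY' X := by
  simp only [← gradMatY_mulVec, Matrix.mulVec_add]

theorem gradW_add_right (dY : Vec l m) (X X' : Vec l n) :
    o.gradW dY (X + X') = o.gradW dY X + o.gradW dY X' := by
  simp only [← gradMatX_mulVec, Matrix.mulVec_add]

end LinearOp

section Arithmetic

variable {l q B : ℕ} {E : HEScheme l} {ev : EvalSim E} {n m w k : ℕ}

/-- Affine maps are computed by encryption, homomorphic evaluation and decryption. -/
theorem HEBound.comp_mulVec_add (hE : HEBound E ev q B) (hn : n ≤ q) (hm : m ≤ q) :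
    Comp (25 * B) fun a : Mat l m n × Vec l n × Vec l m => a.1.mulVec a.2.1 + a.2.2 := by
  have b₀ := hE.one_le
  have b₁ := hE.genCoins_le
  have b₂ := hE.pkLen_le
  have b₃ := hE.skLen_le
  have b₄ := hE.vec_le n hn
  have b₅ := hE.vec_le m hm
  have b₆ := hE.encCoins_le n hn
  have b₇ := hE.ctLen_le n hn
  have b₈ := hE.ctLen_le m hm
  have b₉ := hE.evalCoins_le n hn m hm
  have b₁₀ := hE.mat_le n hn m hm
  -- Correctness is perfect, so any fixed coins of key generation, encryption and evaluation will
  -- do.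
  let keys := E.gen fun _ => false
  have h₁ := Comp.withConst ((hE.enc n hn).comap
    (f := fun a : (Mat l m n × Vec l n × Vec l m) × (E.PK × Bits (E.encCoins n)) =>
      (a.2.1, a.1.2.1, a.2.2)) (by fun_prop)) (keys.1, fun _ => false)
  have h₂ := (Comp.withConst ((hE.eval n hn m hm).comap
    (f := fun a : ((Mat l m n × Vec l n × Vec l m) × E.Ct n) × (E.PK × Bits (E.evalCoins n m)) =>
      (a.2.1, a.1.1.1, a.1.1.2.2, a.1.2, a.2.2)) (by fun_prop)) (keys.1, fun _ => false)).comp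
        ((IsWiring.id.computable).prodMk h₁)
  have h₃ := (Comp.withConst ((hE.dec m hm).comap
    (f := fun a : E.Ct m × E.SK => (a.2, a.1)) (by fun_prop)) keys.2).comp h₂
  simp only [keys, hE.dec_eval] at h₃
  refine h₃.mono ?_
  simp only [bitLength_prod, bitLength_fin, bitLength_bool, bitLength_zmod, bitLength_matrix]
  omega

theorem HEBound.comp_mulVec_const (hE : HEBound E ev q B) (hn : n ≤ q) (hm : m ≤ q)
    (A : Mat l m n) (c : Vec l m) : Comp (30 * B) fun x : Vec l n => A.mulVec x + c := by
  have b₀ := hE.one_le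
  have b₄ := hE.vec_le n hn
  have b₅ := hE.vec_le m hm
  have b₁₀ := hE.mat_le n hn m hm
  refine (Comp.withConst ((hE.comp_mulVec_add hn hm).comap
    (f := fun a : Vec l n × Mat l m n × Vec l m => (a.2.1, a.1, a.2.2)) (by fun_prop)) (A, c)).mono ?_
  simp only [bitLength_prod, bitLength_fin, bitLength_zmod, bitLength_matrix]
  omega

theorem HEBound.comp_add (hE : HEBound E ev q B) (hm : m ≤ q) :
    Comp (30 * B) fun a : Vec l m × Vec l m => a.1 + a.2 := by
  have b₀ := hE.one_le
  have b₅ := hE.vec_le m hm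
  have b₁₀ := hE.mat_le m hm m hm
  have h := Comp.withConst ((hE.comp_mulVec_add hm hm).comap
    (f := fun a : (Vec l m × Vec l m) × Mat l m m => (a.2, a.1.1, a.1.2)) (by fun_prop)) 1
  simp only [Matrix.one_mulVec] at h
  refine h.mono ?_
  simp only [bitLength_prod, bitLength_fin, bitLength_zmod, bitLength_matrix]
  omega

/-- Subtraction is the affine map with matrix `-1`, so its circuit also comes from the encryption
scheme. -/
theorem HEBound.comp_sub (hE : HEBound E ev q B) (hm : m ≤ q) :
    Comp (30 * B) fun a : Vec l m × Vec l m => a.1 - a.2 := by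
  have b₀ := hE.one_le
  have b₅ := hE.vec_le m hm
  have b₁₀ := hE.mat_le m hm m hm
  have h := Comp.withConst ((hE.comp_mulVec_add hm hm).comap
    (f := fun a : (Vec l m × Vec l m) × Mat l m m => (a.2, a.1.2, a.1.1)) (by fun_prop)) (-1)
  simp only [Matrix.neg_mulVec, Matrix.one_mulVec, neg_add_eq_sub] at h
  refine h.mono ?_
  simp only [bitLength_prod, bitLength_fin, bitLength_zmod, bitLength_matrix]
  omega

/-- The entries of the matrix `gradMatX dY` are linear in `dY`. Flattened, they form a vector of
length `w * n`, obtained from `dY` by a constant matrix `Q`; multiplying the resulting matrix by `X`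
gives the gradient. This is why `q` has to bound `w * n`. -/
theorem HEBound.comp_gradW (hE : HEBound E ev q B) (o : LinearOp l n m w k) (hn : n ≤ q)
    (hm : m ≤ q) (hw : w ≤ q) (hwn : w * n ≤ q) :
    Comp (70 * B) fun a : Vec l m × Vec l n => o.gradW a.1 a.2 := by
  have b₀ := hE.one_le
  have b₅ := hE.vec_le m hm
  have b₄ := hE.vec_le n hn
  have b₆ := hE.vec_le w hw
  have b₁₀ := hE.mat_le n hn w hw
  let Q : Mat l (w * n) m := Matrix.of fun p i =>
    o.coef i (finProdFinEquiv.symm p).1 (finProdFinEquiv.symm p).2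
  have h₁ := hE.comp_mulVec_const hm hwn Q 0
  have hr : IsWiring fun v : Vec l (w * n) =>
      (Matrix.of fun j q => v (finProdFinEquiv (j, q)) : Mat l w n) := by
    refine ⟨fun p => (finProdFinEquiv (p.1, p.2.1), p.2.2), fun v => rfl⟩
  have h₂ := (hr.computable.comp h₁).comap (f := fun a : Vec l m × Vec l n => a.1) (by fun_prop)
  have h₃ := Comp.withConst ((hE.comp_mulVec_add hn hw).comap
    (f := fun a : ((Vec l m × Vec l n) × Mat l w n) × Vec l w => (a.1.2, a.1.1.2, a.2))
      (by fun_prop)) 0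
  have h₄ := h₃.comp (IsWiring.id.computable.prodMk h₂)
  have heq : ∀ dY : Vec l m, (Matrix.of fun j q => Q.mulVec dY (finProdFinEquiv (j, q))) =
      o.gradMatX dY := by
    intro dY
    ext j i
    simp only [Q, LinearOp.gradMatX, Matrix.mulVec, dotProduct, Matrix.of_apply,
      Equiv.symm_apply_apply]
  simp only [add_zero, heq, LinearOp.gradMatX_mulVec] at h₄
  refine h₄.mono ?_
  simp only [bitLength_prod, bitLength_fin, bitLength_zmod, bitLength_matrix]
  omega

end Arithmetic

/-! ### Weight gradients revealed to the model owner. -/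

section Gradient

variable {l q B : ℕ} {E : HEScheme l} {ev : EvalSim E} {Base : ℕ → ℝ → Prop} {n m w k : ℕ}

theorem isWiring_gradWSeen₁ (E : HEScheme l) (o : LinearOp l n m w k) :
    IsWiring (α := Bits (E.encCoins n) × Bits (E.encCoins m) × E.Ct w)
      (β := (gradWProt E o).Seen₁) fun v =>
        ((((((((v.1, v.2.1), ()), ()), ()), ()), v.2.2), ()), ()) := by
  change IsWiring (α := Bits (E.encCoins n) × Bits (E.encCoins m) × E.Ct w)
    (β := ((((((((Bits (E.encCoins n) × Bits (E.encCoins m)) × Unit) × Unit) × Unit) × Unit) ×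
      E.Ct w) × Unit) × Unit)) fun v => ((((((((v.1, v.2.1), ()), ()), ()), ()), v.2.2), ()), ())
  fun_prop

theorem isWiring_gradWSeen₀ (E : HEScheme l) (o : LinearOp l n m w k) :
    IsWiring (α := E.Ct n × E.Ct m × Vec l w × Bits (E.eval₂Coins n m w) × Vec l w)
      (β := (gradWProt E o).Seen₀) fun v =>
        (((((((((), ()), v.1), v.2.1), v.2.2.1), v.2.2.2.1), ()), v.2.2.2.2), ()) := by
  change IsWiring (α := E.Ct n × E.Ct m × Vec l w × Bits (E.eval₂Coins n m w) × Vec l w)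
    (β := ((((((((Unit × Unit) × E.Ct n) × E.Ct m) × Vec l w) × Bits (E.eval₂Coins n m w)) ×
      Unit) × Vec l w) × Unit)) fun v =>
        (((((((((), ()), v.1), v.2.1), v.2.2.1), v.2.2.2.1), ()), v.2.2.2.2), ())
  fun_prop

theorem run₁_gradW (hE : HEBound E ev q B) (o : LinearOp l n m w k)
    (x : Vec l w × (Vec l n × Vec l m) × (Vec l n × Vec l m)) (g : Bits E.genCoins) :
    (gradWProt E o).run₁ ((E.gen g).1, x.2.1) (E.gen g, x.1, x.2.2) =
      ((PMF.uniformOfFintype (Bits (E.encCoins n))).bind fun r =>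
        (PMF.uniformOfFintype (Bits (E.encCoins m))).bind fun r' =>
          (PMF.uniformOfFintype (Vec l w)).bind fun s =>
            (PMF.uniformOfFintype (Bits (E.eval₂Coins n m w))).bind fun r'' =>
              PMF.pure ((r, r', E.eval₂ n m w (E.gen g).1 (o.gradMatX x.2.1.2) (o.gradMatY x.2.1.1)
                (-s) (E.enc n (E.gen g).1 x.2.2.1 r) (E.enc m (E.gen g).1 x.2.2.2 r') r''),
                (o.gradW (x.2.1.2 + x.2.2.2) (x.2.1.1 + x.2.2.1) + x.1, ()))).map
      fun u => (((((((((u.1.1, u.1.2.1), ()), ()), ()), ()), u.1.2.2), ()), ()), u.2) := by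
  simp only [gradWProt, Proto.run₁_seq, Proto.run₁_coin₁, Proto.run₁_send₁, Proto.run₁_coin₀,
    Proto.run₁_send₀, Proto.run₁_loc]
  dsimp only [Proto.Seen₁]
  simp only [PMF.bind_bind, PMF.pure_bind, PMF.map, Function.comp_def, hE.dec_eval₂]
  refine bind_congr fun r => bind_congr fun r' => bind_congr fun s => bind_congr fun r'' => ?_
  congr 3
  simp only [LinearOp.gradMatX_mulVec, LinearOp.gradMatY_mulVec, LinearOp.gradW_add_left,
    LinearOp.gradW_add_right]
  abel

/-- The last message is rewritten as the revealed perturbed gradient minus the mask and the model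
owner's own term. In this form it involves the data owner's shares through the revealed value only.
-/
theorem run₀_gradW (hE : HEBound E ev q B) (o : LinearOp l n m w k)
    (x : Vec l w × (Vec l n × Vec l m) × (Vec l n × Vec l m)) (g : Bits E.genCoins) :
    (gradWProt E o).run₀ ((E.gen g).1, x.2.1) (E.gen g, x.1, x.2.2) =
      ((PMF.uniformOfFintype (Bits (E.encCoins n))).bind fun r =>
        (PMF.uniformOfFintype (Bits (E.encCoins m))).bind fun r' =>
          (PMF.uniformOfFintype (Vec l w)).bind fun s =>
            (PMF.uniformOfFintype (Bits (E.eval₂Coins n m w))).bind fun r'' =>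
              PMF.pure ((E.enc n (E.gen g).1 x.2.2.1 r, E.enc m (E.gen g).1 x.2.2.2 r', s, r'',
                o.gradW (x.2.1.2 + x.2.2.2) (x.2.1.1 + x.2.2.1) + x.1 - s -
                  o.gradW x.2.1.2 x.2.1.1),
                (o.gradW (x.2.1.2 + x.2.2.2) (x.2.1.1 + x.2.2.1) + x.1, ()))).map
      fun u => ((((((((((), ()), u.1.1), u.1.2.1), u.1.2.2.1), u.1.2.2.2.1), ()), u.1.2.2.2.2), ()),
        u.2) := by
  simp only [gradWProt, Proto.run₀_seq, Proto.run₀_coin₁, Proto.run₀_send₁, Proto.run₀_coin₀,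
    Proto.run₀_send₀, Proto.run₀_loc]
  dsimp only [Proto.Seen₀]
  simp only [PMF.bind_bind, PMF.pure_bind, PMF.map, Function.comp_def, hE.dec_eval₂]
  refine bind_congr fun r => bind_congr fun r' => bind_congr fun s => bind_congr fun r'' => ?_
  congr 3
  · congr 2
    simp only [LinearOp.gradMatX_mulVec, LinearOp.gradMatY_mulVec, LinearOp.gradW_add_left,
      LinearOp.gradW_add_right]
    abel
  · simp only [LinearOp.gradMatX_mulVec, LinearOp.gradMatY_mulVec, LinearOp.gradW_add_left,
      LinearOp.gradW_add_right]
    abel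

/-- The data owner sees one evaluated ciphertext, whose plaintext is uniform because of the mask
`-s`. It has no output, so the simulator draws that plaintext and discards it. -/
theorem secure₁_gradW (hE : HEBound E ev q B) (hB : ∀ S ε, Base S ε → HEClose E ev q S ε)
    (o : LinearOp l n m w k) (hn : n ≤ q) (hm : m ≤ q) (hw : w ≤ q) :
    Secure (doSource E) Base (100 * B) (10000 * B) 1
      (fun (x : Vec l w × (Vec l n × Vec l m) × (Vec l n × Vec l m)) g =>
        (gradWProt E o).run₁ ((E.gen g).1, x.2.1) (E.gen g, x.1, x.2.2))
      (fun x => x.2.2) (fun o => o.2)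
      (fun x u => u.1 = o.gradW (x.2.1.2 + x.2.2.2) (x.2.1.1 + x.2.2.1) + x.1) := by
  have b₀ := hE.one_le
  have b₁ := hE.genCoins_le
  have b₂ := hE.pkLen_le
  have b₃ := hE.skLen_le
  have b₄ := hE.vec_le n hn
  have b₅ := hE.vec_le m hm
  have b₆ := hE.encCoins_le n hn
  have b₇ := hE.ctLen_le n hn
  have b₈ := hE.ctLen_le m hm
  have b₉ := hE.encCoins_le m hm
  have b₁₀ := hE.mat_le n hn w hw
  have b₁₁ := hE.mat_le m hm w hw
  have b₁₂ := hE.vec_le w hw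
  have b₁₃ := hE.ctLen_le w hw
  have b₁₄ := hE.eval₂Coins_le n hn m hm w hw
  have hclean : Secure (doSource E) Base (20 * B) (1000 * B) 1
      (fun (x : Vec l w × (Vec l n × Vec l m) × (Vec l n × Vec l m)) g =>
        (PMF.uniformOfFintype (Bits (E.encCoins n))).bind fun r =>
        (PMF.uniformOfFintype (Bits (E.encCoins m))).bind fun r' =>
          (PMF.uniformOfFintype (Vec l w)).bind fun s =>
            (PMF.uniformOfFintype (Bits (E.eval₂Coins n m w))).bind fun r'' =>
              PMF.pure ((r, r', E.eval₂ n m w (E.gen g).1 (o.gradMatX x.2.1.2) (o.gradMatY x.2.1.1)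
                (-s) (E.enc n (E.gen g).1 x.2.2.1 r) (E.enc m (E.gen g).1 x.2.2.2 r') r''),
                (o.gradW (x.2.1.2 + x.2.2.2) (x.2.1.1 + x.2.2.1) + x.1, ())))
      (fun x => x.2.2) (fun o => o.2)
      (fun x u => u.1 = o.gradW (x.2.1.2 + x.2.2.2) (x.2.1.1 + x.2.2.1) + x.1) := by
    have hsim := ((samp_uniform (α := Bits E.genCoins × Vec l n × Vec l m)
      ((encodeSurjective_bits (E.encCoins n)).prod ((encodeSurjective_bits (E.encCoins m)).prod
        (encodeSurjective_vec l w)))).bindWith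
        ((hE.gen.samp.comap (f := fun a => a.1.1) (by fun_prop)).bindWith
          (((hE.enc n hn).samp.comap
            (f := fun a => (a.2.1, a.1.1.2.1, a.1.2.1)) (by fun_prop)).bindWith
            (((hE.enc m hm).samp.comap
              (f := fun a => (a.1.2.1, a.1.1.1.2.2, a.1.1.2.2.1)) (by fun_prop)).bindWith
              (((hE.sim₂ n hn m hm w hw).comap
                (f := fun a => (a.1.1.2.1, a.1.1.2.2, a.1.2, a.2, a.1.1.1.2.2.2))
                (by fun_prop)).bindWith
                  (IsWiring.samp (f := fun a =>
                    ((a.1.1.1.1.2.1, a.1.1.1.1.2.2.1, a.2), ())) (by fun_prop)))))))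
    refine ⟨?_, ⟨_, hsim.mono ?_ ?_, fun S ε hε hS x s hs => ?_⟩, fun x => ?_⟩
    · simp only [bitLength_prod, bitLength_fin, bitLength_bool, bitLength_zmod, bitLength_unit]
      omega
    · simp only [bitLength_prod, bitLength_fin, bitLength_bool, bitLength_zmod]
      omega
    · simp only [bitLength_prod, bitLength_fin, bitLength_bool, bitLength_zmod, bitLength_unit]
      omega
    · have hpost : Samp 0 (40 * B)
          fun a : Bits E.genCoins × Bits (E.encCoins n) × Bits (E.encCoins m) × E.Ct w =>
            PMF.pure (a.1, (a.2, ())) := by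
        refine (IsWiring.samp (by fun_prop)).mono le_rfl ?_
        simp only [bitLength_prod, bitLength_fin, bitLength_bool, bitLength_unit]
        omega
      have hcl := Close.bind (Z := PMF.uniformOfFintype (Vec l w)) fun s' _ =>
        Close.bind_samp (s := s) ((hB S ε hS).eval₂ n hn m hm w hw x.2.2.1 x.2.2.2
          (o.gradMatX x.2.1.2) (o.gradMatY x.2.1.1) (-s') |>.mono (by
            simp only [bitLength_prod, bitLength_fin, bitLength_bool]
            omega) le_rfl) hpost
      refine (hcl.mono le_rfl (by simp)).congr ?_ ?_
      · simp only [Source.joint, uniform_prod, PMF.map, PMF.bind_bind, PMF.pure_bind,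
          Function.comp_def]
        conv_rhs => rw [PMF.bind_comm]
        refine bind_congr fun g => ?_
        conv_rhs => rw [PMF.bind_comm]
        refine bind_congr fun r => ?_
        conv_rhs => rw [PMF.bind_comm]
      · simp only [Source.joint, uniform_prod, PMF.map, PMF.bind_bind, PMF.pure_bind,
          Function.comp_def]
        conv_rhs => rw [PMF.bind_comm]
        refine bind_congr fun g => ?_
        conv_rhs => rw [PMF.bind_comm]
        refine bind_congr fun r => ?_
        conv_rhs => rw [PMF.bind_comm]
        refine bind_congr fun r' => ?_
        simp only [← sub_eq_add_neg]
        -- Again the mask is substituted by the masked plaintext.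
        exact (bind_uniform_equiv (Equiv.subLeft ((o.gradMatX x.2.1.2).mulVec x.2.2.1 +
          (o.gradMatY x.2.1.1).mulVec x.2.2.2)) fun y => (ev.sim₂ n m w ((E.gen g).1, (E.gen g).2,
            E.enc n (E.gen g).1 x.2.2.1 r, E.enc m (E.gen g).1 x.2.2.2 r', y)).bind
              fun a => PMF.pure (g, (r, r', a), ())).symm
    · have hT := fun s : Vec l w => ((samp_uniform (α := Bits E.genCoins)
        ((encodeSurjective_bits (E.encCoins n)).prod ((encodeSurjective_bits (E.encCoins m)).prod
          (encodeSurjective_bits (E.eval₂Coins n m w))))).bindWith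
        ((hE.gen.samp.comap (f := fun a => a.1) (by fun_prop)).bindWith
          (((Comp.withConst ((hE.enc n hn).comap (f := fun a =>
              (a.1.2.1, a.2, a.1.1.2.1)) (by fun_prop)) x.2.2.1).samp).bindWith
            (((Comp.withConst ((hE.enc m hm).comap (f := fun a =>
                (a.1.1.2.1, a.2, a.1.1.1.2.2.1)) (by fun_prop)) x.2.2.2).samp).bindWith
              ((Comp.withConst ((hE.eval₂ n hn m hm w hw).comap (f := fun a =>
                (a.1.1.1.2.1, a.2.1, a.2.2.1, a.2.2.2, a.1.1.2, a.1.2, a.1.1.1.1.2.2.2))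
                  (by fun_prop)) (o.gradMatX x.2.1.2, o.gradMatY x.2.1.1, -s)).samp.bindWith
                  (IsWiring.samp (f := fun a => (a.1.1.1.1.2.1, a.1.1.1.1.2.2.1, a.2))
                    (by fun_prop)))))))
      refine ⟨Vec l w, PMF.uniformOfFintype _, _, fun s =>
        (o.gradW (x.2.1.2 + x.2.2.2) (x.2.1.1 + x.2.2.1) + x.1, ()), fun g => ?_,
        fun s => (hT s).mono ?_ ?_, fun s _ => rfl⟩
      · simp only [uniform_prod, PMF.map, PMF.bind_bind, PMF.pure_bind, Function.comp_def]
        conv_rhs => rw [PMF.bind_comm]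
        refine bind_congr fun r => ?_
        conv_rhs => rw [PMF.bind_comm]
      · simp only [bitLength_prod, bitLength_fin, bitLength_bool]
        omega
      · simp only [bitLength_prod, bitLength_fin, bitLength_bool, bitLength_zmod,
          bitLength_matrix]
        omega
  have hbits : bitLength (gradWProt E o).Seen₁ ≤ 3 * B := by
    change bitLength ((((((((Bits (E.encCoins n) × Bits (E.encCoins m)) × Unit) × Unit) × Unit) ×
      Unit) × E.Ct w) × Unit) × Unit) ≤ _
    simp only [bitLength_prod, bitLength_fin, bitLength_bool, bitLength_unit]
    omega
  refine (hclean.reshape (b' := 40 * B) (fun x => x) (fun x o => o) (hI := fun i => i)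
    (hP := fun i => i.2) (by fun_prop) (isWiring_gradWSeen₁ E o) (by fun_prop)
    (fun x g => run₁_gradW hE o x g)
    (fun x => rfl) (fun x o _ => rfl) (fun x o h => h) ?_ ?_).mono ?_ ?_ le_rfl
  · omega
  · simp only [bitLength_prod, bitLength_fin, bitLength_bool, bitLength_zmod, bitLength_unit]
    omega
  · omega
  · omega

/-- Two ciphertexts under the same key are exchanged one after the other, whence the factor `2`. The
simulator is entitled to the perturbed gradient, since that is the model owner's output, and
computes the last message from it. -/
theorem secure₀_gradW (hE : HEBound E ev q B) (hB : ∀ S ε, Base S ε → HEClose E ev q S ε)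
    (o : LinearOp l n m w k) (hn : n ≤ q) (hm : m ≤ q) (hw : w ≤ q) (hwn : w * n ≤ q) :
    Secure (moSource E) Base (100 * B) (10000 * B) 2
      (fun (x : Vec l w × (Vec l n × Vec l m) × (Vec l n × Vec l m)) g =>
        (gradWProt E o).run₀ ((E.gen g).1, x.2.1) (E.gen g, x.1, x.2.2))
      (fun x => (o.gradW (x.2.1.2 + x.2.2.2) (x.2.1.1 + x.2.2.1) + x.1, x.2.1)) (fun o => o.1)
      (fun x u => u.1 = o.gradW (x.2.1.2 + x.2.2.2) (x.2.1.1 + x.2.2.1) + x.1) := by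
  have b₀ := hE.one_le
  have b₁ := hE.genCoins_le
  have b₂ := hE.pkLen_le
  have b₃ := hE.skLen_le
  have b₄ := hE.vec_le n hn
  have b₅ := hE.vec_le m hm
  have b₆ := hE.encCoins_le n hn
  have b₇ := hE.ctLen_le n hn
  have b₈ := hE.ctLen_le m hm
  have b₉ := hE.encCoins_le m hm
  have b₁₀ := hE.mat_le n hn w hw
  have b₁₁ := hE.mat_le m hm w hw
  have b₁₂ := hE.vec_le w hw
  have b₁₃ := hE.ctLen_le w hw
  have b₁₄ := hE.eval₂Coins_le n hn m hm w hw
  have hmsg : Comp (300 * B) fun a : Vec l w × (Vec l n × Vec l m) × Vec l w =>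
      a.1 - a.2.2 - o.gradW a.2.1.2 a.2.1.1 := by
    have h₁ := (hE.comp_gradW o hn hm hw hwn).comap
      (f := fun a : Vec l w × (Vec l n × Vec l m) × Vec l w => (a.2.1.2, a.2.1.1)) (by fun_prop)
    have h₂ := (hE.comp_sub hw).comap
      (f := fun a : Vec l w × (Vec l n × Vec l m) × Vec l w => (a.1, a.2.2)) (by fun_prop)
    exact ((hE.comp_sub hw).comp (h₂.prodMk h₁)).mono (by omega)
  have hclean : Secure (moSource E) Base (20 * B) (1000 * B) 2
      (fun (x : Vec l w × (Vec l n × Vec l m) × (Vec l n × Vec l m)) g =>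
        (PMF.uniformOfFintype (Bits (E.encCoins n))).bind fun r =>
        (PMF.uniformOfFintype (Bits (E.encCoins m))).bind fun r' =>
          (PMF.uniformOfFintype (Vec l w)).bind fun s =>
            (PMF.uniformOfFintype (Bits (E.eval₂Coins n m w))).bind fun r'' =>
              PMF.pure ((E.enc n (E.gen g).1 x.2.2.1 r, E.enc m (E.gen g).1 x.2.2.2 r', s, r'',
                o.gradW (x.2.1.2 + x.2.2.2) (x.2.1.1 + x.2.2.1) + x.1 - s -
                  o.gradW x.2.1.2 x.2.1.1),
                (o.gradW (x.2.1.2 + x.2.2.2) (x.2.1.1 + x.2.2.1) + x.1, ())))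
      (fun x => (o.gradW (x.2.1.2 + x.2.2.2) (x.2.1.1 + x.2.2.1) + x.1, x.2.1)) (fun o => o.1)
      (fun x u => u.1 = o.gradW (x.2.1.2 + x.2.2.2) (x.2.1.1 + x.2.2.1) + x.1) := by
    have hsim := ((samp_uniform (α := E.PK × Vec l w × Vec l n × Vec l m)
      ((encodeSurjective_bits (E.encCoins n)).prod ((encodeSurjective_bits (E.encCoins m)).prod
        ((encodeSurjective_vec l w).prod
          (encodeSurjective_bits (E.eval₂Coins n m w)))))).bindWith
          ((Comp.withConst ((hE.enc n hn).comap
            (f := fun a => (a.1.1.1, a.2, a.1.2.1)) (by fun_prop)) 0).samp.bindWith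
            ((Comp.withConst ((hE.enc m hm).comap
              (f := fun a => (a.1.1.1.1, a.2, a.1.1.2.2.1)) (by fun_prop)) 0).samp.bindWith
              ((hmsg.samp.comap
                (f := fun a => (a.1.1.1.2.1, a.1.1.1.2.2, a.1.1.2.2.2.1))
                (by fun_prop)).bindWith
                  (IsWiring.samp (f := fun a =>
                    ((a.1.1.2, a.1.2, a.1.1.1.2.2.2.1, a.1.1.1.2.2.2.2, a.2), a.1.1.1.1.2.1))
                    (by fun_prop))))))
    refine ⟨?_, ⟨_, hsim.mono ?_ ?_, fun S ε hε hS x s hs => ?_⟩, fun x => ?_⟩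
    · simp only [bitLength_prod, bitLength_fin, bitLength_bool, bitLength_zmod]
      omega
    · simp only [bitLength_prod, bitLength_fin, bitLength_bool, bitLength_zmod]
      omega
    · simp only [bitLength_prod, bitLength_fin, bitLength_bool, bitLength_zmod]
      omega
    · let z : Vec l w := o.gradW (x.2.1.2 + x.2.2.2) (x.2.1.1 + x.2.2.1) + x.1
      have hpost₁ := fun s : Vec l w => (samp_uniform (α := E.PK × E.Ct n)
        ((encodeSurjective_bits (E.encCoins m)).prod
          (encodeSurjective_bits (E.eval₂Coins n m w)))).bindWith
            ((Comp.withConst ((hE.enc m hm).comap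
              (f := fun a => (a.1.1.1, a.2, a.1.2.1)) (by fun_prop)) x.2.2.2).samp.bindWith
                (Comp.withConst (IsWiring.computable (f := fun a => (a.1.1.1.1, ((a.1.1.1.2, a.1.2,
                  a.2.1, a.1.1.2.2, a.2.2.1), a.2.2.2))) (by fun_prop))
                    (s, z - s - o.gradW x.2.1.2 x.2.1.1, z)).samp)
      have hpost₂ := fun s : Vec l w => (samp_uniform (α := E.PK × E.Ct m)
        ((encodeSurjective_bits (E.encCoins n)).prod
          (encodeSurjective_bits (E.eval₂Coins n m w)))).bindWith
            ((Comp.withConst ((hE.enc n hn).comap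
              (f := fun a => (a.1.1.1, a.2, a.1.2.1)) (by fun_prop)) 0).samp.bindWith
                (Comp.withConst (IsWiring.computable (f := fun a => (a.1.1.1.1, ((a.1.2, a.1.1.1.2,
                  a.2.1, a.1.1.2.2, a.2.2.1), a.2.2.2))) (by fun_prop))
                    (s, z - s - o.gradW x.2.1.2 x.2.1.1, z)).samp)
      -- First the encryption of `X₁` is exchanged while the reduction encrypts the true share of
      -- `∇Y`; then, in `hcl₂`, the encryption of that share, with the other ciphertext already
      -- encrypting `0`.
      have hcl₁ := Close.bind (Z := PMF.uniformOfFintype (Vec l w)) fun s' _ =>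
        Close.bind_samp (s := s) ((hB S ε hS).enc n hn x.2.2.1 0
          |>.mono (by
            simp only [bitLength_prod, bitLength_fin, bitLength_bool, bitLength_zmod]
            omega) le_rfl) (hpost₁ s')
      have hcl₂ := Close.bind (Z := PMF.uniformOfFintype (Vec l w)) fun s' _ =>
        Close.bind_samp (s := s) ((hB S ε hS).enc m hm x.2.2.2 0
          |>.mono (by
            simp only [bitLength_prod, bitLength_fin, bitLength_bool, bitLength_zmod]
            omega) le_rfl) (hpost₂ s')
      refine ((hcl₁.trans (hcl₂.congr ?_ rfl)).mono le_rfl (by push_cast; linarith)).congr ?_ ?_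
      · simp only [uniform_prod, PMF.map, PMF.bind_bind, PMF.pure_bind, Function.comp_def]
        refine bind_congr fun s' => bind_congr fun g => ?_
        conv_rhs => rw [PMF.bind_comm]
      · simp only [Source.joint, uniform_prod, PMF.map, PMF.bind_bind, PMF.pure_bind,
          Function.comp_def]
        conv_rhs => rw [PMF.bind_comm]
        refine bind_congr fun g => ?_
        conv_rhs => rw [PMF.bind_comm]
        refine bind_congr fun r => ?_
        conv_rhs => rw [PMF.bind_comm]
      · simp only [Source.joint, uniform_prod, PMF.map, PMF.bind_bind, PMF.pure_bind,
          Function.comp_def]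
        conv_rhs => rw [PMF.bind_comm]
        refine bind_congr fun g => ?_
        conv_lhs => rw [PMF.bind_comm]
        conv_rhs => rw [PMF.bind_comm]
        refine bind_congr fun r' => ?_
        conv_rhs => rw [PMF.bind_comm]
    · let z : Vec l w := o.gradW (x.2.1.2 + x.2.2.2) (x.2.1.1 + x.2.2.1) + x.1
      have hT := fun s : Vec l w => ((samp_uniform (α := E.PK)
        ((encodeSurjective_bits (E.encCoins n)).prod ((encodeSurjective_bits (E.encCoins m)).prod
          (encodeSurjective_bits (E.eval₂Coins n m w))))).bindWith
          ((Comp.withConst ((hE.enc n hn).comap (f := fun a =>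
              (a.1.1, a.2, a.1.2.1)) (by fun_prop)) x.2.2.1).samp.bindWith
            ((Comp.withConst ((hE.enc m hm).comap (f := fun a =>
                (a.1.1.1, a.2, a.1.1.2.2.1)) (by fun_prop)) x.2.2.2).samp.bindWith
                  (Comp.withConst (IsWiring.computable (f := fun a =>
                    (a.1.1.2, a.1.2, a.2.1, a.1.1.1.2.2.2, a.2.2))
                    (by fun_prop)) (s, z - s - o.gradW x.2.1.2 x.2.1.1)).samp)))
      refine ⟨Vec l w, PMF.uniformOfFintype _, _, fun s => (z, ()), fun g => ?_,
        fun s => (hT s).mono ?_ ?_, fun s _ => rfl⟩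
      · simp only [uniform_prod, PMF.map, PMF.bind_bind, PMF.pure_bind, Function.comp_def]
        conv_rhs => rw [PMF.bind_comm]
        refine bind_congr fun r => ?_
        conv_rhs => rw [PMF.bind_comm]
      · simp only [bitLength_prod, bitLength_fin, bitLength_bool]
        omega
      · simp only [bitLength_prod, bitLength_fin, bitLength_bool, bitLength_zmod]
        omega
  have hbits : bitLength (gradWProt E o).Seen₀ ≤ 5 * B := by
    change bitLength ((((((((Unit × Unit) × E.Ct n) × E.Ct m) × Vec l w) ×
      Bits (E.eval₂Coins n m w)) × Unit) × Vec l w) × Unit) ≤ _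
    simp only [bitLength_prod, bitLength_fin, bitLength_bool, bitLength_unit, bitLength_zmod]
    omega
  refine (hclean.reshape (b' := 40 * B) (fun x => x) (fun x o => o) (hI := fun i => i)
    (hP := fun i => i.2) (by fun_prop) (isWiring_gradWSeen₀ E o) (by fun_prop)
    (fun x g => run₀_gradW hE o x g)
    (fun x => rfl) (fun x o _ => rfl) (fun x o h => h) ?_ ?_).mono ?_ ?_ le_rfl
  · omega
  · simp only [bitLength_prod, bitLength_fin, bitLength_bool, bitLength_zmod]
    omega
  · omega
  · omega

end Gradient

/-! # Gadgets -/

/-- Simulators of the views of the two parties of a gadget. -/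
structure GadgetSim (γ : Gadget) where
  sim₀ : γ.G × γ.H → PMF γ.prot.View₀
  sim₁ : γ.G × γ.H → PMF γ.prot.View₁

/-- The simulators of the gadget `γ` have costs at most `B`, and `γ` is correct. -/
structure GadgetBound (γ : Gadget) (s : GadgetSim γ) (B : ℕ) : Prop where
  bits : bitLength γ.G + bitLength γ.H ≤ B
  sim₀ : Samp B B s.sim₀
  sim₁ : Samp B B s.sim₁
  surj : EncodeSurjective γ.H
  correct : ∀ x₀ x₁, ∀ o ∈ (γ.prot.outLaw x₀ x₁).support, o.1 + o.2 = γ.φ (x₀ + x₁)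

/-- Circuits of size at most `S` have an advantage of at most `ε` against the gadget `γ`. -/
structure GadgetClose (γ : Gadget) (s : GadgetSim γ) (S : ℕ) (ε : ℝ) : Prop where
  close₀ : ∀ x₀ x₁, Close S ε ((γ.prot.exec x₀ x₁).map fun u => ((x₀, u.1.1), u.2))
    ((PMF.uniformOfFintype γ.H).bind fun o =>
      (s.sim₀ (x₀, o)).map fun v => (v, (o, γ.φ (x₀ + x₁) - o)))
  close₁ : ∀ x₀ x₁, Close S ε ((γ.prot.exec x₀ x₁).map fun u => ((x₁, u.1.2), u.2))
    ((PMF.uniformOfFintype γ.H).bind fun o =>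
      (s.sim₁ (x₁, o)).map fun v => (v, (γ.φ (x₀ + x₁) - o, o)))

section

variable {σ : Source} {Base : ℕ → ℝ → Prop} {B : ℕ} {γ : Gadget} {s : GadgetSim γ}

/-- The protocol of a gadget does not involve the keys, so its security holds for each fixed key and
hence jointly with the key. The simulator first draws the output share, as the ideal functionality
does. -/
theorem secure₁_gadget (hkey : bitLength σ.Key ≤ B) (hB : 1 ≤ B) (hγ : GadgetBound γ s B)
    (hc : ∀ S ε, Base S ε → GadgetClose γ s S ε) :
    Secure σ Base (10 * B) (200 * B) 1 (fun (x : γ.G × γ.G) _ => γ.prot.run₁ x.1 x.2)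
      (fun x => x.2) (fun o => o.2) (fun x o => o.1 + o.2 = γ.φ (x.1 + x.2)) := by
  -- The simulator's circuit outputs a whole view, so its size bounds the length of views.
  have hv : bitLength γ.G + bitLength γ.prot.Seen₁ ≤ B := by
    have := hγ.sim₁.bitLength_le
    rwa [bitLength_prod] at this
  have hb := hγ.bits
  have hsim := (samp_uniform (α := σ.Key × γ.G) hγ.surj).bindWith
    ((hγ.sim₁.comap (f := fun a => (a.1.2, a.2)) (by fun_prop)).bindWith
      (IsWiring.samp (f := fun a => (a.2.2, a.1.2)) (by fun_prop)))
  refine ⟨by omega, ⟨_, hsim.mono (by omega) ?_, fun S ε hε hS x t ht => ?_⟩, fun x => ?_⟩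
  · simp only [bitLength_prod]
    omega
  · have hpost : ∀ k : σ.Key, Samp 0 (20 * B) fun a : γ.prot.View₁ × (γ.H × γ.H) =>
        PMF.pure (k, (a.1.2, a.2.2)) := by
      intro k
      refine (Comp.samp (Comp.withConst (IsWiring.computable
        (f := fun a : (γ.prot.View₁ × (γ.H × γ.H)) × σ.Key => (a.2, (a.1.1.2, a.1.2.2)))
          (by fun_prop)) k)).mono le_rfl ?_
      simp only [bitLength_prod]
      omega
    have hcl := Close.bind (Z := σ.law) fun g _ =>
      Close.bind_samp (s := t) (((hc S ε hS).close₁ x.1 x.2).mono (by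
        simp only [bitLength_prod]
        omega) le_rfl) (hpost (σ.key g))
    refine (hcl.mono le_rfl (by simp)).congr ?_ ?_
    · simp only [Source.joint, Proto.run₁, PMF.map, PMF.bind_bind, PMF.pure_bind,
        Function.comp_def]
    · simp only [Source.joint, PMF.map, PMF.bind_bind, PMF.pure_bind, Function.comp_def]
  -- The complete run serves as the mixing variable, and the view is a hard-wired constant. No
  -- efficiency is required of the mixing law itself.
  · refine ⟨γ.prot.Seen₁ × (γ.H × γ.H), γ.prot.run₁ x.1 x.2, fun w _ => PMF.pure w.1,
      fun w => w.2, fun g => ?_, fun w => ?_, fun w hw => ?_⟩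
    · simp only [PMF.pure_map]
      exact (PMF.bind_pure _).symm
    · exact (Comp.const _).samp.mono (by omega) (by omega)
    · refine hγ.correct x.1 x.2 w.2 ?_
      obtain ⟨u, hu, rfl⟩ := (PMF.mem_support_map_iff _ _ _).1 hw
      exact (PMF.mem_support_map_iff _ _ _).2 ⟨u, hu, rfl⟩

theorem secure₀_gadget (hkey : bitLength σ.Key ≤ B) (hB : 1 ≤ B) (hγ : GadgetBound γ s B)
    (hc : ∀ S ε, Base S ε → GadgetClose γ s S ε) :
    Secure σ Base (10 * B) (200 * B) 1 (fun (x : γ.G × γ.G) _ => γ.prot.run₀ x.1 x.2)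
      (fun x => x.1) (fun o => o.1) (fun x o => o.1 + o.2 = γ.φ (x.1 + x.2)) := by
  have hv : bitLength γ.G + bitLength γ.prot.Seen₀ ≤ B := by
    have := hγ.sim₀.bitLength_le
    rwa [bitLength_prod] at this
  have hb := hγ.bits
  have hsim := (samp_uniform (α := σ.Key × γ.G) hγ.surj).bindWith
    ((hγ.sim₀.comap (f := fun a => (a.1.2, a.2)) (by fun_prop)).bindWith
      (IsWiring.samp (f := fun a => (a.2.2, a.1.2)) (by fun_prop)))
  refine ⟨by omega, ⟨_, hsim.mono (by omega) ?_, fun S ε hε hS x t ht => ?_⟩, fun x => ?_⟩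
  · simp only [bitLength_prod]
    omega
  · have hpost : ∀ k : σ.Key, Samp 0 (20 * B) fun a : γ.prot.View₀ × (γ.H × γ.H) =>
        PMF.pure (k, (a.1.2, a.2.1)) := by
      intro k
      refine (Comp.samp (Comp.withConst (IsWiring.computable
        (f := fun a : (γ.prot.View₀ × (γ.H × γ.H)) × σ.Key => (a.2, (a.1.1.2, a.1.2.1)))
          (by fun_prop)) k)).mono le_rfl ?_
      simp only [bitLength_prod]
      omega
    have hcl := Close.bind (Z := σ.law) fun g _ =>
      Close.bind_samp (s := t) (((hc S ε hS).close₀ x.1 x.2).mono (by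
        simp only [bitLength_prod]
        omega) le_rfl) (hpost (σ.key g))
    refine (hcl.mono le_rfl (by simp)).congr ?_ ?_
    · simp only [Source.joint, Proto.run₀, PMF.map, PMF.bind_bind, PMF.pure_bind,
        Function.comp_def]
    · simp only [Source.joint, PMF.map, PMF.bind_bind, PMF.pure_bind, Function.comp_def]
  · refine ⟨γ.prot.Seen₀ × (γ.H × γ.H), γ.prot.run₀ x.1 x.2, fun w _ => PMF.pure w.1,
      fun w => w.2, fun g => ?_, fun w => ?_, fun w hw => ?_⟩
    · simp only [PMF.pure_map]
      exact (PMF.bind_pure _).symm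
    · exact (Comp.const _).samp.mono (by omega) (by omega)
    · refine hγ.correct x.1 x.2 w.2 ?_
      obtain ⟨u, hu, rfl⟩ := (PMF.mem_support_map_iff _ _ _).1 hw
      exact (PMF.mem_support_map_iff _ _ _).2 ⟨u, hu, rfl⟩

end

/-! # Layers -/

/-- The dimensions of a layer are at most `q`, and the costs of its gadgets are at most `B`. -/
structure LayerBound {l n m : ℕ} (a : Layer l n m) (sims : ∀ s : a.Site, GadgetSim (a.gadget s))
    (q B : ℕ) : Prop where
  in_le : n ≤ q
  out_le : m ≤ q
  w_le : a.wDim ≤ q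
  b_le : a.bDim ≤ q
  wn_le : a.wDim * n ≤ q
  gadget : ∀ s, GadgetBound (a.gadget s) (sims s) B

section Layers

variable {l q B : ℕ} {E : HEScheme l} {ev : EvalSim E} {Base : ℕ → ℝ → Prop} {n m : ℕ}

theorem LayerBound.cache_le (hE : HEBound E ev q B) {a : Layer l n m}
    {sims : ∀ s : a.Site, GadgetSim (a.gadget s)} (ha : LayerBound a sims q B) :
    bitLength a.Cache ≤ B := by
  cases a with
  | linear w k o trunc truncProt =>
    rw [bitLength_fin, bitLength_zmod]
    exact hE.vec_le n ha.in_le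
  | nonlinear s c fwd bwd fwdProt bwdProt =>
    have h := (ha.gadget false).bits
    change bitLength (Vec l n) + bitLength (Vec l m × Vec s c) ≤ B at h
    rw [bitLength_prod] at h
    change bitLength (Vec s c) ≤ B
    omega

/-- A layer makes one use of a primitive. The cached share is either the input share or part of the
gadget's output, so it adds nothing to simulate. -/
theorem secure₁_forward (hE : HEBound E ev q B) (hB : ∀ S ε, Base S ε → HEClose E ev q S ε)
    (a : Layer l n m) {sims : ∀ s : a.Site, GadgetSim (a.gadget s)} (ha : LayerBound a sims q B)
    (hG : ∀ S ε, Base S ε → ∀ s, GadgetClose (a.gadget s) (sims s) S ε) :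
    Secure (doSource E) Base (200 * B) (30000 * B) 1
      (fun (x : a.Param × Vec l n × Vec l n) g =>
        (forwardProt E a).run₁ ((E.gen g).1, x.1, x.2.1) (E.gen g, x.2.2))
      (fun x => x.2.2) (fun o => o.2) (fun x o => o.1 + o.2 = a.forward x.1 (x.2.1 + x.2.2)) := by
  have hcache := ha.cache_le hE
  have b₀ := hE.one_le
  have b₁ : bitLength (doSource E).Key ≤ B := by
    have := hE.genCoins_le
    simpa using this
  have b₄ : bitLength (Vec l n) ≤ B := by
    have := hE.vec_le n ha.in_le
    simpa using this
  have b₅ : bitLength (Vec l m) ≤ B := by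
    have := hE.vec_le m ha.out_le
    simpa using this
  cases a with
  | linear w k o trunc truncProt =>
    have h := secure₁_affine hE hB ha.in_le ha.out_le
    have hbits := h.bits
    refine (h.reshape (b' := 200 * B) (fun x : (Vec l w × Vec l k) × Vec l n × Vec l n =>
      (o.weightMat x.1.1, o.bias.mulVec x.1.2, x.2.1, x.2.2))
      (fun x u => ((u.1, x.2.1), (u.2, x.2.2))) (hI := fun i => i) (hP := fun p => (p.2, p.1))
      (V' := (Unit × (affineProt E n m).Seen₁) × Unit) (hV := fun v => (((), v), ())) (by fun_prop)
      (by fun_prop) (by fun_prop) (fun x g => ?_) (fun x => rfl) (fun x o _ => rfl) (fun x o h => ?_)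
      ?_ ?_).mono ?_ ?_ le_rfl
    · simp only [forwardProt, Proto.run₁_seq, Proto.run₁_call, Proto.run₁_loc]
      dsimp only [Proto.Seen₁, Proto.call, Layer.Cache, Layer.cacheBits, Layer.cacheLen]
      simp only [PMF.map, PMF.bind_bind, PMF.pure_bind, Function.comp_def]
    · exact Prod.ext h rfl
    · omega
    · simp only [bitLength_prod, bitLength_unit] at hcache hbits ⊢
      omega
    · omega
    · omega
  | nonlinear s c fwd bwd fwdProt bwdProt =>
    have h : Secure (doSource E) Base (10 * B) (200 * B) 1
        (fun (x : Vec l n × Vec l n) _ => fwdProt.run₁ x.1 x.2)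
        (fun x => x.2) (fun o => o.2) (fun x o => o.1 + o.2 = fwd (x.1 + x.2)) :=
      secure₁_gadget b₁ b₀ (ha.gadget false) fun S ε hS => hG S ε hS false
    have hbits := h.bits
    refine (h.reshape (b' := 200 * B) (fun x : (Vec l 0 × Vec l 0) × Vec l n × Vec l n => x.2)
      (fun x u => u) (hI := fun i => i) (hP := fun p => p.2)
      (V' := (Unit × fwdProt.Seen₁) × Unit) (hV := fun v => (((), v), ())) (by fun_prop)
      (by fun_prop) (by fun_prop) (fun x g => ?_) (fun x => rfl) (fun x o _ => rfl) (fun x o h => h)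
      ?_ ?_).mono ?_ ?_ le_rfl
    · simp only [forwardProt, Proto.run₁_seq, Proto.run₁_call, Proto.run₁_loc]
      dsimp only [Proto.Seen₁, Proto.call, Layer.Cache, Layer.cacheBits, Layer.cacheLen]
      simp only [PMF.map, PMF.bind_bind, PMF.pure_bind, Function.comp_def]
    · omega
    · simp only [bitLength_prod, bitLength_unit] at hcache hbits ⊢
      omega
    · omega
    · omega

end Layers

section Layers

variable {l q B : ℕ} {E : HEScheme l} {ev : EvalSim E} {Base : ℕ → ℝ → Prop} {n m : ℕ}

theorem secure₀_forward (hE : HEBound E ev q B) (hB : ∀ S ε, Base S ε → HEClose E ev q S ε)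
    (a : Layer l n m) {sims : ∀ s : a.Site, GadgetSim (a.gadget s)} (ha : LayerBound a sims q B)
    (hG : ∀ S ε, Base S ε → ∀ s, GadgetClose (a.gadget s) (sims s) S ε) :
    Secure (moSource E) Base (200 * B) (40000 * B) 1
      (fun (x : a.Param × Vec l n × Vec l n) g =>
        (forwardProt E a).run₀ ((E.gen g).1, x.1, x.2.1) (E.gen g, x.2.2))
      (fun x => (x.1, x.2.1)) (fun o => o.1)
      (fun x o => o.1 + o.2 = a.forward x.1 (x.2.1 + x.2.2)) := by
  have hcache := ha.cache_le hE
  have b₀ := hE.one_le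
  have b₁ : bitLength (moSource E).Key ≤ B := by
    have := hE.pkLen_le
    simpa using this
  have b₄ : bitLength (Vec l n) ≤ B := by
    have := hE.vec_le n ha.in_le
    simpa using this
  have b₅ : bitLength (Vec l m) ≤ B := by
    have := hE.vec_le m ha.out_le
    simpa using this
  have b₆ : bitLength (Vec l a.wDim) ≤ B := by
    have := hE.vec_le _ ha.w_le
    simpa using this
  have b₇ : bitLength (Vec l a.bDim) ≤ B := by
    have := hE.vec_le _ ha.b_le
    simpa using this
  cases a with
  | linear w k o trunc truncProt =>
    change bitLength E.PK ≤ B at b₁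
    change bitLength (Vec l w) ≤ B at b₆
    change bitLength (Vec l k) ≤ B at b₇
    have h₁ := secure₀_affine hE hB ha.in_le ha.out_le (hE.comp_add ha.out_le)
    -- Broadcasting the bias is a computation and not a wiring, so it cannot be part of `glue`; it
    -- enters as a deterministic step without loss.
    have h₀ : Secure (moSource E) Base (10 * B) (50 * B) 0
        (fun (x : (Vec l w × Vec l k) × Vec l n × Vec l n) _ =>
          PMF.pure ((), o.bias.mulVec x.1.2)) (fun x => (x.1, x.2.1)) (fun c : Vec l m => c)
        (fun x c => c = o.bias.mulVec x.1.2) := by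
      have hf := (IsWiring.const (α := (Vec l w × Vec l k) × Vec l n) ()).computable.prodMk
        ((hE.comp_mulVec_const ha.b_le ha.out_le o.bias 0).comap
          (f := fun i : (Vec l w × Vec l k) × Vec l n => i.1.2) (by fun_prop))
      simp only [add_zero] at hf
      refine (Secure.det (b := 10 * B)
        (X := (Vec l w × Vec l k) × Vec l n × Vec l n) (v := fun _ => ()) (o := fun x => o.bias.mulVec x.1.2)
        (inp := fun x => (x.1, x.2.1)) (obs := fun c => c)
        (Post := fun x c => c = o.bias.mulVec x.1.2) hf (fun x g => rfl) (fun x => rfl) (fun x => rfl) ?_).mono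
        le_rfl ?_ le_rfl
      · simp only [bitLength_prod, bitLength_unit]
        change bitLength E.PK + _ + _ + bitLength (Vec l m) ≤ _
        omega
      · simp only [bitLength_unit]
        omega
    have h := h₀.seq h₁ (fun x c => (o.weightMat x.1.1, c, x.2.1, x.2.2)) (glue := fun p => p.2)
      (by fun_prop) (fun x c hc => rfl)
    have hbits := h.bits
    refine (h.reshape (b' := 200 * B) (fun x => x)
      (fun x u => ((u.2.1, x.2.1), (u.2.2, x.2.2))) (hI := fun i => i)
      (hP := fun p => (p.2.2, p.1.2))
      (V' := (Unit × (affineProt E n m).Seen₀) × Unit) (hV := fun v => (((), v.2), ()))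
      (by fun_prop) (by fun_prop) (by fun_prop) (fun x g => ?_) (fun x => rfl) (fun x o _ => rfl)
      (fun x u hu => ?_) ?_ ?_).mono ?_ ?_ ?_
    · simp only [forwardProt, Proto.run₀_seq, Proto.run₀_call, Proto.run₀_loc]
      dsimp only [Proto.Seen₀, Proto.call, Layer.Cache, Layer.cacheBits, Layer.cacheLen]
      simp only [PMF.map, PMF.bind_bind, PMF.pure_bind, Function.comp_def]
    · refine Prod.ext ?_ rfl
      have h₂ := hu.2
      simp only [hu.1] at h₂
      exact h₂
    · omega
    · simp only [bitLength_prod, bitLength_unit] at hcache hbits ⊢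
      omega
    · omega
    · omega
    · omega
  | nonlinear s c fwd bwd fwdProt bwdProt =>
    have h : Secure (moSource E) Base (10 * B) (200 * B) 1
        (fun (x : Vec l n × Vec l n) _ => fwdProt.run₀ x.1 x.2)
        (fun x => x.1) (fun o => o.1) (fun x o => o.1 + o.2 = fwd (x.1 + x.2)) :=
      secure₀_gadget b₁ b₀ (ha.gadget false) fun S ε hS => hG S ε hS false
    have hbits := h.bits
    refine (h.reshape (b' := 200 * B) (fun x : (Vec l 0 × Vec l 0) × Vec l n × Vec l n => x.2)
      (fun x u => u) (inp' := fun x => (x.1, x.2.1)) (hI := fun i => i.2) (hP := fun p => p.2)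
      (V' := (Unit × fwdProt.Seen₀) × Unit) (hV := fun v => (((), v), ())) (by fun_prop)
      (by fun_prop) (by fun_prop) (fun x g => ?_) (fun x => rfl) (fun x o _ => rfl) (fun x o h => h)
      ?_ ?_).mono ?_ ?_ le_rfl
    · simp only [forwardProt, Proto.run₀_seq, Proto.run₀_call, Proto.run₀_loc]
      dsimp only [Proto.Seen₀, Proto.call, Layer.Cache, Layer.cacheBits, Layer.cacheLen]
      simp only [PMF.map, PMF.bind_bind, PMF.pure_bind, Function.comp_def]
    · omega
    · change bitLength (Vec l 0) ≤ B at b₆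
      simp only [bitLength_prod, bitLength_unit] at hcache hbits ⊢
      omega
    · omega
    · omega

/-- For a linear layer the three exchanges are the transposed affine map, the truncation and the
weight gradient. The bias gradient is sent by the data owner and adds nothing to its view. -/
theorem secure₁_backward (hE : HEBound E ev q B) (hB : ∀ S ε, Base S ε → HEClose E ev q S ε)
    (a : Layer l n m) {sims : ∀ s : a.Site, GadgetSim (a.gadget s)} (ha : LayerBound a sims q B)
    (hG : ∀ S ε, Base S ε → ∀ s, GadgetClose (a.gadget s) (sims s) S ε) :
    Secure (doSource E) Base (1000 * B) (200000 * B) 3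
      (fun (x : a.Param × a.Param × (a.Cache × Vec l m) × (a.Cache × Vec l m)) g =>
        (backwardProt E a).run₁ ((E.gen g).1, x.1, x.2.2.1) (E.gen g, x.2.1, x.2.2.2))
      (fun x => x.2.2.2) (fun o => o.2)
      (fun x o => (o.1.1 + o.2, o.1.2) =
        ((a.backward x.1 (x.2.2.1.1 + x.2.2.2.1) (x.2.2.1.2 + x.2.2.2.2)).1,
          (a.backward x.1 (x.2.2.1.1 + x.2.2.2.1) (x.2.2.1.2 + x.2.2.2.2)).2 + x.2.1)) := by
  have hcache := ha.cache_le hE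
  have b₀ := hE.one_le
  have b₁ : bitLength (doSource E).Key ≤ B := by
    have := hE.genCoins_le
    simpa using this
  have b₄ : bitLength (Vec l n) ≤ B := by
    have := hE.vec_le n ha.in_le
    simpa using this
  have b₅ : bitLength (Vec l m) ≤ B := by
    have := hE.vec_le m ha.out_le
    simpa using this
  cases a with
  | linear w k o trunc truncProt =>
    have h₁ := (secure₁_affine hE hB ha.out_le ha.in_le).pull (b' := 200 * B)
      (fun x : (Vec l w × Vec l k) × (Vec l w × Vec l k) × (Vec l n × Vec l m) ×
        (Vec l n × Vec l m) => ((o.weightMat x.1.1).transpose, 0, x.2.2.1.2, x.2.2.2.2))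
      (fun x => x.2.2.2) (hI := fun i => i.2) (by fun_prop) (fun x => rfl) (by
        simp only [bitLength_prod]
        omega)
    have h₂ : Secure (doSource E) Base (10 * B) (200 * B) 1
        (fun (x : Vec l n × Vec l n) _ => truncProt.run₁ x.1 x.2)
        (fun x => x.2) (fun o => o.2) (fun x o => o.1 + o.2 = trunc (x.1 + x.2)) :=
      secure₁_gadget b₁ b₀ (ha.gadget ()) fun S ε hS => hG S ε hS ()
    have h₃ := secure₁_gradW hE hB o ha.in_le ha.out_le ha.w_le
    have h := (h₁.seq h₂ (fun x u => u) (glue := fun p => p.2) (by fun_prop)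
      (fun x u hu => rfl)).seq h₃ (fun x u => (x.2.1.1, x.2.2.1, x.2.2.2)) (glue := fun p => p.1)
        (by fun_prop) (fun x u hu => rfl)
    have hbits := h.bits
    refine (h.reshape (b' := 1000 * B) (fun x => x) (fun x u => ((u.1.2.1,
      (u.2.1, o.bias.transpose.mulVec x.2.2.1.2 + (o.bias.transpose.mulVec x.2.2.2.2 + x.2.1.2))),
        u.1.2.2)) (hI := fun i => i) (hP := fun p => p.2.1.2)
      (V' := (((((Unit × (affineProt E m n).Seen₁) × (Unit × truncProt.Seen₁)) × Unit) ×
        (Unit × (gradWProt E o).Seen₁)) × Unit))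
      (hV := fun v => ((((((), v.1.1), ((), v.1.2)), ()), ((), v.2)), ()))
      (by fun_prop) (by fun_prop) (by fun_prop) (fun x g => ?_) (fun x => rfl) (fun x o _ => rfl)
      (fun x u hu => ?_) ?_ ?_).mono ?_ ?_ ?_
    · simp only [backwardProt, Proto.run₁_seq, Proto.run₁_call, Proto.run₁_loc, Proto.run₁_send₁]
      dsimp only [Proto.Seen₁, Proto.call, Layer.Cache, Layer.cacheBits, Layer.cacheLen,
        Layer.Param, Layer.wDim, Layer.bDim]
      simp only [PMF.map, PMF.bind_bind, PMF.pure_bind, Function.comp_def]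
    · obtain ⟨⟨hu₁, hu₂⟩, hu₃⟩ := hu
      refine Prod.ext ?_ (Prod.ext hu₃ ?_)
      · refine hu₂.trans ?_
        simp only [add_zero] at hu₁
        rw [hu₁]
        rfl
      · change _ = o.bias.transpose.mulVec (x.2.2.1.2 + x.2.2.2.2) + x.2.1.2
        rw [Matrix.mulVec_add, add_assoc]
    · omega
    · simp only [bitLength_prod, bitLength_unit] at hcache hbits ⊢
      omega
    · omega
    · omega
    · omega
  | nonlinear s c fwd bwd fwdProt bwdProt =>
    have h : Secure (doSource E) Base (10 * B) (200 * B) 1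
        (fun (x : (Vec s c × Vec l m) × (Vec s c × Vec l m)) _ => bwdProt.run₁ x.1 x.2)
        (fun x => x.2) (fun o => o.2) (fun x o => o.1 + o.2 = bwd (x.1 + x.2)) :=
      secure₁_gadget b₁ b₀ (ha.gadget true) fun S ε hS => hG S ε hS true
    have hbits := h.bits
    refine (h.reshape (b' := 200 * B) (fun x : (Vec l 0 × Vec l 0) × (Vec l 0 × Vec l 0) ×
        (Vec s c × Vec l m) × (Vec s c × Vec l m) => x.2.2)
      (fun x u => ((u.1, 0), u.2)) (hI := fun i => i) (hP := fun p => p.2)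
      (V' := (Unit × bwdProt.Seen₁) × Unit) (hV := fun v => (((), v), ())) (by fun_prop)
      (by fun_prop) (by fun_prop) (fun x g => ?_) (fun x => rfl) (fun x o _ => rfl)
      (fun x u hu => ?_) ?_ ?_).mono ?_ ?_ ?_
    · simp only [backwardProt, Proto.run₁_seq, Proto.run₁_call, Proto.run₁_loc]
      dsimp only [Proto.Seen₁, Proto.call, Layer.Cache, Layer.cacheBits, Layer.cacheLen,
        Layer.Param, Layer.wDim, Layer.bDim]
      simp only [PMF.map, PMF.bind_bind, PMF.pure_bind, Function.comp_def]
    -- Parameters of non-linear layers have no entries, so the equation between gradients is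
    -- trivial.
    · exact Prod.ext hu (Subsingleton.elim (α := Vec l 0 × Vec l 0) _ _)
    · omega
    · simp only [bitLength_prod, bitLength_unit] at hcache hbits ⊢
      omega
    · omega
    · omega
    · omega

/-- The simulator is given the perturbed gradients of the parameters, which the model owner learns
anyway, and its own shares. The loss is one for the affine map, one for the truncation and two for
the weight gradient. -/
theorem secure₀_backward (hE : HEBound E ev q B) (hB : ∀ S ε, Base S ε → HEClose E ev q S ε)
    (a : Layer l n m) {sims : ∀ s : a.Site, GadgetSim (a.gadget s)} (ha : LayerBound a sims q B)
    (hG : ∀ S ε, Base S ε → ∀ s, GadgetClose (a.gadget s) (sims s) S ε) :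
    Secure (moSource E) Base (1000 * B) (200000 * B) 4
      (fun (x : a.Param × a.Param × (a.Cache × Vec l m) × (a.Cache × Vec l m)) g =>
        (backwardProt E a).run₀ ((E.gen g).1, x.1, x.2.2.1) (E.gen g, x.2.1, x.2.2.2))
      (fun x => ((a.backward x.1 (x.2.2.1.1 + x.2.2.2.1) (x.2.2.1.2 + x.2.2.2.2)).2 + x.2.1,
        x.2.2.1)) (fun o => o.1)
      (fun x o => (o.1.1 + o.2, o.1.2) =
        ((a.backward x.1 (x.2.2.1.1 + x.2.2.2.1) (x.2.2.1.2 + x.2.2.2.2)).1,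
          (a.backward x.1 (x.2.2.1.1 + x.2.2.2.1) (x.2.2.1.2 + x.2.2.2.2)).2 + x.2.1)) := by
  have hcache := ha.cache_le hE
  have b₀ := hE.one_le
  have b₁ : bitLength (moSource E).Key ≤ B := by
    have := hE.pkLen_le
    simpa using this
  have b₄ : bitLength (Vec l n) ≤ B := by
    have := hE.vec_le n ha.in_le
    simpa using this
  have b₅ : bitLength (Vec l m) ≤ B := by
    have := hE.vec_le m ha.out_le
    simpa using this
  have b₆ : bitLength (Vec l a.wDim) ≤ B := by
    have := hE.vec_le _ ha.w_le
    simpa using this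
  have b₇ : bitLength (Vec l a.bDim) ≤ B := by
    have := hE.vec_le _ ha.b_le
    simpa using this
  cases a with
  | linear w k o trunc truncProt =>
    change bitLength E.PK ≤ B at b₁
    change bitLength (Vec l w) ≤ B at b₆
    change bitLength (Vec l k) ≤ B at b₇
    let X : Type := (Vec l w × Vec l k) × (Vec l w × Vec l k) × (Vec l n × Vec l m) ×
      (Vec l n × Vec l m)
    let inp : X → (Vec l w × Vec l k) × (Vec l n × Vec l m) := fun x =>
      ((o.gradW (x.2.2.1.2 + x.2.2.2.2) (x.2.2.1.1 + x.2.2.2.1) + x.2.1.1,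
        o.bias.transpose.mulVec (x.2.2.1.2 + x.2.2.2.2) + x.2.1.2), x.2.2.1)
    -- The transposed map is used with bias `0`. This nonempty constant is not a wiring and is
    -- supplied by a deterministic step.
    have h₀ : Secure (moSource E) Base (10 * B) (50 * B) 0 (fun (_ : X) _ => PMF.pure ((), 0)) inp
        (fun c : Vec l n => c) (fun _ c => c = 0) := by
      refine (Secure.det (b := 10 * B) (X := X) (inp := inp) (v := fun _ => ()) (o := fun _ => 0)
        (obs := fun c => c) (Post := fun _ c => c = 0) (Comp.const ((), (0 : Vec l n))) (fun x g => rfl) (fun x => rfl) (fun x => rfl) ?_).mono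
          le_rfl ?_ le_rfl
      · simp only [bitLength_prod, bitLength_unit]
        omega
      · simp only [bitLength_prod, bitLength_unit]
        omega
    have h₁ := secure₀_affine hE hB ha.out_le ha.in_le (hE.comp_add ha.in_le)
    have h₂ : Secure (moSource E) Base (10 * B) (200 * B) 1
        (fun (x : Vec l n × Vec l n) _ => truncProt.run₀ x.1 x.2)
        (fun x => x.1) (fun o => o.1) (fun x o => o.1 + o.2 = trunc (x.1 + x.2)) :=
      secure₀_gadget b₁ b₀ (ha.gadget ()) fun S ε hS => hG S ε hS ()
    -- The bias message `bᵀ ∇Y₁ + e` equals the revealed gradient minus `bᵀ ∇Y₀`, a function of the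
    -- simulator's input.
    have h₃ : Secure (moSource E) Base (10 * B) (500 * B) 0
        (fun (x : X) _ => PMF.pure (o.bias.transpose.mulVec x.2.2.2.2 + x.2.1.2, ())) inp
        (fun u : Unit => u) (fun _ _ => True) := by
      have hf := ((hE.comp_sub ha.b_le).comp
        (((IsWiring.computable (f := fun i : (Vec l w × Vec l k) × (Vec l n × Vec l m) => i.1.2)
          (by fun_prop))).prodMk ((hE.comp_mulVec_const ha.out_le ha.b_le o.bias.transpose 0).comap
            (f := fun i : (Vec l w × Vec l k) × (Vec l n × Vec l m) => i.2.2)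
              (by fun_prop)))).prodMk (IsWiring.const ()).computable
      refine (Secure.det (b := 10 * B) (X := X) (inp := inp) (obs := fun u => u)
        (Post := fun _ _ => True) (v := fun x => o.bias.transpose.mulVec x.2.2.2.2 + x.2.1.2) (o := fun _ => ()) hf
        (fun x g => rfl) (fun x => ?_) (fun x => trivial) ?_).mono le_rfl ?_ le_rfl
      · simp only [inp, Matrix.mulVec_add, add_zero]
        congr 1
        abel
      · simp only [bitLength_prod, bitLength_unit]
        change bitLength E.PK + bitLength (Vec l k) + _ + _ ≤ _
        omega
      · simp only [bitLength_unit]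
        omega
    have h₄ := secure₀_gradW hE hB o ha.in_le ha.out_le ha.w_le ha.wn_le
    have h₅ := h₀.seq h₁ (fun x c => ((o.weightMat x.1.1).transpose, c, x.2.2.1.2, x.2.2.2.2))
      (glue := fun p => p.2) (by fun_prop) (fun x c hc => rfl)
    have h₆ := h₅.seq h₂ (fun x u => u.2) (glue := fun p => p.2.2) (by fun_prop)
      (fun x c hc => rfl)
    have h₇ := h₆.seq h₃ (fun x u => x) (glue := fun p => p.1) (by fun_prop) (fun x c hc => rfl)
    have h := h₇.seq h₄ (fun x u => (x.2.1.1, x.2.2.1, x.2.2.2))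
      (glue := fun p => (p.1.1.1, p.1.2)) (by fun_prop) (fun x c hc => rfl)
    have hbits := h.bits
    refine (h.reshape (b' := 1000 * B) (fun x => x) (fun x u => ((u.1.1.2.1,
      (u.2.1, o.bias.transpose.mulVec x.2.2.1.2 + (o.bias.transpose.mulVec x.2.2.2.2 + x.2.1.2))),
        u.1.1.2.2)) (hI := fun i => i) (hP := fun p => (p.2.1.1.2, (p.2.2, p.1.1.2)))
      (V' := (((((Unit × (affineProt E m n).Seen₀) × (Unit × truncProt.Seen₀)) × Vec l k) ×
        (Unit × (gradWProt E o).Seen₀)) × Unit))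
      (hV := fun v => ((((((), v.1.1.1.2), ((), v.1.1.2)), v.1.2), ((), v.2)), ()))
      (by fun_prop) (by fun_prop) (by fun_prop) (fun x g => ?_) (fun x => rfl) (fun x u _ => ?_)
      (fun x u hu => ?_) ?_ ?_).mono ?_ ?_ ?_
    · simp only [backwardProt, Proto.run₀_seq, Proto.run₀_call, Proto.run₀_loc, Proto.run₀_send₁]
      dsimp only [Proto.Seen₀, Proto.call, Layer.Cache, Layer.cacheBits, Layer.cacheLen,
        Layer.Param, Layer.wDim, Layer.bDim]
      simp only [PMF.map, PMF.bind_bind, PMF.pure_bind, Function.comp_def]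
    · refine Prod.ext rfl (Prod.ext rfl ?_)
      simp only [inp, Matrix.mulVec_add, add_assoc]
    · obtain ⟨⟨⟨⟨hu₀, hu₁⟩, hu₂⟩, -⟩, hu₃⟩ := hu
      refine Prod.ext ?_ (Prod.ext hu₃ ?_)
      · refine hu₂.trans ?_
        simp only [hu₀, add_zero] at hu₁
        rw [hu₁]
        rfl
      · change _ = o.bias.transpose.mulVec (x.2.2.1.2 + x.2.2.2.2) + x.2.1.2
        rw [Matrix.mulVec_add, add_assoc]
    · omega
    · simp only [bitLength_prod, bitLength_unit] at hcache hbits ⊢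
      omega
    · omega
    · omega
    · omega
  | nonlinear s c fwd bwd fwdProt bwdProt =>
    have h : Secure (moSource E) Base (10 * B) (200 * B) 1
        (fun (x : (Vec s c × Vec l m) × (Vec s c × Vec l m)) _ => bwdProt.run₀ x.1 x.2)
        (fun x => x.1) (fun o => o.1) (fun x o => o.1 + o.2 = bwd (x.1 + x.2)) :=
      secure₀_gadget b₁ b₀ (ha.gadget true) fun S ε hS => hG S ε hS true
    have hbits := h.bits
    refine (h.reshape (b' := 200 * B) (fun x : (Vec l 0 × Vec l 0) × (Vec l 0 × Vec l 0) ×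
        (Vec s c × Vec l m) × (Vec s c × Vec l m) => x.2.2)
      (fun x u => ((u.1, 0), u.2))
      (inp' := fun x => ((Layer.backward (.nonlinear s c fwd bwd fwdProt bwdProt) x.1
        (x.2.2.1.1 + x.2.2.2.1) (x.2.2.1.2 + x.2.2.2.2)).2 + x.2.1, x.2.2.1))
      (obs' := fun o : (Vec l n × (Vec l 0 × Vec l 0)) × Vec l n => o.1)
      (hI := fun i => i.2) (hP := fun p => (p.2, p.1.1))
      (V' := (Unit × bwdProt.Seen₀) × Unit) (hV := fun v => (((), v), ())) (by fun_prop)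
      (by fun_prop) (by fun_prop) (fun x g => ?_) (fun x => rfl)
      (fun x o _ => Prod.ext rfl (Subsingleton.elim (α := Vec l 0 × Vec l 0) _ _))
      (fun x u hu => ?_) ?_ ?_).mono ?_ ?_ ?_
    · simp only [backwardProt, Proto.run₀_seq, Proto.run₀_call, Proto.run₀_loc]
      dsimp only [Proto.Seen₀, Proto.call, Layer.Cache, Layer.cacheBits, Layer.cacheLen,
        Layer.Param, Layer.wDim, Layer.bDim]
      simp only [PMF.map, PMF.bind_bind, PMF.pure_bind, Function.comp_def]
    · exact Prod.ext hu (Subsingleton.elim (α := Vec l 0 × Vec l 0) _ _)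
    · omega
    · have b₈ : bitLength (Vec l 0) ≤ B := b₆
      simp only [bitLength_prod, bitLength_unit] at hcache hbits ⊢
      omega
    · omega
    · omega
    · omega

end Layers

/-! # Networks -/

/-- The dimensions of the network are at most `q`, and the costs of its non-linear parts are at
most `B`. -/
structure NetBound (N : Network) (sims : ∀ s : N.Site, GadgetSim (N.gadget s)) (q B : ℕ) :
    Prop where
  label_le : N.labelDim ≤ q
  dim_le : ∀ j ≤ N.L, N.dim j ≤ q
  layer : ∀ j (hj : j < N.L), LayerBound (N.layer j) (fun s => sims ⟨⟨j, hj⟩, s⟩) q B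
  loss : Comp B fun a : N.Prediction × Vec N.l N.labelDim => N.lossGrad a.1 a.2
  update : ∀ τ < N.T, Comp B fun a : N.Model × N.Model => N.update τ a.1 a.2

section Networks

variable {N : Network} {E : HEScheme N.l} {ev : EvalSim E} {q B : ℕ} {Base : ℕ → ℝ → Prop}
  {sims : ∀ s : N.Site, GadgetSim (N.gadget s)}

theorem NetBound.params_le (hN : NetBound N sims q B) (hE : HEBound E ev q B) :
    ∀ j ≤ N.L, bitLength (N.Params j) ≤ 2 * (j * B)
  | 0, _ => Nat.zero_le _
  | j + 1, hj => by
    have ih := hN.params_le hE j (by omega)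
    have ha := hN.layer j hj
    have h₁ := hE.vec_le _ ha.w_le
    have h₂ := hE.vec_le _ ha.b_le
    change bitLength (N.Params j × (N.layer j).Param) ≤ _
    simp only [bitLength_prod, bitLength_fin, bitLength_zmod]
    have : (j + 1) * B = j * B + B := by ring
    omega

/-- Induction on the number of layers before the output. The only value that has to be leaked to the
data owner is the prediction. Each composition adds a multiple of the current bit bound to the
circuit size; hence a quadratic bound on bits goes with a cubic bound on sizes. -/
theorem secure₁_propagate (hE : HEBound E ev q B) (hB : ∀ S ε, Base S ε → HEClose E ev q S ε)
    (hN : NetBound N sims q B)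
    (hG : ∀ S ε, Base S ε → ∀ s, GadgetClose (N.gadget s) (sims s) S ε) :
    ∀ j ≤ N.L, Secure (doSource E) Base (2000 * ((j + 1) ^ 2 * B)) (1000000 * ((j + 1) ^ 3 * B))
      (5 * j)
      (fun (x : N.Params j × N.Params j × Vec N.l N.labelDim × Vec N.l (N.dim j) ×
          Vec N.l (N.dim j)) g =>
        (propagateProt N E j).run₁ ((E.gen g).1, x.1, x.2.2.2.1)
          (E.gen g, x.2.2.1, x.2.1, x.2.2.2.2))
      (fun x => ((N.propagate x.2.2.1 j x.1 x.2.1 (x.2.2.2.1 + x.2.2.2.2)).1, x.2.2.1, x.2.2.2.2))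
      (fun o => o.2)
      (fun x o => (o.2.1, o.1.1, o.1.2 + o.2.2) =
        N.propagate x.2.2.1 j x.1 x.2.1 (x.2.2.2.1 + x.2.2.2.2))
  | 0, _ => by
    have b₀ := hE.one_le
    have b₁ : bitLength (doSource E).Key ≤ B := by
      have := hE.genCoins_le
      simpa using this
    have b₂ : bitLength (Vec N.l N.labelDim) ≤ B := by
      have := hE.vec_le _ hN.label_le
      simpa using this
    have b₃ : bitLength N.Prediction ≤ B := by
      have := hE.vec_le _ (hN.dim_le 0 (Nat.zero_le _))
      simpa using this
    -- The revealed share is the prediction minus the own share, and the gradient of the loss is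
    -- computed from the prediction and the labels.
    have hf := (((hE.comp_sub (hN.dim_le 0 (Nat.zero_le _))).comap
      (f := fun i : N.Prediction × Vec N.l N.labelDim × N.Prediction => (i.1, i.2.2))
        (by fun_prop)).prodMk (IsWiring.const ()).computable).prodMk
      ((IsWiring.computable (f := fun i : N.Prediction × Vec N.l N.labelDim × N.Prediction => i.1)
        (by fun_prop)).prodMk (hN.loss.comap
          (f := fun i : N.Prediction × Vec N.l N.labelDim × N.Prediction => (i.1, i.2.1))
            (by fun_prop)))
    refine (Secure.det (b := 2000 * B) (v := fun x => (x.2.2.2.1, ()))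
      (o := fun x => (((), 0), (x.2.2.2.1 + x.2.2.2.2,
        N.lossGrad (x.2.2.2.1 + x.2.2.2.2) x.2.2.1))) hf (fun x g => ?_) (fun x => ?_) (fun x => ?_)
          ?_).mono ?_ ?_ le_rfl
    · simp only [propagateProt, Proto.run₁_seq, Proto.run₁_loc, Proto.run₁_send₀]
      dsimp only [Proto.Seen₁]
      simp only [PMF.pure_bind]
      rfl
    · simp [Network.propagate]
    · simp [Network.propagate]
    · change bitLength (doSource E).Key + bitLength (N.Prediction × Unit) +
        bitLength (N.Prediction × Vec N.l N.labelDim × N.Prediction) +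
          bitLength (N.Prediction × N.Prediction) ≤ _
      simp only [bitLength_prod, bitLength_unit] at b₁ ⊢
      omega
    · omega
    · simp only [bitLength_unit]
      omega
  | j + 1, hj => by
    have ha := hN.layer j hj
    have b₀ := hE.one_le
    have b₂ : bitLength (Vec N.l N.labelDim) ≤ B := by
      have := hE.vec_le _ hN.label_le
      simpa using this
    have b₃ : bitLength N.Prediction ≤ B := by
      have := hE.vec_le _ (hN.dim_le 0 (Nat.zero_le _))
      simpa using this
    have b₄ : bitLength (Vec N.l (N.dim (j + 1))) ≤ B := by
      have := hE.vec_le _ ha.in_le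
      simpa using this
    let X : Type := (N.Params j × (N.layer j).Param) × (N.Params j × (N.layer j).Param) ×
      Vec N.l N.labelDim × Vec N.l (N.dim (j + 1)) × Vec N.l (N.dim (j + 1))
    have h₁ := (secure₁_forward hE hB _ ha fun S ε hS s => hG S ε hS ⟨⟨j, hj⟩, s⟩).pull
      (b' := 210 * B) (fun x : X => (x.1.2, x.2.2.2))
      (fun x => ((N.propagate x.2.2.1 (j + 1) x.1 x.2.1 (x.2.2.2.1 + x.2.2.2.2)).1, x.2.2.1,
        x.2.2.2.2)) (hI := fun i => i.2.2) (by fun_prop) (fun x => rfl) (by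
        simp only [bitLength_prod]
        omega)
    have h₂ := secure₁_propagate hE hB hN hG j (by omega)
    have h₃ := secure₁_backward hE hB _ ha fun S ε hS s => hG S ε hS ⟨⟨j, hj⟩, s⟩
    have h := (h₁.seq h₂ (fun x o => (x.1.1, x.2.1.1, x.2.2.1, o.1.1, o.2.1))
      (glue := fun p => (p.1.1, p.1.2.1, p.2.1)) (by fun_prop) (fun x o ho => by
        -- The shares after the layer add up to the plaintext activations, so the remaining layers
        -- lead to the prediction already in the simulator's input.
        have ho₁ := congrArg Prod.fst ho
        simp only [Prod.fst_add] at ho₁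
        simp only [ho₁]
        rfl)).seq h₃ (fun x o => (x.1.2, x.2.1.2, (o.1.1.2, o.2.1.2), (o.1.2.2, o.2.2.2)))
      (glue := fun p => (p.2.1.2, p.2.2.2)) (by fun_prop) (fun x o ho => rfl)
    have hbits := h.bits
    refine (h.reshape (b' := 1210 * B + 2000 * ((j + 1) ^ 2 * B)) (fun x => x)
      (hO := fun x o => (((o.1.2.1.1, o.2.1.2), o.2.1.1), (o.1.2.2.1, o.2.2)))
      (hI := fun i => i) (hP := fun p => (p.2.1.2.1, p.2.2))
      (V' := (((Unit × (forwardProt E (N.layer j)).Seen₁) × (Unit × (propagateProt N E j).Seen₁)) ×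
        (Unit × (backwardProt E (N.layer j)).Seen₁)) × Unit)
      (hV := fun v => (((((), v.1.1), ((), v.1.2)), ((), v.2)), ()))
      (by fun_prop) (by fun_prop) (by fun_prop) (fun x g => ?_) (fun x => rfl) (fun x o _ => rfl)
      (fun x o ho => ?_) ?_ ?_).mono ?_ ?_ ?_
    · simp only [propagateProt, Proto.run₁_seq, Proto.run₁_call, Proto.run₁_loc]
      dsimp only [Proto.Seen₁, Proto.call]
      simp only [PMF.map, PMF.bind_bind, PMF.pure_bind, Function.comp_def]
      rfl
    · obtain ⟨⟨ho₁, ho₂⟩, ho₃⟩ := ho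
      dsimp only at ho₁ ho₂ ho₃
      simp only [Network.propagate]
      rw [← ho₁, Prod.fst_add, Prod.snd_add, ← ho₂]
      rw [Prod.mk.injEq] at ho₃
      exact Prod.ext rfl (Prod.ext (Prod.ext rfl ho₃.2) ho₃.1)
    · omega
    · simp only [bitLength_prod, bitLength_unit] at hbits ⊢
      omega
    -- The powers are expanded into monomials, which `omega` treats as atoms.
    · have : (j + 1 + 1) ^ 2 * B = (j + 1) ^ 2 * B + 2 * (j * B) + 3 * B := by ring
      omega
    · have e₁ : (j + 1 + 1) ^ 3 * B = (j + 1) ^ 3 * B + 3 * ((j + 1) ^ 2 * B) + 3 * (j * B) + 4 * B := by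
        ring
      omega
    · omega

/-- The model owner's simulator carries the perturbed gradients of all remaining layers and splits
off those of the current one. At the output nothing is received and the new share is `0`. The loss
`1 + 4` of a layer is the origin of the factor `5`. -/
theorem secure₀_propagate (hE : HEBound E ev q B) (hB : ∀ S ε, Base S ε → HEClose E ev q S ε)
    (hN : NetBound N sims q B)
    (hG : ∀ S ε, Base S ε → ∀ s, GadgetClose (N.gadget s) (sims s) S ε) :
    ∀ j ≤ N.L, Secure (moSource E) Base (2000 * ((j + 1) ^ 2 * B)) (1000000 * ((j + 1) ^ 3 * B))
      (5 * j)
      (fun (x : N.Params j × N.Params j × Vec N.l N.labelDim × Vec N.l (N.dim j) ×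
          Vec N.l (N.dim j)) g =>
        (propagateProt N E j).run₀ ((E.gen g).1, x.1, x.2.2.2.1)
          (E.gen g, x.2.2.1, x.2.1, x.2.2.2.2))
      (fun x => ((N.propagate x.2.2.1 j x.1 x.2.1 (x.2.2.2.1 + x.2.2.2.2)).2.1, x.1, x.2.2.2.1))
      (fun o => o.1)
      (fun x o => (o.2.1, o.1.1, o.1.2 + o.2.2) =
        N.propagate x.2.2.1 j x.1 x.2.1 (x.2.2.2.1 + x.2.2.2.2))
  | 0, _ => by
    have b₀ := hE.one_le
    have b₁ : bitLength (moSource E).Key ≤ B := by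
      have := hE.pkLen_le
      simpa using this
    have b₃ : bitLength N.Prediction ≤ B := by
      have := hE.vec_le _ (hN.dim_le 0 (Nat.zero_le _))
      simpa using this
    refine (Secure.det (b := 2000 * B) (v := fun x => ((), ()))
      (o := fun x => (((), 0), (x.2.2.2.1 + x.2.2.2.2,
        N.lossGrad (x.2.2.2.1 + x.2.2.2.2) x.2.2.1)))
      (Comp.const (((), ()), ((), (0 : N.Prediction)))) (fun x g => ?_) (fun x => ?_) (fun x => ?_)
          ?_).mono ?_ ?_ le_rfl
    · simp only [propagateProt, Proto.run₀_seq, Proto.run₀_loc, Proto.run₀_send₀]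
      dsimp only [Proto.Seen₀]
      simp only [PMF.pure_bind]
      rfl
    · rfl
    · simp [Network.propagate]
    · change bitLength (moSource E).Key + bitLength (Unit × Unit) +
        bitLength (Unit × Unit × N.Prediction) + bitLength (Unit × N.Prediction) ≤ _
      simp only [bitLength_prod, bitLength_unit] at b₁ ⊢
      omega
    · omega
    · simp only [bitLength_prod, bitLength_unit]
      omega
  | j + 1, hj => by
    have ha := hN.layer j hj
    have b₀ := hE.one_le
    have b₂ := hN.params_le hE (j + 1) hj
    have b₄ : bitLength (Vec N.l (N.dim (j + 1))) ≤ B := by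
      have := hE.vec_le _ ha.in_le
      simpa using this
    change bitLength (N.Params j × (N.layer j).Param) ≤ _ at b₂
    have e : (j + 1) * B = j * B + B := by ring
    rw [bitLength_prod, e] at b₂
    let X : Type := (N.Params j × (N.layer j).Param) × (N.Params j × (N.layer j).Param) ×
      Vec N.l N.labelDim × Vec N.l (N.dim (j + 1)) × Vec N.l (N.dim (j + 1))
    let inp : X → (N.Params j × (N.layer j).Param) × (N.Params j × (N.layer j).Param) ×
        Vec N.l (N.dim (j + 1)) := fun x =>
      ((N.propagate x.2.2.1 (j + 1) x.1 x.2.1 (x.2.2.2.1 + x.2.2.2.2)).2.1, x.1, x.2.2.2.1)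
    have h₁ := (secure₀_forward hE hB _ ha fun S ε hS s => hG S ε hS ⟨⟨j, hj⟩, s⟩).pull
      (b' := 210 * B + 4 * (j * B)) (fun x : X => (x.1.2, x.2.2.2)) inp
      (hI := fun i => (i.2.1.2, i.2.2)) (by fun_prop) (fun x => rfl) (by
        simp only [bitLength_prod] at b₂ ⊢
        omega)
    have h₂ := secure₀_propagate hE hB hN hG j (by omega)
    have h₃ := secure₀_backward hE hB _ ha fun S ε hS s => hG S ε hS ⟨⟨j, hj⟩, s⟩
    have h := (h₁.seq h₂ (fun x o => (x.1.1, x.2.1.1, x.2.2.1, o.1.1, o.2.1))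
      (glue := fun p => (p.1.1.1, p.1.2.1.1, p.2.1)) (by fun_prop) (fun x o ho => by
        dsimp only at ho
        simp only [inp, Network.propagate, ← ho]
        rfl)).seq h₃ (fun x o => (x.1.2, x.2.1.2, (o.1.1.2, o.2.1.2), (o.1.2.2, o.2.2.2)))
      (glue := fun p => (p.1.1.2, p.2.1.2, p.2.2.2)) (by fun_prop) (fun x o ho => by
        obtain ⟨ho₁, ho₂⟩ := ho
        dsimp only at ho₁ ho₂
        simp only [inp, Network.propagate]
        -- The reconstructed cache and output gradient are the plaintext ones, so the backward step
        -- reveals exactly the gradient in the simulator's input.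
        rw [← ho₁, Prod.fst_add, Prod.snd_add, ← ho₂])
    have hbits := h.bits
    refine (h.reshape (b' := 1210 * B + 4 * (j * B) + 2000 * ((j + 1) ^ 2 * B)) (fun x => x)
      (hO := fun x o => (((o.1.2.1.1, o.2.1.2), o.2.1.1), (o.1.2.2.1, o.2.2)))
      (hI := fun i => i) (hP := fun p => ((p.2.1.2.1, p.2.2.2), p.2.2.1))
      (V' := (((Unit × (forwardProt E (N.layer j)).Seen₀) × (Unit × (propagateProt N E j).Seen₀)) ×
        (Unit × (backwardProt E (N.layer j)).Seen₀)) × Unit)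
      (hV := fun v => (((((), v.1.1), ((), v.1.2)), ((), v.2)), ()))
      (by fun_prop) (by fun_prop) (by fun_prop) (fun x g => ?_) (fun x => rfl) (fun x o _ => rfl)
      (fun x o ho => ?_) ?_ ?_).mono ?_ ?_ ?_
    · simp only [propagateProt, Proto.run₀_seq, Proto.run₀_call, Proto.run₀_loc]
      dsimp only [Proto.Seen₀, Proto.call]
      simp only [PMF.map, PMF.bind_bind, PMF.pure_bind, Function.comp_def]
      rfl
    · obtain ⟨⟨ho₁, ho₂⟩, ho₃⟩ := ho
      dsimp only at ho₁ ho₂ ho₃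
      simp only [Network.propagate]
      rw [← ho₁, Prod.fst_add, Prod.snd_add, ← ho₂]
      rw [Prod.mk.injEq] at ho₃
      exact Prod.ext rfl (Prod.ext (Prod.ext rfl ho₃.2) ho₃.1)
    · omega
    · simp only [bitLength_prod, bitLength_unit] at hbits ⊢
      omega
    · have : (j + 1 + 1) ^ 2 * B = (j + 1) ^ 2 * B + 2 * (j * B) + 3 * B := by ring
      omega
    · have e₁ : (j + 1 + 1) ^ 3 * B =
          (j + 1) ^ 3 * B + 3 * ((j + 1) ^ 2 * B) + 3 * (j * B) + 4 * B := by ring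
      omega
    · omega

end Networks

/-! ### Iterations of training; `R` bounds the costs of one iteration. -/

section Training

variable {N : Network} {E : HEScheme N.l} {ev : EvalSim E} {q B R : ℕ} {Base : ℕ → ℝ → Prop}
  {sims : ∀ s : N.Site, GadgetSim (N.gadget s)}

theorem NetBound.cost_le (hN : NetBound N sims q B) (hE : HEBound E ev q B)
    (hR : 1000000 * ((N.L + 1) ^ 3 * B) ≤ R) :
    1 ≤ R ∧ 100 * B ≤ R ∧ bitLength E.PK ≤ R ∧ E.genCoins ≤ R ∧
      2000 * ((N.L + 1) ^ 2 * B) ≤ R ∧ bitLength N.Model ≤ R ∧ bitLength N.Round ≤ R ∧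
        bitLength N.Prediction ≤ R ∧ bitLength (Vec N.l (N.dim N.L)) ≤ R := by
  have h₁ := hE.one_le
  have h₂ := hE.pkLen_le
  have h₃ := hE.genCoins_le
  have h₄ : bitLength N.Model ≤ _ := hN.params_le hE N.L le_rfl
  have h₅ := hE.vec_le _ hN.label_le
  have h₆ := hE.vec_le _ (hN.dim_le 0 (Nat.zero_le _))
  have h₇ := hE.vec_le _ (hN.dim_le N.L le_rfl)
  have e₁ : (N.L + 1) ^ 3 * B = N.L ^ 3 * B + 3 * (N.L ^ 2 * B) + 3 * (N.L * B) + B := by ring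
  have e₂ : (N.L + 1) ^ 2 * B = N.L ^ 2 * B + 2 * (N.L * B) + B := by ring
  rw [e₁] at hR
  rw [e₂]
  simp only [bitLength_prod, bitLength_fin, bitLength_zmod, bitLength_bool, mul_one]
  omega

/-- One iteration on shares agrees with the plaintext one; the summand `0` is the model owner's
share of the batch. -/
theorem trainIter_succ_eq {k : ℕ} {M : N.Model} {D : Fin (k + 1) → N.Round}
    {s : ((Fin k → N.Model) × N.Model) × (Fin k → N.Prediction)}
    {u : (N.Params N.L × Vec N.l (N.dim N.L)) × (N.Prediction × Vec N.l (N.dim N.L))}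
    (hs : s = N.trainIter M k fun i => D i.castSucc)
    (hu : (u.2.1, u.1.1, u.1.2 + u.2.2) = N.propagate (D (Fin.last k)).2.1 N.L s.1.2
      (D (Fin.last k)).2.2 (0 + (D (Fin.last k)).1)) :
    ((Fin.snoc (α := fun _ => N.Model) s.1.1 u.1.1, N.update k s.1.2 u.1.1),
      Fin.snoc (α := fun _ => N.Prediction) s.2 u.2.1) = N.trainIter M (k + 1) D := by
  have h₁ := congrArg (fun v => v.1) hu
  have h₂ := congrArg (fun v => v.2.1) hu
  dsimp only at h₁ h₂
  rw [zero_add] at h₁ h₂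
  simp only [Network.trainIter]
  rw [h₁, h₂, hs]

/-- The simulator receives all batches and all predictions at once; those of earlier iterations are
passed on by restriction, those of the last are read off. Intermediate models never enter, since
`secure₁_propagate` does not need them. -/
theorem secure₁_trainIter (hE : HEBound E ev q B) (hB : ∀ S ε, Base S ε → HEClose E ev q S ε)
    (hN : NetBound N sims q B)
    (hG : ∀ S ε, Base S ε → ∀ s, GadgetClose (N.gadget s) (sims s) S ε)
    (hR : 1000000 * ((N.L + 1) ^ 3 * B) ≤ R) :
    ∀ k ≤ N.T, Secure (doSource E) Base (100 * ((k + 1) ^ 2 * R)) (100000 * ((k + 1) ^ 3 * R))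
      (5 * (N.L * k))
      (fun (x : N.Model × (Fin k → N.Round)) g =>
        (trainIterProt N E k).run₁ ((E.gen g).1, x.1) (E.gen g, x.2))
      (fun x => (x.2, (N.trainIter x.1 k x.2).2)) (fun o => o.2)
      (fun x o => o = N.trainIter x.1 k x.2)
  | 0, _ => by
    obtain ⟨r₀, r₁, r₂, r₃, r₄, r₅, r₆, r₇, r₈⟩ := hN.cost_le hE hR
    have b₁ : bitLength (doSource E).Key ≤ R := by simpa using r₃
    have hf := (IsWiring.const (α := (Fin 0 → N.Round) × (Fin 0 → N.Prediction)) ()).prodMk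
      (IsWiring.id.snd)
    refine (Secure.det (b := 100 * R) (X := N.Model × (Fin 0 → N.Round)) (v := fun x => ())
      (inp := fun x => (x.2, (N.trainIter x.1 0 x.2).2)) (obs := fun o => o.2)
      (Post := fun x o => o = N.trainIter x.1 0 x.2) (o := fun x => ((Fin.elim0, x.1), Fin.elim0)) hf.computable (fun x g => ?_) (fun x => rfl)
        (fun x => rfl) ?_).mono ?_ ?_ le_rfl
    · exact Proto.run₁_loc _ _ _ _
    · simp only [bitLength_prod, bitLength_unit, bitLength_fin] at b₁ ⊢
      omega
    · omega
    · simp only [bitLength_prod, bitLength_unit, bitLength_fin]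
      omega
  | k + 1, hk => by
    obtain ⟨r₀, r₁, r₂, r₃, r₄, r₅, r₆, r₇, r₈⟩ := hN.cost_le hE hR
    have r₉ := Nat.mul_le_mul_left k r₆
    have r₁₀ := Nat.mul_le_mul_left k r₇
    have e₁ : (k + 1 + 1) ^ 2 * R = (k + 1) ^ 2 * R + 2 * (k * R) + 3 * R := by ring
    have e₂ : (k + 1 + 1) ^ 3 * R =
      (k + 1) ^ 3 * R + 3 * ((k + 1) ^ 2 * R) + 3 * (k * R) + 4 * R := by ring
    have e₃ : (k + 1) ^ 2 * R = k ^ 2 * R + 2 * (k * R) + R := by ring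
    have hI : bitLength ((Fin (k + 1) → N.Round) × (Fin (k + 1) → N.Prediction)) ≤
        2 * (k * R) + 2 * R := by
      simp only [bitLength_prod _ (Fin (k + 1) → N.Prediction), bitLength_fin (k + 1), add_mul,
        one_mul]
      omega
    have h₁ := (secure₁_trainIter hE hB hN hG hR k (by omega)).pull
      (b' := 100 * ((k + 1) ^ 2 * R) + 2 * (k * R) + 2 * R)
      (fun x : N.Model × (Fin (k + 1) → N.Round) => (x.1, fun i => x.2 i.castSucc))
      (fun x => (x.2, (N.trainIter x.1 (k + 1) x.2).2))
      (hI := fun i => (fun a => i.1 a.castSucc, fun a => i.2 a.castSucc))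
      (by fun_prop) (fun x => by simp [Network.trainIter]) (by omega)
    have h₂ := secure₁_propagate hE hB hN hG N.L le_rfl
    have h := h₁.seq h₂ (fun x o => (o.1.2, (x.2 (Fin.last k)).2.2, (x.2 (Fin.last k)).2.1, 0,
        (x.2 (Fin.last k)).1))
      (glue := fun p => (p.1.2 (Fin.last k), (p.1.1 (Fin.last k)).2.1, (p.1.1 (Fin.last k)).1))
      (by fun_prop) (fun x o ho => by
        dsimp only at ho
        simp [Network.trainIter, ho])
    have hbits := h.bits
    refine (h.reshape (b' := 100 * ((k + 1) ^ 2 * R) + 10 * (k * R) + 10 * R) (fun x => x)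
      (hO := fun x o => ((Fin.snoc (α := fun _ => N.Model) o.1.1.1 o.2.1.1,
        N.update k o.1.1.2 o.2.1.1), Fin.snoc (α := fun _ => N.Prediction) o.1.2 o.2.2.1))
      (hI := fun i => i) (hP := fun p => p.1.2)
      (V' := ((Unit × (trainIterProt N E k).Seen₁) × (Unit × (propagateProt N E N.L).Seen₁)) × Unit)
      (hV := fun v => ((((), v.1), ((), v.2)), ()))
      (by fun_prop) (by fun_prop) (by fun_prop) (fun x g => ?_) (fun x => rfl)
      (fun x o ho => congrArg Prod.snd (trainIter_succ_eq ho.1 ho.2))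
      (fun x o ho => trainIter_succ_eq ho.1 ho.2) ?_ ?_).mono ?_ ?_ ?_
    · simp only [trainIterProt, Proto.run₁_seq, Proto.run₁_call, Proto.run₁_loc]
      dsimp only [Proto.Seen₁, Proto.call]
      simp only [PMF.map, PMF.bind_bind, PMF.pure_bind, Function.comp_def]
    · omega
    · simp only [bitLength_prod, bitLength_unit] at hbits hI ⊢
      rw [bitLength_fin (k + 1), add_mul, one_mul]
      omega
    · omega
    · omega
    · have : N.L * (k + 1) = N.L * k + N.L := by ring
      omega

/-- From the initial model and the series of perturbed gradients, the simulator can follow every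
intermediate model by applying the update rule itself. -/
theorem secure₀_trainIter (hE : HEBound E ev q B) (hB : ∀ S ε, Base S ε → HEClose E ev q S ε)
    (hN : NetBound N sims q B)
    (hG : ∀ S ε, Base S ε → ∀ s, GadgetClose (N.gadget s) (sims s) S ε)
    (hR : 1000000 * ((N.L + 1) ^ 3 * B) ≤ R) :
    ∀ k ≤ N.T, Secure (moSource E) Base (100 * ((k + 1) ^ 2 * R)) (100000 * ((k + 1) ^ 3 * R))
      (5 * (N.L * k))
      (fun (x : N.Model × (Fin k → N.Round)) g =>
        (trainIterProt N E k).run₀ ((E.gen g).1, x.1) (E.gen g, x.2))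
      (fun x => (x.1, (N.trainIter x.1 k x.2).1.1)) (fun o => o.1)
      (fun x o => o = N.trainIter x.1 k x.2)
  | 0, _ => by
    obtain ⟨r₀, r₁, r₂, r₃, r₄, r₅, r₆, r₇, r₈⟩ := hN.cost_le hE hR
    have b₁ : bitLength (moSource E).Key ≤ R := by simpa using r₂
    have hf := (IsWiring.const (α := N.Model × (Fin 0 → N.Model)) ()).prodMk
      (IsWiring.id.snd.prodMk IsWiring.id.fst)
    refine (Secure.det (b := 100 * R) (X := N.Model × (Fin 0 → N.Round)) (v := fun x => ())
      (inp := fun x => (x.1, (N.trainIter x.1 0 x.2).1.1)) (obs := fun o => o.1)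
      (Post := fun x o => o = N.trainIter x.1 0 x.2)
      (o := fun x => ((Fin.elim0, x.1), Fin.elim0)) hf.computable (fun x g => ?_) (fun x => rfl)
        (fun x => rfl) ?_).mono ?_ ?_ le_rfl
    · exact Proto.run₀_loc _ _ _ _
    · simp only [bitLength_prod, bitLength_unit, bitLength_fin] at b₁ ⊢
      omega
    · omega
    · simp only [bitLength_prod, bitLength_unit, bitLength_fin]
      omega
  | k + 1, hk => by
    obtain ⟨r₀, r₁, r₂, r₃, r₄, r₅, r₆, r₇, r₈⟩ := hN.cost_le hE hR
    have b₁ : bitLength (moSource E).Key ≤ R := by simpa using r₂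
    have r₉ := Nat.mul_le_mul_left k r₅
    have e₁ : (k + 1 + 1) ^ 2 * R = (k + 1) ^ 2 * R + 2 * (k * R) + 3 * R := by ring
    have e₂ : (k + 1 + 1) ^ 3 * R =
      (k + 1) ^ 3 * R + 3 * ((k + 1) ^ 2 * R) + 3 * (k * R) + 4 * R := by ring
    have e₃ : (k + 1) ^ 2 * R = k ^ 2 * R + 2 * (k * R) + R := by ring
    have hI : bitLength (N.Model × (Fin (k + 1) → N.Model)) ≤ k * R + 2 * R := by
      rw [bitLength_prod, bitLength_fin (k + 1), add_mul, one_mul]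
      omega
    let inp : N.Model × (Fin (k + 1) → N.Round) → N.Model × (Fin (k + 1) → N.Model) := fun x =>
      (x.1, (N.trainIter x.1 (k + 1) x.2).1.1)
    have hM : bitLength (ParamsOf N.layer N.L) = bitLength N.Model := rfl
    have h₁ := (secure₀_trainIter hE hB hN hG hR k (by omega)).pull
      (b' := 100 * ((k + 1) ^ 2 * R) + 2 * (k * R) + 2 * R)
      (fun x : N.Model × (Fin (k + 1) → N.Round) => (x.1, fun i => x.2 i.castSucc)) inp
      (hI := fun i => (i.1, fun a => i.2 a.castSucc))
      (by fun_prop) (fun x => by simp [inp, Network.trainIter]) (by omega)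
    -- Supplies the initial share `0` of the batch, a constant that no wiring can produce.
    have h₂ : Secure (moSource E) Base (k * R + 4 * R) (k * R + 10 * R) 0
        (fun (_ : N.Model × (Fin (k + 1) → N.Round)) _ => PMF.pure ((), 0)) inp
        (fun c : Vec N.l (N.dim N.L) => c) (fun _ c => c = 0) := by
      refine (Secure.det (b := k * R + 4 * R) (X := N.Model × (Fin (k + 1) → N.Round)) (inp := inp)
        (v := fun _ => ()) (o := fun _ => 0) (obs := fun c => c) (Post := fun _ c => c = 0)
          (Comp.const ((), (0 : Vec N.l (N.dim N.L)))) (fun x g => rfl) (fun x => rfl)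
            (fun x => rfl) ?_).mono le_rfl ?_ le_rfl
      · rw [bitLength_unit]
        omega
      · rw [bitLength_prod, bitLength_unit]
        omega
    have h₃ := secure₀_propagate hE hB hN hG N.L le_rfl
    -- The local update as a separate deterministic step, since it is a computation.
    have h₄ : Secure (moSource E) Base (10 * R) (20 * R) 0
        (fun (x : N.Model × N.Model) _ => PMF.pure ((), N.update k x.1 x.2)) (fun x => x)
        (fun M => M) (fun x M => M = N.update k x.1 x.2) := by
      refine (Secure.det (b := 10 * R) (X := N.Model × N.Model) (inp := fun x => x)
        (v := fun _ => ()) (o := fun x => N.update k x.1 x.2) (obs := fun M => M)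
        (Post := fun x M => M = N.update k x.1 x.2)
        ((IsWiring.const (α := N.Model × N.Model) ()).computable.prodMk (hN.update k (by omega)))
        (fun x g => rfl) (fun x => rfl) (fun x => rfl) ?_).mono le_rfl ?_ le_rfl
      · rw [bitLength_unit, bitLength_prod, hM]
        omega
      · rw [bitLength_unit]
        omega
    have h := ((h₁.seq h₂ (fun x _ => x) (glue := fun p => p.1) (by fun_prop)
      (fun x o ho => rfl)).seq h₃ (fun x o => (o.1.1.2, (x.2 (Fin.last k)).2.2,
        (x.2 (Fin.last k)).2.1, o.2, (x.2 (Fin.last k)).1))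
      (glue := fun p => (p.1.2 (Fin.last k), p.2.1.2, p.2.2)) (by fun_prop) (fun x o ho => by
        obtain ⟨ho₁, ho₂⟩ := ho
        dsimp only at ho₁ ho₂
        simp [inp, Network.trainIter, ho₁, ho₂])).seq h₄ (fun x o => (o.1.1.1.2, o.2.1.1))
      (glue := fun p => (p.2.1.1.2, p.2.2.1)) (by fun_prop) (fun x o ho => rfl)
    have hbits := h.bits
    have hout : ∀ (x : N.Model × (Fin (k + 1) → N.Round)) (o : (((((Fin k → N.Model) × N.Model) ×
        (Fin k → N.Prediction)) × Vec N.l (N.dim N.L)) × ((N.Params N.L × Vec N.l (N.dim N.L)) ×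
          (N.Prediction × Vec N.l (N.dim N.L)))) × N.Model),
        o.1.1.1 = N.trainIter x.1 k (fun i => x.2 i.castSucc) → o.1.1.2 = 0 →
        (o.1.2.2.1, o.1.2.1.1, o.1.2.1.2 + o.1.2.2.2) = N.propagate (x.2 (Fin.last k)).2.1 N.L
          o.1.1.1.1.2 (x.2 (Fin.last k)).2.2 (o.1.1.2 + (x.2 (Fin.last k)).1) →
        o.2 = N.update k o.1.1.1.1.2 o.1.2.1.1 →
        ((Fin.snoc (α := fun _ => N.Model) o.1.1.1.1.1 o.1.2.1.1, o.2),
          Fin.snoc (α := fun _ => N.Prediction) o.1.1.1.2 o.1.2.2.1) =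
            N.trainIter x.1 (k + 1) x.2 := by
      intro x o ho₁ ho₂ ho₃ ho₄
      rw [ho₂] at ho₃
      rw [ho₄]
      exact trainIter_succ_eq ho₁ ho₃
    refine (h.reshape (b' := 100 * ((k + 1) ^ 2 * R) + 10 * (k * R) + 20 * R) (fun x => x)
      (hO := fun x o => ((Fin.snoc (α := fun _ => N.Model) o.1.1.1.1.1 o.1.2.1.1, o.2),
          Fin.snoc (α := fun _ => N.Prediction) o.1.1.1.2 o.1.2.2.1))
      (hI := fun i => i) (hP := fun p => (p.1.2, p.2.2))
      (V' := ((Unit × (trainIterProt N E k).Seen₀) × (Unit × (propagateProt N E N.L).Seen₀)) × Unit)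
      (hV := fun v => ((((), v.1.1.1), ((), v.1.2)), ()))
      (by fun_prop) (by fun_prop) (by fun_prop) (fun x g => ?_) (fun x => rfl)
      (fun x o ho => Prod.ext (congrArg (fun u => u.1.1) (hout x o ho.1.1.1 ho.1.1.2 ho.1.2 ho.2))
        rfl) (fun x o ho => hout x o ho.1.1.1 ho.1.1.2 ho.1.2 ho.2) ?_ ?_).mono ?_ ?_ ?_
    · simp only [trainIterProt, Proto.run₀_seq, Proto.run₀_call, Proto.run₀_loc]
      dsimp only [Proto.Seen₀, Proto.call]
      simp only [PMF.map, PMF.bind_bind, PMF.pure_bind, Function.comp_def]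
    · omega
    · simp only [bitLength_prod, bitLength_unit] at hbits hI ⊢
      rw [bitLength_fin (k + 1), add_mul, one_mul]
      omega
    · omega
    · omega
    · have : N.L * (k + 1) = N.L * k + N.L := by ring
      omega

end Training

/-! ### The whole protocol, including key generation. -/

section Protocol

variable {N : Network} {E : HEScheme N.l} {ev : EvalSim E} {q B R : ℕ} {Base : ℕ → ℝ → Prop}
  {sims : ∀ s : N.Site, GadgetSim (N.gadget s)}

theorem Proto.outLaw_eq_run₁ {A B A' B' : Type} (p : Proto A B A' B') (a : A) (b : B) :
    p.outLaw a b = (p.run₁ a b).map fun u => u.2 := by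
  rw [Proto.run₁, PMF.map_comp]
  rfl

theorem Proto.viewLaw₁_eq_run₁ {A B A' B' : Type} (p : Proto A B A' B') (a : A) (b : B) :
    p.viewLaw₁ a b = (p.run₁ a b).map fun u => (b, u.1) := by
  rw [Proto.run₁, PMF.map_comp]
  rfl

theorem Proto.viewLaw₀_eq_run₀ {A B A' B' : Type} (p : Proto A B A' B') (a : A) (b : B) :
    p.viewLaw₀ a b = (p.run₀ a b).map fun u => (a, u.1) := by
  rw [Proto.run₀, PMF.map_comp]
  rfl

/-- Only the clause `mix` matters: in each component of the mixture the output satisfies `Post`,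
which says that it equals the plaintext result. -/
theorem outLaw_pencil (hE : HEBound E ev q B) (hB : ∀ S ε, Base S ε → HEClose E ev q S ε)
    (hN : NetBound N sims q B)
    (hG : ∀ S ε, Base S ε → ∀ s, GadgetClose (N.gadget s) (sims s) S ε) (M : N.Model)
    (D : N.TrainData) : (pencil N E).outLaw M D = PMF.pure (N.train M D) := by
  obtain ⟨Ω, W, T, out, h₁, -, h₂⟩ := (secure₁_trainIter hE hB hN hG le_rfl N.T le_rfl).mix (M, D)
  dsimp only at h₁ h₂
  rw [Proto.outLaw_eq_run₁]
  simp only [pencil, Proto.run₁_seq, Proto.run₁_call, Proto.run₁_loc, Proto.run₁_coin₁,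
    Proto.run₁_send₁]
  dsimp only [Proto.Seen₁, Proto.call]
  simp only [PMF.map, PMF.bind_bind, PMF.pure_bind, Function.comp_def]
  have h₃ : ∀ g, ((trainIterProt N E N.T).run₁ ((E.gen g).1, M) (E.gen g, D)).bind
      (fun u => PMF.pure u.2) = PMF.pure (N.train M D) := fun g => by
    rw [h₁, PMF.bind_bind]
    simp only [PMF.map, PMF.bind_bind, PMF.pure_bind, Function.comp_def, PMF.bind_const]
    rw [bind_congr_support fun w hw => by rw [h₂ w hw], PMF.bind_const]
    rfl
  simp only [Prod.mk.eta, h₃, PMF.bind_const]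

/-- The coins of the key generation belong to the data owner's view; the simulator draws them
itself, after which the joint law with the key is exactly the view. -/
theorem view₁_pencil (hE : HEBound E ev q B) (hB : ∀ S ε, Base S ε → HEClose E ev q S ε)
    (hN : NetBound N sims q B)
    (hG : ∀ S ε, Base S ε → ∀ s, GadgetClose (N.gadget s) (sims s) S ε)
    (hR : 1000000 * ((N.L + 1) ^ 3 * B) ≤ R) :
    ∃ Sim : N.TrainData × (Fin N.T → N.Prediction) → PMF (pencil N E).View₁,
      Samp (200 * ((N.T + 1) ^ 2 * R)) (200000 * ((N.T + 1) ^ 3 * R)) Sim ∧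
      bitLength (N.TrainData × (Fin N.T → N.Prediction)) ≤ 100 * ((N.T + 1) ^ 2 * R) ∧
      ∀ S ε, 0 ≤ ε → Base S ε → ∀ M D s, s + 200000 * ((N.T + 1) ^ 3 * R) ≤ S →
        Close s ((5 * (N.L * N.T) : ℕ) * ε) ((pencil N E).viewLaw₁ M D)
          (Sim (D, (N.train M D).2)) := by
  obtain ⟨r₀, r₁, r₂, r₃, r₄, r₅, r₆, r₇, r₈⟩ := hN.cost_le hE hR
  obtain ⟨hb, ⟨Sim, h₁, h₂⟩, -⟩ := secure₁_trainIter hE hB hN hG hR N.T le_rfl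
  have e₂ : (N.T + 1) ^ 3 * R = (N.T + 1) ^ 2 * R + N.T * ((N.T + 1) ^ 2 * R) := by ring
  have e₁ : (N.T + 1) ^ 2 * R = N.T ^ 2 * R + 2 * (N.T * R) + R := by ring
  have hS := (samp_uniform (α := N.TrainData × (Fin N.T → N.Prediction))
    (encodeSurjective_bits E.genCoins)).bindWith
      ((h₁.comap (f := fun a : (N.TrainData × (Fin N.T → N.Prediction)) × Bits E.genCoins =>
        (a.2, a.1)) (by fun_prop)).bindWith (IsWiring.samp (f := fun a =>
          (a.1.1.1, (((a.1.2, ()), ((), a.2.1)), ()))) (by fun_prop)))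
  let Seen : Type := ((Bits E.genCoins × Unit) × (Unit × (trainIterProt N E N.T).Seen₁)) × Unit
  have hK : bitLength (Bits E.genCoins) = E.genCoins := by simp
  change bitLength (Bits E.genCoins) + _ + bitLength (N.TrainData × (Fin N.T → N.Prediction)) + _ ≤
    _ at hb
  have hD := hb
  rw [bitLength_prod] at hD
  refine ⟨_, (hS.mono (c' := 200000 * ((N.T + 1) ^ 3 * R)) ?_ ?_ : Samp (β := N.TrainData × Seen)
    _ _ _), ?_, ?_⟩
  · omega
  · simp only [bitLength_prod, bitLength_unit]
    omega
  · omega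
  · intro S ε hε hS M D s hs
    have hF : Samp 0 (10 * (100 * ((N.T + 1) ^ 2 * R)))
        fun a : Bits E.genCoins × ((trainIterProt N E N.T).Seen₁ × (Fin N.T → N.Prediction)) =>
          PMF.pure ((D, (((a.1, ()), ((), a.2.1)), ())) : N.TrainData × Seen) := by
      refine (Comp.samp (Comp.withConst (IsWiring.computable
        (f := fun a : (Bits E.genCoins × ((trainIterProt N E N.T).Seen₁ × (Fin N.T → N.Prediction)))
          × N.TrainData => ((a.2, (((a.1.1, ()), ((), a.1.2.1)), ())) : N.TrainData × Seen))
            (by fun_prop)) D)).mono le_rfl ?_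
      simp only [Seen, bitLength_prod, bitLength_unit]
      omega
    have hcl := Close.bind_samp (s := s) (h₂ S ε hε hS (M, D) _ (by
      simp only [bitLength_prod]
      omega)) hF
    refine hcl.congr ?_ ?_
    · rw [Proto.viewLaw₁_eq_run₁]
      simp only [pencil, Proto.run₁_seq, Proto.run₁_call, Proto.run₁_loc, Proto.run₁_coin₁,
        Proto.run₁_send₁, Source.joint]
      dsimp only [Proto.Seen₁, Proto.call]
      simp only [PMF.map, PMF.bind_bind, PMF.pure_bind, Function.comp_def]
    · simp only [Source.joint, PMF.map, PMF.bind_bind, PMF.pure_bind, Function.comp_def]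
      rfl

theorem view₀_pencil (hE : HEBound E ev q B) (hB : ∀ S ε, Base S ε → HEClose E ev q S ε)
    (hN : NetBound N sims q B)
    (hG : ∀ S ε, Base S ε → ∀ s, GadgetClose (N.gadget s) (sims s) S ε)
    (hR : 1000000 * ((N.L + 1) ^ 3 * B) ≤ R) :
    ∃ Sim : N.Model × N.TrainOutput → PMF (pencil N E).View₀,
      Samp (200 * ((N.T + 1) ^ 2 * R)) (200000 * ((N.T + 1) ^ 3 * R)) Sim ∧
      bitLength (N.Model × N.TrainOutput) ≤ 200 * ((N.T + 1) ^ 2 * R) ∧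
      ∀ S ε, 0 ≤ ε → Base S ε → ∀ M D s, s + 200000 * ((N.T + 1) ^ 3 * R) ≤ S →
        Close s ((5 * (N.L * N.T) : ℕ) * ε) ((pencil N E).viewLaw₀ M D)
          (Sim (M, (N.train M D).1)) := by
  obtain ⟨r₀, r₁, r₂, r₃, r₄, r₅, r₆, r₇, r₈⟩ := hN.cost_le hE hR
  obtain ⟨hb, ⟨Sim, h₁, h₂⟩, -⟩ := secure₀_trainIter hE hB hN hG hR N.T le_rfl
  have e₂ : (N.T + 1) ^ 3 * R = (N.T + 1) ^ 2 * R + N.T * ((N.T + 1) ^ 2 * R) := by ring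
  have e₁ : (N.T + 1) ^ 2 * R = N.T ^ 2 * R + 2 * (N.T * R) + R := by ring
  let Seen : Type := ((Unit × E.PK) × (Unit × (trainIterProt N E N.T).Seen₀)) × Unit
  -- The model owner's simulator runs the key generation and keeps only the public key.
  have hpk : Samp E.genCoins (E.genCoins + 100 * B) fun _ : N.Model × N.TrainOutput =>
      (PMF.uniformOfFintype (Bits E.genCoins)).map fun g => (E.gen g).1 := by
    have := hE.pkLen_le
    have := hE.one_le
    refine ((samp_uniform (α := N.Model × N.TrainOutput)
      (encodeSurjective_bits E.genCoins)).map ((IsWiring.computable (f := fun k : E.PK × E.SK => k.1)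
        (by fun_prop)).comp hE.gen)).mono ?_ ?_
    · simp
    · simp only [bitLength_fin, bitLength_bool, mul_one]
      omega
  have hS := hpk.bindWith
      ((h₁.comap (f := fun a : (N.Model × N.TrainOutput) × E.PK => (a.2, (a.1.1, a.1.2.1)))
        (by fun_prop)).bindWith (IsWiring.samp (f := fun a =>
          ((a.1.1.1, ((((), a.1.2), ((), a.2.1)), ())) : N.Model × Seen)) (by fun_prop)))
  change bitLength E.PK + _ + bitLength (N.Model × (Fin N.T → N.Model)) +
    bitLength N.TrainOutput ≤ _ at hb
  have hD := hb
  rw [bitLength_prod N.Model] at hD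
  have hb' := bitLength_prod N.Model N.TrainOutput
  refine ⟨_, (hS.mono (c' := 200000 * ((N.T + 1) ^ 3 * R)) ?_ ?_ : Samp (β := N.Model × Seen)
    _ _ _), ?_, ?_⟩
  · omega
  · rw [hb']
    simp only [Seen, bitLength_prod _ E.PK, bitLength_prod _ Unit, bitLength_prod Unit,
      bitLength_prod N.Model (((Unit × E.PK) × (Unit × (trainIterProt N E N.T).Seen₀)) × Unit),
      bitLength_prod (Unit × E.PK), bitLength_unit, bitLength_prod _ N.TrainOutput]
    omega
  · omega
  · intro S ε hε hS M D s hs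
    have hF : Samp 0 (10 * (100 * ((N.T + 1) ^ 2 * R)))
        fun a : E.PK × ((trainIterProt N E N.T).Seen₀ × N.TrainOutput) =>
          PMF.pure ((M, ((((), a.1), ((), a.2.1)), ())) : N.Model × Seen) := by
      refine (Comp.samp (Comp.withConst (IsWiring.computable
        (f := fun a : (E.PK × ((trainIterProt N E N.T).Seen₀ × N.TrainOutput))
          × N.Model => ((a.2, ((((), a.1.1), ((), a.1.2.1)), ())) : N.Model × Seen))
            (by fun_prop)) M)).mono le_rfl ?_
      simp only [Seen, bitLength_prod, bitLength_unit] at hD ⊢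
      omega
    have hcl := Close.bind_samp (s := s) (h₂ S ε hε hS (M, D) _ (by
      have := bitLength_prod E.PK ((trainIterProt N E N.T).Seen₀ × N.TrainOutput)
      have := bitLength_prod (trainIterProt N E N.T).Seen₀ N.TrainOutput
      have : bitLength ((moSource E).Key × ((trainIterProt N E N.T).Seen₀ ×
        ((Fin N.T → N.Model) × N.Model))) =
          bitLength (E.PK × ((trainIterProt N E N.T).Seen₀ × N.TrainOutput)) := rfl
      omega)) hF
    refine hcl.congr ?_ ?_
    · rw [Proto.viewLaw₀_eq_run₀]
      simp only [pencil, Proto.run₀_seq, Proto.run₀_call, Proto.run₀_loc, Proto.run₀_coin₁,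
        Proto.run₀_send₁, Source.joint]
      dsimp only [Proto.Seen₀, Proto.call]
      simp only [PMF.map, PMF.bind_bind, PMF.pure_bind, Function.comp_def]
    · simp only [Source.joint, PMF.map, PMF.bind_bind, PMF.pure_bind, Function.comp_def]
      rfl

end Protocol

/-! # Asymptotics -/

theorem PolySize.exists_comp {ι : ℕ → Type} {α β : ∀ κ, ι κ → Type} [∀ κ i, BitData (α κ i)]
    [∀ κ i, BitData (β κ i)] {f : ∀ κ i, α κ i → β κ i} (hf : PolySize f) :
    ∃ p : Polynomial ℕ, ∀ κ i, Comp (p.eval κ) (f κ i) ∧ bitLength (α κ i) ≤ p.eval κ := by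
  obtain ⟨p, hp⟩ := hf
  refine ⟨p, fun κ i => ?_⟩
  obtain ⟨C, h₁, h₂⟩ := hp κ i
  exact ⟨⟨C, by omega, h₂⟩, by omega⟩

theorem PolySampler.exists_samp {ι : ℕ → Type} {α β : ∀ κ, ι κ → Type} [∀ κ i, BitData (α κ i)]
    [∀ κ i, BitData (β κ i)] {F : ∀ κ i, α κ i → PMF (β κ i)} (hF : PolySampler F) :
    ∃ p : Polynomial ℕ, ∀ κ i, Samp (p.eval κ) (p.eval κ) (F κ i) ∧
      bitLength (α κ i) ≤ p.eval κ := by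
  obtain ⟨p, hp⟩ := hF
  refine ⟨p, fun κ i => ?_⟩
  obtain ⟨r, C, h₁, h₂⟩ := hp κ i
  exact ⟨⟨r, C, by omega, by omega, h₂⟩, by omega⟩

theorem PolySampler.of_samp {ι : ℕ → Type} {α β : ∀ κ, ι κ → Type} [∀ κ i, BitData (α κ i)]
    [∀ κ i, BitData (β κ i)] {F : ∀ κ i, α κ i → PMF (β κ i)} (p : Polynomial ℕ)
    (hF : ∀ κ i, Samp (p.eval κ) (p.eval κ) (F κ i)) (hα : ∀ κ i, bitLength (α κ i) ≤ p.eval κ) :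
    PolySampler F := by
  refine ⟨p + p + p, fun κ i => ?_⟩
  obtain ⟨r, C, h₁, h₂, h₃⟩ := hF κ i
  have := hα κ i
  refine ⟨r, C, ?_, h₃⟩
  simp only [Polynomial.eval_add]
  omega

/-- Negligible functions of the security parameter. -/
def Negligible (μ : ℕ → ℝ) : Prop :=
  Asymptotics.SuperpolynomialDecay Filter.atTop (fun κ : ℕ => (κ : ℝ)) μ

theorem Negligible.polynomial_mul {μ : ℕ → ℝ} (hμ : Negligible μ) (p : Polynomial ℕ) :
    Negligible fun κ => (p.eval κ : ℕ) * μ κ := by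
  have h := Asymptotics.SuperpolynomialDecay.polynomial_mul hμ (p.map (Nat.castRingHom ℝ))
  simpa [Negligible, Polynomial.eval_natCast_map] using h

theorem Negligible.abs {μ : ℕ → ℝ} (hμ : Negligible μ) : Negligible fun κ => |μ κ| := by
  have h := (Asymptotics.superpolynomialDecay_iff_superpolynomialDecay_abs _ _ _).1 hμ
  simpa [Negligible] using h

theorem Indist.exists_close {ι : ℕ → Type} {α : ∀ κ, ι κ → Type} [∀ κ i, BitData (α κ i)]
    {X Y : ∀ κ i, PMF (α κ i)} (h : Indist X Y) (p : Polynomial ℕ) :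
    ∃ μ, Negligible μ ∧ ∀ κ, 0 ≤ μ κ ∧ ∀ i, Close (p.eval κ) (μ κ) (X κ i) (Y κ i) := by
  obtain ⟨μ, h₁, h₂⟩ := h p
  exact ⟨fun κ => |μ κ|, Negligible.abs h₁, fun κ => ⟨abs_nonneg _, fun i D hD => (h₂ κ i D hD).trans (le_abs_self _)⟩⟩

/-- Output shares are tensors over powers of two, so uniform shares can be sampled exactly from
random bits. -/
theorem Network.encodeSurjective_gadget (N : Network) (s : N.Site) :
    EncodeSurjective (N.gadget s).H := by
  obtain ⟨j, s⟩ := s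
  change EncodeSurjective ((N.layer j).gadget s).H
  generalize N.layer j = a at s
  cases a with
  | linear w k o trunc truncProt => exact encodeSurjective_vec _ _
  | nonlinear a c fwd bwd fwdProt bwdProt =>
    cases s with
    | false => exact (encodeSurjective_vec _ _).prod (encodeSurjective_vec _ _)
    | true => exact encodeSurjective_vec _ _

variable {N : ℕ → Network} {E : ∀ κ, HEScheme (N κ).l}

/-- Merges the bounds of the hypotheses: one polynomial for shapes, one for costs, and for every
size of adversaries one negligible function that bounds the advantage against all primitives. -/
theorem exists_bounds (hN : EfficientTraining N) (hE : SecureHE E)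
    (hS : SecureOnShares (fun κ (s : (N κ).Site) => (N κ).gadget s)) :
    ∃ (ev : ∀ κ, EvalSim (E κ)) (sims : ∀ κ, ∀ s : (N κ).Site, GadgetSim ((N κ).gadget s))
      (q B : Polynomial ℕ),
      (∀ κ, (N κ).L ≤ q.eval κ ∧ (N κ).T ≤ q.eval κ) ∧
      (∀ κ, HEBound (E κ) (ev κ) (q.eval κ) (B.eval κ)) ∧
      (∀ κ, NetBound (N κ) (sims κ) (q.eval κ) (B.eval κ)) ∧
      ∀ p : Polynomial ℕ, ∃ μ, Negligible μ ∧ ∀ κ, 0 ≤ μ κ ∧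
        HEClose (E κ) (ev κ) (q.eval κ) (p.eval κ) (μ κ) ∧
        ∀ s, GadgetClose ((N κ).gadget s) (sims κ s) (p.eval κ) (μ κ) := by
  obtain ⟨q₀, hq⟩ := hN.bound
  obtain ⟨sim, hsim, hprivate⟩ := hE.eval_private
  obtain ⟨sim₂, hsim₂, hprivate₂⟩ := hE.eval₂_private
  obtain ⟨sim₀, hsim₀, hsecure₀⟩ := hS.secure₀
  obtain ⟨sim₁, hsim₁, hsecure₁⟩ := hS.secure₁
  -- The square accounts for the flattened matrices with `w * n` entries.
  let q : Polynomial ℕ := q₀ + q₀ * q₀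
  have hq' : ∀ κ, q.eval κ = q₀.eval κ + q₀.eval κ * q₀.eval κ := fun κ => by simp [q]
  obtain ⟨p₁, h₁⟩ := hE.gen_eff.exists_comp
  obtain ⟨p₂, h₂⟩ := (hE.enc_eff q).exists_comp
  obtain ⟨p₃, h₃⟩ := (hE.dec_eff q).exists_comp
  obtain ⟨p₄, h₄⟩ := (hE.eval_eff q).exists_comp
  obtain ⟨p₅, h₅⟩ := (hE.eval₂_eff q).exists_comp
  obtain ⟨p₆, h₆⟩ := (hsim q).exists_samp
  obtain ⟨p₇, h₇⟩ := (hsim₂ q).exists_samp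
  obtain ⟨p₈, h₈⟩ := hsim₀.exists_samp
  obtain ⟨p₉, h₉⟩ := hsim₁.exists_samp
  obtain ⟨p₁₀, h₁₀⟩ := hN.loss_eff.exists_comp
  obtain ⟨p₁₁, h₁₁⟩ := hN.update_eff.exists_comp
  -- The term `q * q` bounds the bits of a vector and `q * (q * q)` those of a matrix; the `pᵢ`
  -- bound circuits and their inputs.
  let B : Polynomial ℕ := 1 + q * q + q * (q * q) + p₁ + p₂ + p₃ + p₄ + p₅ + p₆ + p₇ + p₈ + p₉ +
    p₁₀ + p₁₁
  have hB : ∀ κ, B.eval κ = 1 + q.eval κ * q.eval κ + q.eval κ * (q.eval κ * q.eval κ) +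
      p₁.eval κ + p₂.eval κ + p₃.eval κ + p₄.eval κ + p₅.eval κ + p₆.eval κ + p₇.eval κ +
      p₈.eval κ + p₉.eval κ + p₁₀.eval κ + p₁₁.eval κ := fun κ => by
    simp [B]
  clear_value q B
  refine ⟨fun κ => ⟨sim κ, sim₂ κ⟩, fun κ s => ⟨sim₀ κ s, sim₁ κ s⟩, q, B, fun κ => ?_, fun κ => ?_,
    fun κ => ?_, fun p => ?_⟩
  · have := hq κ
    have := hq' κ
    omega
  · have hl : (N κ).l ≤ q.eval κ := by
      have := hq κ
      have := hq' κ
      omega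
    have hB := hB κ
    have b₁ := (h₁ κ ()).2
    have b₂ := (h₁ κ ()).1.bitLength_le
    simp only [bitLength_prod, bitLength_fin, bitLength_bool, mul_one] at b₁ b₂
    refine
      { one_le := by omega
        genCoins_le := by omega
        pkLen_le := by omega
        skLen_le := by omega
        vec_le := fun n hn => (Nat.mul_le_mul hn hl).trans (by omega)
        mat_le := fun n hn m hm => (Nat.mul_le_mul hm (Nat.mul_le_mul hn hl)).trans (by omega)
        encCoins_le := fun n hn => ?_
        ctLen_le := fun n hn => ?_
        evalCoins_le := fun n hn m hm => ?_
        eval₂Coins_le := fun n hn n' hn' m hm => ?_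
        gen := (h₁ κ ()).1.mono (by omega)
        enc := fun n hn => (h₂ κ ⟨n, hn⟩).1.mono (by omega)
        dec := fun n hn => (h₃ κ ⟨n, hn⟩).1.mono (by omega)
        eval := fun n hn m hm => (h₄ κ ⟨(n, m), hn, hm⟩).1.mono (by omega)
        eval₂ := fun n hn n' hn' m hm => (h₅ κ ⟨(n, n', m), hn, hn', hm⟩).1.mono (by omega)
        sim := fun n hn m hm => (h₆ κ ⟨(n, m), hn, hm⟩).1.mono (by omega) (by omega)
        sim₂ := fun n hn n' hn' m hm =>
          (h₇ κ ⟨(n, n', m), hn, hn', hm⟩).1.mono (by omega) (by omega)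
        dec_eval := hE.dec_eval κ
        dec_eval₂ := hE.dec_eval₂ κ }
    · have := (h₂ κ ⟨n, hn⟩).2
      simp only [bitLength_prod, bitLength_fin, bitLength_bool, mul_one] at this
      omega
    · have := (h₂ κ ⟨n, hn⟩).1.bitLength_le
      simp only [bitLength_fin, bitLength_bool, mul_one] at this
      omega
    · have := (h₄ κ ⟨(n, m), hn, hm⟩).2
      simp only [bitLength_prod, bitLength_fin, bitLength_bool, mul_one] at this
      omega
    · have := (h₅ κ ⟨(n, n', m), hn, hn', hm⟩).2
      simp only [bitLength_prod, bitLength_fin, bitLength_bool, mul_one] at this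
      omega
  · obtain ⟨a₁, a₂, a₃, a₄, a₅, a₆⟩ := hq κ
    have hq' := hq' κ
    have hB := hB κ
    refine ⟨by omega, fun j hj => (a₅ j hj).trans (by omega), fun j hj => ?_,
      (h₁₀ κ ()).1.mono (by omega), fun τ hτ => (h₁₁ κ ⟨τ, hτ⟩).1.mono (by omega)⟩
    obtain ⟨c₁, c₂⟩ := a₆ j hj
    have c₃ := a₅ j (by omega)
    have c₄ := a₅ (j + 1) (by omega)
    have c₅ := Nat.mul_le_mul c₁ c₄
    refine ⟨by omega, by omega, by omega, by omega, by omega, fun s => ⟨?_, ?_, ?_, ?_, ?_⟩⟩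
    · have := (h₈ κ ⟨⟨j, hj⟩, s⟩).2
      rw [bitLength_prod] at this
      exact this.trans (by omega)
    · exact (h₈ κ ⟨⟨j, hj⟩, s⟩).1.mono (by omega) (by omega)
    · exact (h₉ κ ⟨⟨j, hj⟩, s⟩).1.mono (by omega) (by omega)
    · exact (N κ).encodeSurjective_gadget ⟨⟨j, hj⟩, s⟩
    · exact hS.correct κ ⟨⟨j, hj⟩, s⟩
  · obtain ⟨μ₁, n₁, m₁⟩ := (hE.indist q).exists_close p
    obtain ⟨μ₂, n₂, m₂⟩ := (hprivate q).exists_close p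
    obtain ⟨μ₃, n₃, m₃⟩ := (hprivate₂ q).exists_close p
    obtain ⟨μ₄, n₄, m₄⟩ := hsecure₀.exists_close p
    obtain ⟨μ₅, n₅, m₅⟩ := hsecure₁.exists_close p
    refine ⟨fun κ => μ₁ κ + μ₂ κ + μ₃ κ + μ₄ κ + μ₅ κ,
      (((n₁.add n₂).add n₃).add n₄).add n₅, fun κ => ?_⟩
    obtain ⟨z₁, m₁⟩ := m₁ κ
    obtain ⟨z₂, m₂⟩ := m₂ κ
    obtain ⟨z₃, m₃⟩ := m₃ κ
    obtain ⟨z₄, m₄⟩ := m₄ κ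
    obtain ⟨z₅, m₅⟩ := m₅ κ
    refine ⟨by positivity, ⟨fun n hn x y => ?_, fun n hn m hm x A c => ?_,
      fun n hn n' hn' m hm x y A A' c => ?_⟩, fun s => ⟨fun x₀ x₁ => ?_, fun x₀ x₁ => ?_⟩⟩
    · exact (m₁ ⟨⟨n, hn⟩, x, y⟩).mono le_rfl (by linarith)
    · exact (m₂ ⟨⟨(n, m), hn, hm⟩, x, A, c⟩).mono le_rfl (by linarith)
    · exact (m₃ ⟨⟨(n, n', m), hn, hn', hm⟩, x, y, A, A', c⟩).mono le_rfl (by linarith)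
    · exact (m₄ ⟨s, x₀, x₁⟩).mono le_rfl (by linarith)
    · exact (m₅ ⟨s, x₀, x₁⟩).mono le_rfl (by linarith)

/-- An adversary of size `p` yields one of size `p + C` against the primitives, and a polynomial
multiple of a negligible function is negligible. -/
theorem Indist.of_close {ι : ℕ → Type} {α : ∀ κ, ι κ → Type} [∀ κ i, BitData (α κ i)]
    {X Y : ∀ κ i, PMF (α κ i)} {Base : ∀ _ : ℕ, ℕ → ℝ → Prop} (C n : Polynomial ℕ)
    (hBase : ∀ p : Polynomial ℕ, ∃ μ, Negligible μ ∧ ∀ κ, 0 ≤ μ κ ∧ Base κ (p.eval κ) (μ κ))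
    (h : ∀ κ S ε, 0 ≤ ε → Base κ S ε → ∀ i s, s + C.eval κ ≤ S →
      Close s ((n.eval κ : ℕ) * ε) (X κ i) (Y κ i)) : Indist X Y := by
  intro p
  obtain ⟨μ, h₁, h₂⟩ := hBase (p + C)
  refine ⟨_, h₁.polynomial_mul n, fun κ i D hD => ?_⟩
  exact h κ _ _ (h₂ κ).1 (h₂ κ).2 i (p.eval κ) (by simp) D hD

end Pencil

end

/-! ### Assembly over all security parameters. -/

theorem theorem1 (N : ℕ → Pencil.Network) (E : ∀ κ, Pencil.HEScheme (N κ).l)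
    (hN : Pencil.EfficientTraining N) (hE : Pencil.SecureHE E)
    (hS : Pencil.SecureOnShares (fun κ (s : (N κ).Site) => (N κ).gadget s)) :
    Pencil.IsCryptographicTrainingProtocol (fun κ => Pencil.pencil (N κ) (E κ))
      (fun κ => (N κ).train) := by
  open Pencil in
  obtain ⟨ev, sims, q, B, hq, hb, hn, hBase⟩ := exists_bounds hN hE hS
  let Base : ℕ → ℕ → ℝ → Prop := fun κ S ε => HEClose (E κ) (ev κ) (q.eval κ) S ε ∧
    ∀ s, GadgetClose ((N κ).gadget s) (sims κ s) S ε
  have hR : ∀ κ, 1000000 * (((N κ).L + 1) ^ 3 * B.eval κ) ≤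
      (1000000 * ((q + 1) ^ 3 * B) : Polynomial ℕ).eval κ := fun κ => by
    have := (hq κ).1
    simp only [Polynomial.eval_mul, Polynomial.eval_pow, Polynomial.eval_add, Polynomial.eval_one,
      Polynomial.eval_ofNat]
    gcongr
  generalize (1000000 * ((q + 1) ^ 3 * B) : Polynomial ℕ) = R at hR
  let C : Polynomial ℕ := 200000 * ((q + 1) ^ 3 * R)
  have hC : ∀ κ, 200000 * (((N κ).T + 1) ^ 3 * R.eval κ) ≤ C.eval κ := fun κ => by
    have := (hq κ).2
    simp only [C, Polynomial.eval_mul, Polynomial.eval_pow, Polynomial.eval_add,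
      Polynomial.eval_one, Polynomial.eval_ofNat]
    gcongr
  have hC' : ∀ κ, 200 * (((N κ).T + 1) ^ 2 * R.eval κ) ≤ C.eval κ := fun κ => by
    refine le_trans ?_ (hC κ)
    gcongr <;> omega
  have hn' : ∀ κ, 5 * ((N κ).L * (N κ).T) ≤ (5 * (q * q) : Polynomial ℕ).eval κ := fun κ => by
    have := hq κ
    simp only [Polynomial.eval_mul, Polynomial.eval_ofNat]
    gcongr <;> omega
  have hout : ∀ κ M D, (pencil (N κ) (E κ)).outLaw M D = PMF.pure ((N κ).train M D) :=
    fun κ M D => outLaw_pencil (Base := Base κ) (hb κ) (fun S ε h => h.1) (hn κ)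
      (fun S ε h => h.2) M D
  choose sim₀ h₀ l₀ c₀ using fun κ => view₀_pencil (Base := Base κ) (hb κ) (fun S ε h => h.1) (hn κ)
    (fun S ε h => h.2) (hR κ)
  choose sim₁ h₁ l₁ c₁ using fun κ => view₁_pencil (Base := Base κ) (hb κ) (fun S ε h => h.1) (hn κ)
    (fun S ε h => h.2) (hR κ)
  refine ⟨hout, ⟨fun κ _ => sim₀ κ, .of_samp C (fun κ _ => (h₀ κ).mono (hC' κ) (hC κ))
    (fun κ _ => (l₀ κ).trans (hC' κ)), ?_⟩, ⟨fun κ _ => sim₁ κ, .of_samp C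
      (fun κ _ => (h₁ κ).mono (hC' κ) (hC κ)) (fun κ _ => (l₁ κ).trans ?_), ?_⟩⟩
  · refine Indist.of_close (Base := Base) C (5 * (q * q)) hBase fun κ S ε hε hS i s hs => ?_
    -- The outputs are deterministic, so the simulator is run on the result of plaintext training.
    rw [hout, PMF.pure_bind]
    exact (c₀ κ S ε hε hS i.1 i.2 s (by have := hC κ; omega)).mono le_rfl (by
      have := hn' κ
      gcongr)
  · have := hC' κ
    omega
  · refine Indist.of_close (Base := Base) C (5 * (q * q)) hBase fun κ S ε hε hS i s hs => ?_
    rw [hout, PMF.pure_bind]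
    exact (c₁ κ S ε hε hS i.1 i.2 s (by have := hC κ; omega)).mono le_rfl (by
      have := hn' κ
      gcongr)
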